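/- **Theorem 3.12.** Let $N\ge 2$, $m\ge 2$ be integers, let $1<p<\infty$ and $\rho>0$. There is a constant $c=c(\rho,m,N,p)>0$ with the following property. Let $b^-<b^+$, $\Omega=\{x=(x',x_N)\in\mathbb{R}^{N-1}\times\mathbb{R} : b^-<x_N<b^+\}$, $\Gamma^\pm=\{x_N=b^\pm\}$, and let $a>0$ satisfy $a\ge\rho\,(b^+-b^-)$. Consider functions $f_k^\pm\in W^{m-1-k,p}_{\mathrm{loc}}(\mathbb{R}^{N-1})$, $k=0,\dots,m-1$ (where $W^{0,p}_{\mathrm{loc}}=L^p_{\mathrm{loc}}$), and for integers $i,n\ge0$ with $n+i\le m-1$ put $$Q_{i,m,n}(x')=\sum_{k=0}^{m-i-n-1}\frac{(-1)^k}{k!}\Big(\nabla_\parallel^i f_{k+n}^+(x')+(-1)^{k+1}\nabla_\parallel^i f_{k+n}^-(x')\Big)\Big(\frac{b^+-b^-}{2}\Big)^k ,$$ where $\nabla_\parallel^i$ is the vector of all weak partial derivatives of order $i$ in $x'$. Call the data $(f_k^\pm)_{k}$ admissible if $$\int_{\mathbb{R}^{N-1}}|Q_{i,m,n}|^p\,dx'<\infty\quad\text{for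 all } i,n\ge 0 \text{ with } n+i\le m-1,$$ $$S_k^\pm:=\int_{\mathbb{R}^{N-1}}\int_{\{h'\in\mathbb{R}^{N-1}:\,|h'|<a\}}\frac{|\nabla_\parallel^{m-k-1}f_k^\pm(x'+h')-\nabla_\parallel^{m-k-1}f_k^\pm(x')|^p}{|h'|^{p+N-2}}\,dh'\,dx'<\infty\quad\text{for } k=0,\dots,m-1 .$$ Then there is a linear map $(f_0^-,\dots,f_{m-1}^-,f_0^+,\dots,f_{m-1}^+)\mapsto u$ which sends every admissible family of data to a function $u\in\dot W^{m,p}(\Omega)$ (that is, $u\in L^1_{\mathrm{loc}}(\Omega)$ and all weak derivatives of $u$ of order $m$ belong to $L^p(\Omega)$) such that $\operatorname{Tr}(\partial_N^k u)=f_k^\pm$ on $\Gamma^\pm$ for $k=0,\dots,m-1$ and $$\int_\Omega|\nabla^m u|^p\,dx\le c\sum_{n=0}^{m-1}\sum_{i=0}^{m-1-n}(b^+-b^-)^{(n+i-m)p+1}\int_{\mathbb{R}^{N-1}}|Q_{i,m,n}|^p\,dx'+c\sum_{k=0}^{m-1}S_k^-+c\sum_{k=0}^{m-1}S_k^+ .$$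 Here $\nabla^m u$ is the vector of all weak partial derivatives of $u$ of order $m$. The trace of a function $v$ on $\Omega$ that belongs to $W^{1,p}$ of every bounded part of $\Omega$ is the function $\operatorname{Tr}v\in L^p_{\mathrm{loc}}(\partial\Omega)$ with $\int_\Omega v\,\partial_i\psi\,dx=-\int_\Omega\psi\,\partial_i v\,dx+\int_{\partial\Omega}\psi\operatorname{Tr}(v)\,\nu_i\,d\mathcal H^{N-1}$ for all $\psi\in C^1_c(\mathbb{R}^N)$ and $i=1,\dots,N$, where $\nu$ is the outward unit normal. -/

import Mathlib

open MeasureTheory Set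
open scoped ENNReal ContDiff

noncomputable section

/-- The horizontal space `ℝ^d`; here `d = N - 1`. -/
abbrev HorSpace (d : ℕ) : Type := EuclideanSpace ℝ (Fin d)

/-- The full space `ℝ^N = ℝ^d × ℝ`, with points `x = (x', x_N)`, with Lebesgue measure. -/
abbrev FullSpace (d : ℕ) : Type := EuclideanSpace ℝ (Fin d) × ℝ

/-- The standard basis of `ℝ^d`. -/
def hBasis (d : ℕ) : Fin d → HorSpace d := fun i => EuclideanSpace.single i 1

/-- The standard basis of `ℝ^N = ℝ^d × ℝ`; the last vector is the vertical one. -/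
def fBasis (d : ℕ) : Fin (d + 1) → FullSpace d :=
  Fin.lastCases ((0, 1) : FullSpace d) (fun i => (hBasis d i, 0))

/-- The horizontal strip `{x ∈ ℝ^N : b⁻ < x_N < b⁺}`. -/
def strip (d : ℕ) (bm bp : ℝ) : Set (FullSpace d) := {x | bm < x.2 ∧ x.2 < bp}

/-- The multi-indices `α ∈ ℕ^n` of length `|α| = k`. -/
def multiIdx (n k : ℕ) : Finset (Fin n → ℕ) := Finset.piAntidiag Finset.univ k

/-- The list of directions of `∂^α`: the vector `e i` is repeated `α i` times. -/
def dirList {E : Type*} {n : ℕ} (e : Fin n → E) (α : Fin n → ℕ) : List E :=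
  (List.finRange n).flatMap (fun i => List.replicate (α i) (e i))

section Weak

variable {E : Type*} [NormedAddCommGroup E] [NormedSpace ℝ E]

/-- Classical iterated directional derivative along a list of vectors. -/
def iterDirDeriv : List E → (E → ℝ) → E → ℝ
  | [], φ => φ
  | v :: L, φ => fun x => fderiv ℝ (iterDirDeriv L φ) x v

variable [MeasureSpace E] {n : ℕ}

/-- `g` is the weak partial derivative `∂^α f` on the open set `U`, the coordinates being those
of the basis `e`. -/
def HasWeakPartial (e : Fin n → E) (U : Set E) (α : Fin n → ℕ) (f g : E → ℝ) : Prop :=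
  LocallyIntegrableOn f U volume ∧ LocallyIntegrableOn g U volume ∧
    ∀ φ : E → ℝ, ContDiff ℝ ∞ φ → HasCompactSupport φ → tsupport φ ⊆ U →
      ∫ x in U, f x * iterDirDeriv (dirList e α) φ x =
        (-1) ^ (∑ i, α i) * ∫ x in U, g x * φ x

open Classical in
/-- The weak partial derivative `∂^α f` on `U` (unique up to null sets); it is set to `0` if it
does not exist. -/
def weakPartial (e : Fin n → E) (U : Set E) (α : Fin n → ℕ) (f : E → ℝ) : E → ℝ :=
  if h : ∃ g, HasWeakPartial e U α f g then h.choose else 0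

/-- The homogeneous Sobolev space `Ẇ^{m,p}(U)`: all `u ∈ L¹_loc(U)` whose weak partial
derivatives of order exactly `m` exist and belong to `L^p(U)`. -/
def MemHomSobolev (e : Fin n → E) (U : Set E) (m : ℕ) (p : ℝ) (u : E → ℝ) : Prop :=
  LocallyIntegrableOn u U volume ∧
    ∀ α ∈ multiIdx n m, ∃ g, HasWeakPartial e U α u g ∧
      MemLp g (ENNReal.ofReal p) (volume.restrict U)

/-- `∫_U |∇^m u|^p`, where `∇^m u` is the vector of all `∂^α u` with `|α| = m`. -/
def gradEnergy (e : Fin n → E) (U : Set E) (m : ℕ) (p : ℝ) (u : E → ℝ) : ℝ≥0∞ :=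
  ∫⁻ x in U, ENNReal.ofReal
    (Real.sqrt (∑ α ∈ multiIdx n m, weakPartial e U α u x ^ 2) ^ p)

/-- `f ∈ L^p_loc`, on the whole space. -/
def MemLpLoc (p : ℝ) (f : E → ℝ) : Prop :=
  ∀ K : Set E, IsCompact K → MemLp f (ENNReal.ofReal p) (volume.restrict K)

/-- `f ∈ W^{k,p}_loc`, on the whole space. For `k = 0` this is `L^p_loc`. -/
def MemSobolevLoc (e : Fin n → E) (k : ℕ) (p : ℝ) (f : E → ℝ) : Prop :=
  MemLpLoc p f ∧ ∀ j ≤ k, ∀ α ∈ multiIdx n j, ∃ g, HasWeakPartial e univ α f g ∧ MemLpLoc p g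

end Weak

section Data

variable {d : ℕ}

/-- The horizontal weak partial derivative `∂^β f` on all of `ℝ^d`. -/
def hPartial (β : Fin d → ℕ) (f : HorSpace d → ℝ) : HorSpace d → ℝ :=
  weakPartial (hBasis d) univ β f

/-- `∫_{ℝ^d} ∫_{B'(0,a)} |∇_∥^j f(x'+h') - ∇_∥^j f(x')|^p / |h'|^{p+N-2} dh' dx'`,
with `N - 2 = d - 1`. -/
def screenedEnergy (p a : ℝ) (j : ℕ) (f : HorSpace d → ℝ) : ℝ≥0∞ :=
  ∫⁻ x : HorSpace d, ∫⁻ h in Metric.ball (0 : HorSpace d) a, ENNReal.ofReal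
    (Real.sqrt (∑ β ∈ multiIdx d j, (hPartial β f (x + h) - hPartial β f x) ^ 2) ^ p
      / ‖h‖ ^ (p + d - 1))

/-- The `β`-component (`|β| = i`) of
`Q_{i,m,n} = ∑_{k=0}^{m-i-n-1} (-1)^k/k! (∇_∥^i f⁺_{k+n} + (-1)^{k+1} ∇_∥^i f⁻_{k+n}) (b/2)^k`,
with `b` the width of the strip. -/
def Qcomp {m : ℕ} (b : ℝ) (i n : ℕ) (fm fp : Fin m → HorSpace d → ℝ) (β : Fin d → ℕ)
    (x : HorSpace d) : ℝ :=
  ∑ k : Fin (m - i - n), (-1 : ℝ) ^ (k : ℕ) / ((k : ℕ).factorial : ℝ) *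
    (hPartial β (fp ⟨k + n, by have := k.isLt; omega⟩) x
      + (-1 : ℝ) ^ ((k : ℕ) + 1) * hPartial β (fm ⟨k + n, by have := k.isLt; omega⟩) x)
    * (b / 2) ^ (k : ℕ)

/-- `∫_{ℝ^d} |Q_{i,m,n}|^p`. -/
def Qenergy {m : ℕ} (p b : ℝ) (i n : ℕ) (fm fp : Fin m → HorSpace d → ℝ) : ℝ≥0∞ :=
  ∫⁻ x : HorSpace d, ENNReal.ofReal
    (Real.sqrt (∑ β ∈ multiIdx d i, Qcomp b i n fm fp β x ^ 2) ^ p)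

/-- The hypotheses on the boundary data `f_k^±`, `k = 0, …, m-1`: local regularity, the
compatibility conditions, and finiteness of the screened seminorms. -/
structure AdmissibleData {m : ℕ} (p a b : ℝ) (fm fp : Fin m → HorSpace d → ℝ) : Prop where
  regular_minus : ∀ k : Fin m, MemSobolevLoc (hBasis d) (m - 1 - k) p (fm k)
  regular_plus : ∀ k : Fin m, MemSobolevLoc (hBasis d) (m - 1 - k) p (fp k)
  compatible : ∀ i n : ℕ, n + i ≤ m - 1 → Qenergy p b i n fm fp < ⊤
  screened_minus : ∀ k : Fin m, screenedEnergy p a (m - 1 - k) (fm k) < ⊤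
  screened_plus : ∀ k : Fin m, screenedEnergy p a (m - 1 - k) (fp k) < ⊤

/-- `Tr v = g⁻` on `Γ⁻` and `Tr v = g⁺` on `Γ⁺`, for a function `v` that is in `W^{1,p}` of
every bounded part of the strip: the trace is the function in `L^p_loc(∂Ω)` for which
`∫_Ω v ∂_i ψ = - ∫_Ω ψ ∂_i v + ∫_{∂Ω} ψ (Tr v) ν_i` for all `ψ ∈ C¹_c(ℝ^N)` and all `i`,
where `ν = ± e_N` on `Γ^±`. This determines `g^±` up to null sets. -/
def HasTrace (bm bp p : ℝ) (v : FullSpace d → ℝ) (gm gp : HorSpace d → ℝ) : Prop :=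
  (∀ R : ℝ, MemLp v (ENNReal.ofReal p)
    (volume.restrict (strip d bm bp ∩ Metric.closedBall 0 R))) ∧
  MemLpLoc p gm ∧ MemLpLoc p gp ∧
  ∀ i : Fin (d + 1), ∃ w : FullSpace d → ℝ,
    HasWeakPartial (fBasis d) (strip d bm bp) (Pi.single i 1) v w ∧
    (∀ R : ℝ, MemLp w (ENNReal.ofReal p)
      (volume.restrict (strip d bm bp ∩ Metric.closedBall 0 R))) ∧
    ∀ ψ : FullSpace d → ℝ, ContDiff ℝ 1 ψ → HasCompactSupport ψ →
      ∫ x in strip d bm bp, v x * fderiv ℝ ψ x (fBasis d i) =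
        - (∫ x in strip d bm bp, ψ x * w x)
        + (if i = Fin.last d then 1 else 0) *
            ((∫ x' : HorSpace d, ψ (x', bp) * gp x') - ∫ x' : HorSpace d, ψ (x', bm) * gm x')

/-- `Tr(∂_N^k u) = g^±` on `Γ^±`. -/
def HasNormalTrace (bm bp p : ℝ) (k : ℕ) (u : FullSpace d → ℝ) (gm gp : HorSpace d → ℝ) : Prop :=
  ∃ v : FullSpace d → ℝ,
    HasWeakPartial (fBasis d) (strip d bm bp) (Pi.single (Fin.last d) k) u v ∧
    HasTrace bm bp p v gm gp

end Data

end

/-! Write b for the width of the strip. The data on each face are extended into the strip by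
mollification at a scale equal to the distance t from the face. The building block is the layer t^k
(f_k ∗ ψ_t), where ψ has mass 1 and ψ_t lives on the ball of radius ρt. The extension of the whole
family sums these layers at the dilated heights λ_j t, λ_j = 1/(j+1), with coefficients c_kj / k!,
where c is the inverse of the Vandermonde matrix of the λ_j. In the trace of an n-th normal
derivative the dilation contributes λ_j^n, so Σ_j c_kj λ_j^n = δ_kn removes every layer except the
n-th, whose trace is n! f_n. The traces of the other layers need not vanish by themselves; only the
combination is exact (`ae_tendsto_wordDeriv_halfExt`).

Energy of one side. Of the m derivatives of t^k (f_k ∗ ψ_t), k are used to remove the factor t^k,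
m-1-k are moved onto f_k, and the last one falls on the kernel. It costs 1/t and leaves a kernel χ
of mean zero. Hence g(x') may be subtracted from g = ∂^γ f_k for free, and Hölder and Tonelli bound
the p-th power integral of t^{-1}(g ∗ χ_t) by the difference-quotient energy of g with weight
|h|^{-(p+N-2)} (`lintegral_avg_le`). Only |h| < ρb ≤ a occurs, and the constant does not see b.

Gluing. Let u⁻, u⁺ be the extensions from the two faces and θ a cutoff in x_N at scale b; put u = u⁺
+ θ(u⁻ - u⁺). By the Leibniz rule ∇^m u is controlled by ∇^m u⁺ and by the terms b^{|v|-m} ∂^v(u⁻ -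
u⁺) with |v| ≤ m. For |v| < m each ∂^v u^± is Taylor expanded in x_N from its own face. The two
polynomials, re-expanded about the middle of the strip, differ by a polynomial whose coefficients
are the components of Q, and the remainders are bounded by b^{m-|v|} times energies of order m. All
powers of b match (`lintegral_sub_le_of_taylor`, `weighted_lintegral_sub_lt_order`).

Inside the strip u is smooth, so its weak derivatives are classical. The traces, which are defined
through integration by parts, follow from the almost everywhere limits along vertical lines by the
fundamental theorem of calculus (`hasTrace_of_contDiffOn`). -/

noncomputable section

set_option linter.unusedSectionVars false

/-! ### Iterated directional derivatives of smooth functions -/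

section IterDirDeriv

variable {E : Type*} [NormedAddCommGroup E] [NormedSpace ℝ E]

theorem ContDiffOn.fderiv_apply_const {U : Set E} (hU : IsOpen U) {f : E → ℝ}
    (hf : ContDiffOn ℝ ∞ f U) (v : E) : ContDiffOn ℝ ∞ (fun x => fderiv ℝ f x v) U :=
  (hf.fderiv_of_isOpen hU (by simp)).clm_apply contDiffOn_const

theorem iterDirDeriv_contDiffOn {U : Set E} (hU : IsOpen U) {f : E → ℝ}
    (hf : ContDiffOn ℝ ∞ f U) (L : List E) : ContDiffOn ℝ ∞ (iterDirDeriv L f) U := by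
  induction L with
  | nil => exact hf
  | cons v L ih => exact ih.fderiv_apply_const hU v

theorem iterDirDeriv_contDiff {f : E → ℝ} (hf : ContDiff ℝ ∞ f) (L : List E) :
    ContDiff ℝ ∞ (iterDirDeriv L f) :=
  contDiffOn_univ.1 (iterDirDeriv_contDiffOn isOpen_univ hf.contDiffOn L)

theorem ContDiffOn.differentiableAt_of_isOpen {U : Set E} (hU : IsOpen U) {f : E → ℝ}
    (hf : ContDiffOn ℝ ∞ f U) {x : E} (hx : x ∈ U) : DifferentiableAt ℝ f x :=
  (hf.differentiableOn (by simp)).differentiableAt (hU.mem_nhds hx)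

theorem fderiv_eqOn_of_isOpen {U : Set E} (hU : IsOpen U) {f g : E → ℝ} (h : EqOn f g U) {x : E}
    (hx : x ∈ U) : fderiv ℝ f x = fderiv ℝ g x :=
  Filter.EventuallyEq.fderiv_eq (h.eventuallyEq_of_mem (hU.mem_nhds hx))

theorem iterDirDeriv_congr {U : Set E} (hU : IsOpen U) {f g : E → ℝ} (h : EqOn f g U)
    (L : List E) : EqOn (iterDirDeriv L f) (iterDirDeriv L g) U := by
  induction L with
  | nil => exact h
  | cons v L ih =>
    intro x hx
    change fderiv ℝ (iterDirDeriv L f) x v = fderiv ℝ (iterDirDeriv L g) x v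
    rw [fderiv_eqOn_of_isOpen hU ih hx]

theorem iterDirDeriv_append (L₁ L₂ : List E) (f : E → ℝ) :
    iterDirDeriv (L₁ ++ L₂) f = iterDirDeriv L₁ (iterDirDeriv L₂ f) := by
  induction L₁ with
  | nil => rfl
  | cons v L ih =>
    change (fun x => fderiv ℝ (iterDirDeriv (L ++ L₂) f) x v) = _
    rw [ih]; rfl

theorem fderiv_fderiv_comm {U : Set E} (hU : IsOpen U) {f : E → ℝ} (hf : ContDiffOn ℝ ∞ f U)
    {x : E} (hx : x ∈ U) (v w : E) :
    fderiv ℝ (fun y => fderiv ℝ f y v) x w = fderiv ℝ (fun y => fderiv ℝ f y w) x v := by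
  have h2 : ContDiffAt ℝ 2 f x :=
    (hf.contDiffAt (hU.mem_nhds hx)).of_le (by norm_cast)
  have hs : IsSymmSndFDerivAt ℝ f x := h2.isSymmSndFDerivAt (by simp)
  have hd : DifferentiableAt ℝ (fderiv ℝ f) x :=
    ((hf.fderiv_of_isOpen hU (m := ∞) (by simp)).differentiableOn (by simp)).differentiableAt
      (hU.mem_nhds hx)
  rw [fderiv_clm_apply hd (by fun_prop), fderiv_clm_apply hd (by fun_prop)]
  simpa using hs w v

/-- Symmetry of the second derivative handles one transposition, and transpositions generate all
permutations. This is what allows multi-indices, lists of directions and words to be exchanged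
freely. -/
theorem iterDirDeriv_perm {U : Set E} (hU : IsOpen U) {f : E → ℝ} (hf : ContDiffOn ℝ ∞ f U)
    {L₁ L₂ : List E} (h : L₁.Perm L₂) : EqOn (iterDirDeriv L₁ f) (iterDirDeriv L₂ f) U := by
  induction h with
  | nil => exact fun _ _ => rfl
  | cons v _ ih =>
    intro x hx
    change fderiv ℝ _ x v = fderiv ℝ _ x v
    rw [fderiv_eqOn_of_isOpen hU ih hx]
  | swap v w L =>
    intro x hx
    exact fderiv_fderiv_comm hU (iterDirDeriv_contDiffOn hU hf L) hx v w
  | trans _ _ ih₁ ih₂ => exact ih₁.trans ih₂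

theorem iterDirDeriv_add {U : Set E} (hU : IsOpen U) {f g : E → ℝ} (hf : ContDiffOn ℝ ∞ f U)
    (hg : ContDiffOn ℝ ∞ g U) (L : List E) :
    EqOn (iterDirDeriv L (fun x => f x + g x))
      (fun x => iterDirDeriv L f x + iterDirDeriv L g x) U := by
  induction L with
  | nil => exact fun _ _ => rfl
  | cons v L ih =>
    intro x hx
    change fderiv ℝ _ x v = fderiv ℝ _ x v + fderiv ℝ _ x v
    rw [fderiv_eqOn_of_isOpen hU ih hx, fderiv_fun_add
      ((iterDirDeriv_contDiffOn hU hf L).differentiableAt_of_isOpen hU hx)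
      ((iterDirDeriv_contDiffOn hU hg L).differentiableAt_of_isOpen hU hx)]
    rfl

theorem iterDirDeriv_const_mul {U : Set E} (hU : IsOpen U) {f : E → ℝ} (c : ℝ)
    (hf : ContDiffOn ℝ ∞ f U) (L : List E) :
    EqOn (iterDirDeriv L (fun x => c * f x)) (fun x => c * iterDirDeriv L f x) U := by
  induction L with
  | nil => exact fun _ _ => rfl
  | cons v L ih =>
    intro x hx
    change fderiv ℝ _ x v = c * fderiv ℝ _ x v
    rw [fderiv_eqOn_of_isOpen hU ih hx, fderiv_const_mul
      ((iterDirDeriv_contDiffOn hU hf L).differentiableAt_of_isOpen hU hx)]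
    rfl

theorem iterDirDeriv_zero (L : List E) : iterDirDeriv L (fun _ => (0 : ℝ)) = fun _ => 0 := by
  induction L with
  | nil => rfl
  | cons v L ih =>
    funext x
    change fderiv ℝ (iterDirDeriv L _) x v = 0
    rw [ih]; simp

theorem iterDirDeriv_sum {ι : Type*} {U : Set E} (hU : IsOpen U) (s : Finset ι) {f : ι → E → ℝ}
    (hf : ∀ i ∈ s, ContDiffOn ℝ ∞ (f i) U) (L : List E) :
    EqOn (iterDirDeriv L (fun x => ∑ i ∈ s, f i x))
      (fun x => ∑ i ∈ s, iterDirDeriv L (f i) x) U := by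
  classical
  induction s using Finset.induction_on with
  | empty => intro x _; simp [iterDirDeriv_zero]
  | insert a s ha ih =>
    intro x hx
    simp only [Finset.sum_insert ha]
    rw [iterDirDeriv_add hU (hf a (by simp))
      (ContDiffOn.sum fun i hi => hf i (by simp [hi])) L hx]
    simp only
    rw [ih (fun i hi => hf i (by simp [hi])) hx]

theorem iterDirDeriv_tsupport_subset (f : E → ℝ) (L : List E) :
    tsupport (iterDirDeriv L f) ⊆ tsupport f := by
  induction L with
  | nil => exact subset_rfl
  | cons v L ih =>
    refine subset_trans ?_ ih
    refine closure_minimal ?_ (isClosed_tsupport _)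
    intro x hx
    by_contra hc
    apply hx
    change fderiv ℝ (iterDirDeriv L f) x v = 0
    have : fderiv ℝ (iterDirDeriv L f) x = 0 := by
      by_contra h0
      exact hc (support_fderiv_subset ℝ h0)
    simp [this]

theorem iterDirDeriv_hasCompactSupport {f : E → ℝ} (hf : HasCompactSupport f) (L : List E) :
    HasCompactSupport (iterDirDeriv L f) :=
  hf.mono' ((subset_tsupport _).trans (iterDirDeriv_tsupport_subset f L))

end IterDirDeriv

/-! ### Weak derivatives against classical ones; bookkeeping of multi-indices -/

section WeakClassical

variable {E : Type*} [NormedAddCommGroup E] [NormedSpace ℝ E] [FiniteDimensional ℝ E]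
  [MeasureSpace E] [BorelSpace E] [(volume : Measure E).IsAddHaarMeasure]

theorem setIntegral_mul_eq_of_tsupport_subset {U : Set E} {f φ : E → ℝ}
    (hφ : tsupport φ ⊆ U) : ∫ x in U, f x * φ x = ∫ x, f x * φ x := by
  apply setIntegral_eq_integral_of_forall_compl_eq_zero
  intro x hx
  have : φ x = 0 := by
    by_contra h
    exact hx (hφ (subset_tsupport _ h))
  simp [this]

theorem integrable_mul_of_tsupport_subset {U : Set E} (hU : IsOpen U) {f φ : E → ℝ}
    (hf : ContinuousOn f U) (hφ : Continuous φ) (hc : HasCompactSupport φ) (hs : tsupport φ ⊆ U) :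
    Integrable (fun x => f x * φ x) := by
  have hcont : Continuous (fun x => f x * φ x) := by
    rw [continuous_iff_continuousAt]
    intro x
    by_cases hx : x ∈ tsupport φ
    · exact (hf.continuousAt (hU.mem_nhds (hs hx))).mul hφ.continuousAt
    · have h0 : (fun x => f x * φ x) =ᶠ[nhds x] fun _ => 0 := by
        filter_upwards [(isClosed_tsupport φ).isOpen_compl.mem_nhds hx] with y hy
        simp [image_eq_zero_of_notMem_tsupport hy]
      exact h0.continuousAt
  exact hcont.integrable_of_hasCompactSupport hc.mul_left

theorem setIntegral_mul_fderiv_eq_neg {U : Set E} (hU : IsOpen U) {f φ : E → ℝ}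
    (hf : ContDiffOn ℝ ∞ f U) (hφ : ContDiff ℝ ∞ φ) (hc : HasCompactSupport φ)
    (hs : tsupport φ ⊆ U) (v : E) :
    ∫ x in U, f x * fderiv ℝ φ x v = - ∫ x in U, fderiv ℝ f x v * φ x := by
  have hs' : tsupport (fun x => fderiv ℝ φ x v) ⊆ tsupport φ :=
    iterDirDeriv_tsupport_subset φ [v]
  have hd : ContDiff ℝ ∞ (fun x => fderiv ℝ φ x v) := iterDirDeriv_contDiff hφ [v]
  rw [setIntegral_mul_eq_of_tsupport_subset (hs'.trans hs),
    setIntegral_mul_eq_of_tsupport_subset hs]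
  apply integral_mul_fderiv_eq_neg_fderiv_mul_of_integrable
  · exact integrable_mul_of_tsupport_subset hU (hf.fderiv_apply_const hU v).continuousOn
      hφ.continuous hc hs
  · exact integrable_mul_of_tsupport_subset hU hf.continuousOn hd.continuous
      (iterDirDeriv_hasCompactSupport hc [v]) (hs'.trans hs)
  · exact integrable_mul_of_tsupport_subset hU hf.continuousOn hφ.continuous hc hs
  · exact fun x hx => hf.differentiableAt_of_isOpen hU (hs hx)
  · exact fun x _ => hφ.differentiable (by simp) x

theorem setIntegral_mul_iterDirDeriv {U : Set E} (hU : IsOpen U) {f φ : E → ℝ}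
    (hf : ContDiffOn ℝ ∞ f U) (hφ : ContDiff ℝ ∞ φ) (hc : HasCompactSupport φ)
    (hs : tsupport φ ⊆ U) (L : List E) :
    ∫ x in U, f x * iterDirDeriv L φ x =
      (-1) ^ L.length * ∫ x in U, iterDirDeriv L f x * φ x := by
  induction L generalizing f with
  | nil => simp [iterDirDeriv]
  | cons v L ih =>
    change ∫ x in U, f x * fderiv ℝ (iterDirDeriv L φ) x v = _
    rw [setIntegral_mul_fderiv_eq_neg hU hf (iterDirDeriv_contDiff hφ L)
      (iterDirDeriv_hasCompactSupport hc L) ((iterDirDeriv_tsupport_subset φ L).trans hs),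
      ih (hf.fderiv_apply_const hU v), List.length_cons, pow_succ]
    -- Integration by parts puts v innermost on f, whereas it was outermost on φ.
    have hperm : EqOn (iterDirDeriv L (fun x => fderiv ℝ f x v)) (iterDirDeriv (v :: L) f) U := by
      have h1 := iterDirDeriv_append L [v] f
      have h2 := iterDirDeriv_perm hU hf (List.perm_append_singleton v L)
      rw [h1] at h2
      exact h2
    rw [setIntegral_congr_fun hU.measurableSet (g := fun x => iterDirDeriv (v :: L) f x * φ x)
      (fun x hx => by simp only; rw [hperm hx])]
    ring

theorem length_dirList {n : ℕ} {E : Type*} (e : Fin n → E) (α : Fin n → ℕ) :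
    (dirList e α).length = ∑ i, α i := by
  simp [dirList, List.length_flatMap, Fin.sum_univ_def]

theorem hasWeakPartial_iterDirDeriv {n : ℕ} (e : Fin n → E) {U : Set E} (hU : IsOpen U)
    (α : Fin n → ℕ) {f : E → ℝ} (hf : ContDiffOn ℝ ∞ f U) :
    HasWeakPartial e U α f (iterDirDeriv (dirList e α) f) := by
  refine ⟨hf.continuousOn.locallyIntegrableOn hU.measurableSet,
    (iterDirDeriv_contDiffOn hU hf _).continuousOn.locallyIntegrableOn hU.measurableSet, ?_⟩
  intro φ hφ hc hs
  rw [setIntegral_mul_iterDirDeriv hU hf hφ hc hs, length_dirList]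

/-- The difference of the two candidates integrates to zero against all test functions, so the
fundamental lemma of the calculus of variations applies. It identifies the arbitrary choice in
`weakPartial` with any explicit derivative. -/
theorem HasWeakPartial.ae_eq {n : ℕ} {e : Fin n → E} {U : Set E} (hU : IsOpen U)
    {α : Fin n → ℕ} {f g₁ g₂ : E → ℝ} (h₁ : HasWeakPartial e U α f g₁)
    (h₂ : HasWeakPartial e U α f g₂) : g₁ =ᵐ[volume.restrict U] g₂ := by
  have hint : ∀ g : E → ℝ, LocallyIntegrableOn g U volume → ∀ φ : E → ℝ, Continuous φ →
      HasCompactSupport φ → tsupport φ ⊆ U → IntegrableOn (fun x => g x * φ x) U := by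
    intro g hg φ hφ hc hs
    have h1 : IntegrableOn (fun x => g x * φ x) (tsupport φ) :=
      (hg.integrableOn_compact_subset hs hc).mul_continuousOn hφ.continuousOn hc
    have h2 : Integrable (fun x => g x * φ x) :=
      h1.integrable_of_forall_notMem_eq_zero (fun x hx => by
        simp [image_eq_zero_of_notMem_tsupport hx])
    exact h2.integrableOn
  have key := IsOpen.ae_eq_zero_of_integral_contDiff_smul_eq_zero (μ := volume) hU
    (f := fun x => g₁ x - g₂ x) (h₁.2.1.sub h₂.2.1) ?_
  · rw [Filter.EventuallyEq, ae_restrict_iff' hU.measurableSet]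
    filter_upwards [key] with x hx hxU
    exact sub_eq_zero.1 (hx hxU)
  · intro φ hφ hc hs
    have e1 := h₁.2.2 φ hφ hc hs
    have e2 := h₂.2.2 φ hφ hc hs
    have e3 : ∫ x in U, g₁ x * φ x = ∫ x in U, g₂ x * φ x := by
      have := e1.symm.trans e2
      exact mul_left_cancel₀ (pow_ne_zero _ (by norm_num)) this
    have e4 : ∫ x, φ x • (g₁ x - g₂ x) = ∫ x in U, (g₁ x - g₂ x) * φ x := by
      rw [setIntegral_mul_eq_of_tsupport_subset hs]
      simp [mul_comm]
    rw [e4]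
    simp only [sub_mul]
    rw [integral_sub (hint _ h₁.2.1 φ hφ.continuous hc hs) (hint _ h₂.2.1 φ hφ.continuous hc hs),
      e3, sub_self]

theorem HasWeakPartial.weakPartial {n : ℕ} {e : Fin n → E} {U : Set E}
    {α : Fin n → ℕ} {f g : E → ℝ} (h : HasWeakPartial e U α f g) :
    HasWeakPartial e U α f (weakPartial e U α f) := by
  have h' : ∃ g, HasWeakPartial e U α f g := ⟨g, h⟩
  rw [_root_.weakPartial, dif_pos h']
  exact h'.choose_spec

theorem coe_dirList {n : ℕ} {E : Type*} (e : Fin n → E) (α : Fin n → ℕ) :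
    (dirList e α : Multiset E) = ∑ i, α i • ({e i} : Multiset E) := by
  have h : ∀ l : List (Fin n), ((l.flatMap (fun i => List.replicate (α i) (e i)) : List E) :
      Multiset E) = (l.map (fun i => α i • ({e i} : Multiset E))).sum := by
    intro l
    induction l with
    | nil => simp
    | cons i l ih =>
      rw [List.flatMap_cons, ← Multiset.coe_add, ih, List.map_cons, List.sum_cons,
        Multiset.nsmul_singleton, Multiset.coe_replicate]
  rw [dirList, h, Fin.sum_univ_def]

theorem dirList_add_single_perm {n : ℕ} {E : Type*} (e : Fin n → E) (α : Fin n → ℕ) (r : Fin n) :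
    (e r :: dirList e α).Perm (dirList e (α + Pi.single r 1)) := by
  rw [← Multiset.coe_eq_coe, ← Multiset.cons_coe, coe_dirList, coe_dirList]
  simp only [Pi.add_apply, add_smul, Finset.sum_add_distrib]
  rw [← Multiset.singleton_add, add_comm]
  congr 1
  rw [Finset.sum_eq_single r]
  · simp
  · intro b _ hb; simp [hb]
  · simp

theorem map_perm_dirList {n : ℕ} {E : Type*} (e : Fin n → E) (w : List (Fin n)) :
    (w.map e).Perm (dirList e (fun i => w.count i)) := by
  induction w with
  | nil =>
    rw [← Multiset.coe_eq_coe, coe_dirList]; simp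
  | cons i w ih =>
    rw [List.map_cons]
    refine (ih.cons (e i)).trans ((dirList_add_single_perm e _ i).trans ?_)
    refine List.Perm.of_eq (congrArg _ ?_)
    funext j
    simp only [Pi.add_apply, List.count_cons, Pi.single_apply, beq_iff_eq]
    by_cases h : i = j
    · simp [h]
    · simp [h, Ne.symm h]

theorem exists_word_dirList {n : ℕ} {E : Type*} (e : Fin n → E) (α : Fin n → ℕ) :
    ∃ w : List (Fin n), w.map e = dirList e α ∧ w.length = ∑ i, α i := by
  refine ⟨(List.finRange n).flatMap (fun i => List.replicate (α i) i), ?_, ?_⟩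
  · simp [dirList, List.map_flatMap]
  · simp [List.length_flatMap, Fin.sum_univ_def]

/-- `g'` is the weak derivative of `g` along the vector `v`, on the whole space. -/
def IsWeakDir (v : E) (g g' : E → ℝ) : Prop :=
  ∀ φ : E → ℝ, ContDiff ℝ ∞ φ → HasCompactSupport φ →
    ∫ x, g x * fderiv ℝ φ x v = - ∫ x, g' x * φ x

/-- Test the definition of ∂^α f with ∂_r φ and that of ∂^{α+e_r} f with φ: the left sides agree and
the signs differ by one factor -1. -/
theorem HasWeakPartial.isWeakDir {n : ℕ} {e : Fin n → E} {α : Fin n → ℕ} {r : Fin n}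
    {f g g' : E → ℝ} (h : HasWeakPartial e univ α f g)
    (h' : HasWeakPartial e univ (α + Pi.single r 1) f g') : IsWeakDir (e r) g g' := by
  intro φ hφ hc
  have h1 := h.2.2 _ (iterDirDeriv_contDiff hφ [e r]) (iterDirDeriv_hasCompactSupport hc [e r])
    (subset_univ _)
  have h2 := h'.2.2 φ hφ hc (subset_univ _)
  have h3 : iterDirDeriv (dirList e α) (iterDirDeriv [e r] φ) =
      iterDirDeriv (dirList e (α + Pi.single r 1)) φ := by
    rw [← iterDirDeriv_append]
    funext x
    exact iterDirDeriv_perm isOpen_univ hφ.contDiffOn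
      ((List.perm_append_singleton _ _).trans (dirList_add_single_perm e α r)) (mem_univ x)
  rw [h3, h2] at h1
  simp only [Measure.restrict_univ] at h1
  have h4 : ∑ i, (α + Pi.single r 1 : Fin n → ℕ) i = ∑ i, α i + 1 := by
    simp [Finset.sum_add_distrib]
  rw [h4, pow_succ, mul_assoc] at h1
  have h5 := mul_left_cancel₀ (pow_ne_zero _ (by norm_num)) h1
  rw [← neg_one_mul]
  exact h5.symm

end WeakClassical

end

noncomputable section

set_option linter.unusedSectionVars false

/-! ### Compactly supported kernels and the kernels of derivatives -/

section Kernel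

variable {d : ℕ}

/-- Smooth kernels supported in the closed ball of radius `ε`. -/
structure IsKernel (ε : ℝ) (χ : HorSpace d → ℝ) : Prop where
  smooth : ContDiff ℝ ∞ χ
  zero : ∀ y, ε < ‖y‖ → χ y = 0

theorem IsKernel.tsupport_subset {ε : ℝ} {χ : HorSpace d → ℝ} (h : IsKernel ε χ) :
    tsupport χ ⊆ Metric.closedBall 0 ε := by
  refine closure_minimal (fun y hy => ?_) Metric.isClosed_closedBall
  rw [mem_closedBall_zero_iff]
  by_contra hc
  exact hy (h.zero y (not_le.1 hc))

theorem isKernel_of_tsupport {ε : ℝ} {χ : HorSpace d → ℝ} (h : ContDiff ℝ ∞ χ)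
    (hs : tsupport χ ⊆ Metric.closedBall 0 ε) : IsKernel ε χ := by
  refine ⟨h, fun y hy => ?_⟩
  by_contra hc
  have := hs (subset_tsupport _ hc)
  rw [mem_closedBall_zero_iff] at this
  linarith

theorem IsKernel.hasCompactSupport {ε : ℝ} {χ : HorSpace d → ℝ} (h : IsKernel ε χ) :
    HasCompactSupport χ :=
  (isCompact_closedBall (0 : HorSpace d) ε).of_isClosed_subset (isClosed_tsupport _)
    h.tsupport_subset

theorem IsKernel.mul {ε : ℝ} {χ : HorSpace d → ℝ} (h : IsKernel ε χ) {c : HorSpace d → ℝ}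
    (hc : ContDiff ℝ ∞ c) : IsKernel ε (fun y => c y * χ y) :=
  ⟨hc.mul h.smooth, fun y hy => by simp [h.zero y hy]⟩

theorem IsKernel.add {ε : ℝ} {χ₁ χ₂ : HorSpace d → ℝ} (h₁ : IsKernel ε χ₁) (h₂ : IsKernel ε χ₂) :
    IsKernel ε (fun y => χ₁ y + χ₂ y) :=
  ⟨h₁.smooth.add h₂.smooth, fun y hy => by simp [h₁.zero y hy, h₂.zero y hy]⟩

theorem IsKernel.sum {ε : ℝ} {ι : Type*} {s : Finset ι} {χ : ι → HorSpace d → ℝ}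
    (h : ∀ i ∈ s, IsKernel ε (χ i)) : IsKernel ε (fun y => ∑ i ∈ s, χ i y) :=
  ⟨ContDiff.sum fun i hi => (h i hi).smooth,
    fun y hy => Finset.sum_eq_zero fun i hi => (h i hi).zero y hy⟩

theorem IsKernel.fderiv {ε : ℝ} {χ : HorSpace d → ℝ} (h : IsKernel ε χ) (v : HorSpace d) :
    IsKernel ε (fun y => fderiv ℝ χ y v) :=
  isKernel_of_tsupport (iterDirDeriv_contDiff h.smooth [v])
    ((iterDirDeriv_tsupport_subset χ [v]).trans h.tsupport_subset)

/-- The coefficient of `∂_r` when the `i`-th derivative of a mollification is moved onto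
the mollified function. -/
def dirCoef (d : ℕ) (i : Fin (d + 1)) (r : Fin d) : HorSpace d → ℝ :=
  Fin.lastCases (motive := fun _ => HorSpace d → ℝ) (fun y => -(y r))
    (fun j _ => if j = r then 1 else 0) i

theorem dirCoef_last (r : Fin d) (y : HorSpace d) : dirCoef d (Fin.last d) r y = -(y r) := by
  simp [dirCoef]

theorem dirCoef_castSucc (j r : Fin d) (y : HorSpace d) :
    dirCoef d j.castSucc r y = if j = r then 1 else 0 := by
  simp [dirCoef]

theorem contDiff_dirCoef (i : Fin (d + 1)) (r : Fin d) : ContDiff ℝ ∞ (dirCoef d i r) := by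
  refine Fin.lastCases ?_ (fun j => ?_) i
  · have : dirCoef d (Fin.last d) r = fun y => -(y r) := funext (dirCoef_last r)
    rw [this]; fun_prop
  · have : dirCoef d j.castSucc r = fun _ => if j = r then 1 else 0 := funext (dirCoef_castSucc j r)
    rw [this]; exact contDiff_const

/-- The kernel of the `i`-th derivative of a mollification. -/
def kernelDeriv (i : Fin (d + 1)) (χ : HorSpace d → ℝ) : HorSpace d → ℝ := fun y =>
  ∑ r, fderiv ℝ (fun z => dirCoef d i r z * χ z) y (hBasis d r)

theorem IsKernel.kernelDeriv {ε : ℝ} {χ : HorSpace d → ℝ} (h : IsKernel ε χ) (i : Fin (d + 1)) :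
    IsKernel ε (kernelDeriv i χ) :=
  IsKernel.sum fun r _ => (h.mul (contDiff_dirCoef i r)).fderiv _

theorem IsKernel.integrable {ε : ℝ} {χ : HorSpace d → ℝ} (h : IsKernel ε χ) :
    Integrable χ := h.smooth.continuous.integrable_of_hasCompactSupport h.hasCompactSupport

theorem IsKernel.integral_fderiv {ε : ℝ} {χ : HorSpace d → ℝ} (h : IsKernel ε χ)
    (v : HorSpace d) : ∫ y, _root_.fderiv ℝ χ y v = 0 := by
  have := setIntegral_mul_fderiv_eq_neg (E := HorSpace d) isOpen_univ (f := fun _ => (1 : ℝ))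
    contDiffOn_const h.smooth h.hasCompactSupport (subset_univ _) v
  simpa using this

/-- The kernel is the divergence of a compactly supported field, so it has mean zero. The top order
estimate rests on this cancellation. -/
theorem IsKernel.integral_kernelDeriv {ε : ℝ} {χ : HorSpace d → ℝ} (h : IsKernel ε χ)
    (i : Fin (d + 1)) : ∫ y, _root_.kernelDeriv i χ y = 0 := by
  unfold _root_.kernelDeriv
  rw [integral_finsetSum _ fun r _ => ((h.mul (contDiff_dirCoef i r)).fderiv _).integrable]
  exact Finset.sum_eq_zero fun r _ => (h.mul (contDiff_dirCoef i r)).integral_fderiv _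

theorem kernelDeriv_castSucc (χ : HorSpace d → ℝ) (j : Fin d)
    (y : HorSpace d) : kernelDeriv j.castSucc χ y = fderiv ℝ χ y (hBasis d j) := by
  unfold kernelDeriv
  rw [Finset.sum_eq_single j]
  · simp [dirCoef_castSucc]
  · intro r _ hr
    simp [dirCoef_castSucc, hr.symm]
  · simp

theorem sum_smul_hBasis (y : HorSpace d) : ∑ r, y r • hBasis d r = y := by
  ext j
  simp [hBasis, Pi.single_apply]

theorem hBasis_apply_self (r : Fin d) : (hBasis d r) r = 1 := by simp [hBasis]

/-- This is the product rule for -div(yχ), and it is the form in which the t-derivative of t^{-d}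
χ(y/t) appears. -/
theorem kernelDeriv_last {ε : ℝ} {χ : HorSpace d → ℝ} (h : IsKernel ε χ)
    (y : HorSpace d) : kernelDeriv (Fin.last d) χ y = -(d * χ y) - fderiv ℝ χ y y := by
  unfold kernelDeriv
  have hr : ∀ r : Fin d, fderiv ℝ (fun z => dirCoef d (Fin.last d) r z * χ z) y (hBasis d r)
      = -χ y - y r * fderiv ℝ χ y (hBasis d r) := by
    intro r
    have h1 : HasFDerivAt (fun z : HorSpace d => -(z r))
        (-(EuclideanSpace.proj r : HorSpace d →L[ℝ] ℝ)) y :=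
      (EuclideanSpace.proj r : HorSpace d →L[ℝ] ℝ).hasFDerivAt.neg
    have h2 : HasFDerivAt χ (fderiv ℝ χ y) y :=
      (h.smooth.differentiable (by simp) y).hasFDerivAt
    simp only [dirCoef_last]
    have h3 := (h1.mul h2).fderiv
    change fderiv ℝ (fun z => -z.ofLp r * χ z) y = _ at h3
    rw [h3]
    simp [hBasis_apply_self]
    ring
  simp only [hr]
  rw [Finset.sum_sub_distrib]
  congr 1
  · simp
  · conv_rhs => rw [← sum_smul_hBasis y]
    rw [map_sum]
    simp [sum_smul_hBasis]

end Kernel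

/-! ### Mollification with variable width -/

section Avg

variable {d : ℕ}

/-- The mollification `x ↦ ∫ g(x' - x_N y) χ(y) dy` with the width `x_N`. -/
def avg (χ g : HorSpace d → ℝ) (x : FullSpace d) : ℝ :=
  ∫ z, g z * ((x.2 ^ d)⁻¹ * χ (x.2⁻¹ • (x.1 - z)))

/-- The open upper half space. -/
def upper (d : ℕ) : Set (FullSpace d) := {x | 0 < x.2}

theorem isOpen_upper : IsOpen (upper d) := isOpen_lt continuous_const continuous_snd

/-- The rescaled kernel. -/
def scaledKernel (χ : HorSpace d → ℝ) (t : ℝ) (y : HorSpace d) : ℝ := (t ^ d)⁻¹ * χ (t⁻¹ • y)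

theorem contDiffOn_scaledKernel {χ : HorSpace d → ℝ} (h : ContDiff ℝ ∞ χ) :
    ContDiffOn ℝ ∞ (↿(scaledKernel χ)) (Ioi (0 : ℝ) ×ˢ univ) := by
  change ContDiffOn ℝ ∞ (fun q : ℝ × HorSpace d => (q.1 ^ d)⁻¹ * χ (q.1⁻¹ • q.2)) _
  have h0 : ∀ q ∈ (Ioi (0 : ℝ) ×ˢ (univ : Set (HorSpace d))), q.1 ≠ 0 := fun q hq => hq.1.ne'
  refine ContDiffOn.mul ?_ ?_
  · exact (contDiffOn_fst.pow d).inv fun q hq => pow_ne_zero _ (h0 q hq)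
  · exact h.comp_contDiffOn ((contDiffOn_fst.inv h0).smul contDiffOn_snd)

theorem scaledKernel_eq_zero {ε T : ℝ} {χ : HorSpace d → ℝ} (h : IsKernel ε χ) (hε : 0 ≤ ε)
    (t : ℝ) (y : HorSpace d) (ht : t ∈ Ioo 0 T) (hy : y ∉ Metric.closedBall (0 : HorSpace d) (ε * T)) :
    scaledKernel χ t y = 0 := by
  have : χ (t⁻¹ • y) = 0 := by
    apply h.zero
    rw [mem_closedBall_zero_iff, not_le] at hy
    rw [norm_smul, norm_inv, Real.norm_of_nonneg ht.1.le, ← div_eq_inv_mul, lt_div_iff₀ ht.1]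
    exact (mul_le_mul_of_nonneg_left ht.2.le hε).trans_lt hy
  simp [scaledKernel, this]

theorem avg_eq_convolution (χ g : HorSpace d → ℝ) :
    avg χ g = (fun q : ℝ × HorSpace d =>
      (convolution g (scaledKernel χ q.1) (ContinuousLinearMap.mul ℝ ℝ) volume) q.2) ∘
        Prod.swap := rfl

/-- The point x enters only through the kernel, so the regularity of g plays no role beyond local
integrability. Restricting the width to t < x_N + 1 gives all kernels a common compact support, as
needed for a convolution depending on a parameter. -/
theorem contDiffOn_avg {ε : ℝ} {χ g : HorSpace d → ℝ} (h : IsKernel ε χ) (hε : 0 ≤ ε)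
    (hg : LocallyIntegrable g) : ContDiffOn ℝ ∞ (avg χ g) (upper d) := by
  intro x hx
  have hsub : Ioo 0 (x.2 + 1) ×ˢ (univ : Set (HorSpace d)) ⊆ Ioi (0 : ℝ) ×ˢ univ :=
    prod_mono (fun t ht => ht.1) subset_rfl
  have h1 := contDiffOn_convolution_right_with_param (n := ⊤) (ContinuousLinearMap.mul ℝ ℝ)
    (μ := volume) (isOpen_Ioo (a := (0 : ℝ)) (b := x.2 + 1))
    (isCompact_closedBall (0 : HorSpace d) (ε * (x.2 + 1)))
    (scaledKernel_eq_zero h hε) hg ((contDiffOn_scaledKernel h.smooth).mono hsub)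
  have hx0 : (0 : ℝ) < x.2 := hx
  have h2 := h1.contDiffAt (x := x.swap)
    ((isOpen_Ioo.prod isOpen_univ).mem_nhds ⟨⟨hx0, by simp⟩, mem_univ _⟩)
  rw [avg_eq_convolution]
  exact (h2.comp x (contDiff_snd.prodMk contDiff_fst).contDiffAt).contDiffWithinAt

theorem fderiv_scaledKernel_zero {χ : HorSpace d → ℝ} (h : ContDiff ℝ ∞ χ) {t : ℝ} (ht : 0 < t)
    (y v : HorSpace d) : fderiv ℝ (↿(scaledKernel χ)) (t, y) (0, v) =
      t⁻¹ * ((t ^ d)⁻¹ * fderiv ℝ χ (t⁻¹ • y) v) := by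
  have hd : DifferentiableAt ℝ (↿(scaledKernel χ)) (t, y) :=
    (contDiffOn_scaledKernel h).differentiableAt_of_isOpen (isOpen_Ioi.prod isOpen_univ)
      ⟨ht, mem_univ _⟩
  have h1 : HasFDerivAt (fun z : HorSpace d => (t, z)) (ContinuousLinearMap.inr ℝ ℝ _) y :=
    hasFDerivAt_prodMk_right t y
  have h2 := hd.hasFDerivAt.comp y h1
  have h3 : HasFDerivAt (fun z => (t ^ d)⁻¹ * χ (t⁻¹ • z))
      ((t ^ d)⁻¹ • (fderiv ℝ χ (t⁻¹ • y)).comp (t⁻¹ • ContinuousLinearMap.id ℝ _)) y :=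
    ((h.differentiable (by simp) _).hasFDerivAt.comp y
      ((hasFDerivAt_id y).const_smul t⁻¹)).const_mul _
  have h4 := congrArg (fun A => A v) (h2.unique h3)
  simp only [ContinuousLinearMap.comp_apply, ContinuousLinearMap.inr_apply] at h4
  rw [h4]
  simp
  ring

theorem fderiv_scaledKernel_one {χ : HorSpace d → ℝ} (h : ContDiff ℝ ∞ χ) {t : ℝ} (ht : 0 < t)
    (y : HorSpace d) : fderiv ℝ (↿(scaledKernel χ)) (t, y) (1, 0) =
      t⁻¹ * ((t ^ d)⁻¹ * (-(d * χ (t⁻¹ • y)) - fderiv ℝ χ (t⁻¹ • y) (t⁻¹ • y))) := by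
  have hd : DifferentiableAt ℝ (↿(scaledKernel χ)) (t, y) :=
    (contDiffOn_scaledKernel h).differentiableAt_of_isOpen (isOpen_Ioi.prod isOpen_univ)
      ⟨ht, mem_univ _⟩
  have h1 : HasDerivAt (fun s : ℝ => (s, y)) ((1 : ℝ), (0 : HorSpace d)) t :=
    (hasDerivAt_id t).prodMk (hasDerivAt_const t y)
  have h2 := hd.hasFDerivAt.comp_hasDerivAt t h1
  have h3 : HasDerivAt (fun s : ℝ => s⁻¹ • y) ((-(t ^ 2)⁻¹) • y) t :=
    (hasDerivAt_inv ht.ne').smul_const y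
  have h4 := (h.differentiable (by simp) (t⁻¹ • y)).hasFDerivAt.comp_hasDerivAt t h3
  have h5 : HasDerivAt (fun s : ℝ => (s ^ d)⁻¹) (-(d * t ^ (d - 1)) / (t ^ d) ^ 2) t :=
    (hasDerivAt_pow d t).inv (pow_ne_zero _ ht.ne')
  have h6 := h2.unique (h5.mul h4)
  rw [h6]
  simp only [map_smul, smul_eq_mul]
  -- For d = 0 the exponent d - 1 in the derivative of t^d is truncated, so this case is separate.
  rcases d with _ | d
  · simp; field_simp
  · simp only [Nat.add_sub_cancel]
    field_simp
    ring

/-- Derivatives fall on the scaled kernel. By homogeneity each of them, horizontal or vertical,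
costs one factor 1/t and leaves a kernel at the same scale. -/
theorem fderiv_avg {ε : ℝ} {χ g : HorSpace d → ℝ} (h : IsKernel ε χ) (hε : 0 ≤ ε)
    (hg : LocallyIntegrable g) {x : FullSpace d} (hx : x ∈ upper d) (i : Fin (d + 1)) :
    fderiv ℝ (avg χ g) x (fBasis d i) = x.2⁻¹ * avg (kernelDeriv i χ) g x := by
  have hsub : Ioo 0 (x.2 + 1) ×ˢ (univ : Set (HorSpace d)) ⊆ Ioi (0 : ℝ) ×ˢ univ :=
    prod_mono (fun t ht => ht.1) subset_rfl
  have hx0 : (0 : ℝ) < x.2 := hx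
  have hsm := (contDiffOn_scaledKernel h.smooth).mono hsub
  have hopen : IsOpen (Ioo 0 (x.2 + 1) ×ˢ (univ : Set (HorSpace d))) :=
    isOpen_Ioo.prod isOpen_univ
  have h1 := hasFDerivAt_convolution_right_with_param (ContinuousLinearMap.mul ℝ ℝ)
    (μ := volume) (isOpen_Ioo (a := (0 : ℝ)) (b := x.2 + 1))
    (isCompact_closedBall (0 : HorSpace d) (ε * (x.2 + 1)))
    (scaledKernel_eq_zero h hε) hg (hsm.of_le (by simp)) x.swap
    ⟨hx0, by simp⟩
  have hswap : HasFDerivAt (Prod.swap : FullSpace d → ℝ × HorSpace d)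
      ((ContinuousLinearMap.snd ℝ (HorSpace d) ℝ).prod (ContinuousLinearMap.fst ℝ (HorSpace d) ℝ))
      x := ((ContinuousLinearMap.snd ℝ (HorSpace d) ℝ).prod
        (ContinuousLinearMap.fst ℝ (HorSpace d) ℝ)).hasFDerivAt
  have h2 := (h1.comp x hswap).fderiv
  rw [← avg_eq_convolution] at h2
  rw [h2]
  simp only [ContinuousLinearMap.comp_apply, Prod.fst_swap, Prod.snd_swap]
  have hcs : HasCompactSupport (fun y : HorSpace d => fderiv ℝ (↿(scaledKernel χ)) (x.2, y)) := by
    refine HasCompactSupport.of_support_subset_isCompact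
      (isCompact_closedBall (0 : HorSpace d) (ε * (x.2 + 1))) ?_
    intro y hy
    by_contra hc
    apply hy
    have : (↿(scaledKernel χ)) =ᶠ[nhds (x.2, y)] fun _ => 0 := by
      have hn : Ioo 0 (x.2 + 1) ×ˢ (Metric.closedBall (0 : HorSpace d) (ε * (x.2 + 1)))ᶜ
          ∈ nhds (x.2, y) :=
        (isOpen_Ioo.prod Metric.isClosed_closedBall.isOpen_compl).mem_nhds
          ⟨⟨hx0, by simp⟩, hc⟩
      filter_upwards [hn] with q hq
      exact scaledKernel_eq_zero h hε q.1 q.2 hq.1 hq.2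
    simp only
    rw [this.fderiv_eq]
    simp
  have hct : Continuous (fun y : HorSpace d => fderiv ℝ (↿(scaledKernel χ)) (x.2, y)) := by
    have := (hsm.fderiv_of_isOpen hopen (m := ∞) (by simp)).continuousOn
    exact this.comp_continuous (by fun_prop) (fun y => ⟨⟨hx0, by simp⟩, mem_univ _⟩)
  rw [convolution_precompR_apply _ hg hcs hct]
  rw [convolution_def]
  simp only [avg, ContinuousLinearMap.mul_apply']
  rw [← integral_const_mul]
  congr 1
  funext z
  simp only [ContinuousLinearMap.prod_apply, ContinuousLinearMap.coe_fst',
    ContinuousLinearMap.coe_snd']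
  refine Fin.lastCases ?_ (fun j => ?_) i
  · simp only [fBasis, Fin.lastCases_last]
    rw [fderiv_scaledKernel_one h.smooth hx0, kernelDeriv_last h]
    ring
  · simp only [fBasis, Fin.lastCases_castSucc]
    rw [fderiv_scaledKernel_zero h.smooth hx0, kernelDeriv_castSucc]
    ring

theorem IsKernel.scaled_shift {ε : ℝ} {χ : HorSpace d → ℝ} (h : IsKernel ε χ)
    (x : FullSpace d) (hx : x ∈ upper d) :
    ContDiff ℝ ∞ (fun z => (x.2 ^ d)⁻¹ * χ (x.2⁻¹ • (x.1 - z))) ∧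
      HasCompactSupport (fun z => (x.2 ^ d)⁻¹ * χ (x.2⁻¹ • (x.1 - z))) := by
  have hx0 : (0 : ℝ) < x.2 := hx
  constructor
  · exact contDiff_const.mul (h.smooth.comp (by fun_prop))
  · refine HasCompactSupport.of_support_subset_isCompact
      (isCompact_closedBall x.1 (ε * x.2)) ?_
    intro z hz
    by_contra hc
    apply hz
    have : χ (x.2⁻¹ • (x.1 - z)) = 0 := by
      apply h.zero
      rw [Metric.mem_closedBall, not_le, dist_comm, dist_eq_norm] at hc
      rw [norm_smul, norm_inv, Real.norm_of_nonneg hx0.le, ← div_eq_inv_mul, lt_div_iff₀ hx0]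
      exact hc
    simp [this]

theorem integrable_mul_scaled {ε : ℝ} {χ g : HorSpace d → ℝ} (h : IsKernel ε χ)
    (hg : LocallyIntegrable g) {x : FullSpace d} (hx : x ∈ upper d) :
    Integrable (fun z => g z * ((x.2 ^ d)⁻¹ * χ (x.2⁻¹ • (x.1 - z)))) := by
  obtain ⟨h1, h2⟩ := h.scaled_shift x hx
  have := hg.integrable_smul_right_of_hasCompactSupport h1.continuous h2
  simpa using this

/-- The scaled version of ∂_r χ is -t times the z-derivative of the scaled χ, which is a test
function in z. Moving the derivative onto g thus gains the factor t that pays for the 1/t in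
`fderiv_avg`. -/
theorem avg_fderiv_kernel {ε : ℝ} {χ g g' : HorSpace d → ℝ} (h : IsKernel ε χ)
    {r : Fin d} (hw : IsWeakDir (hBasis d r) g g') {x : FullSpace d} (hx : x ∈ upper d) :
    avg (fun y => fderiv ℝ χ y (hBasis d r)) g x = x.2 * avg χ g' x := by
  have hx0 : (0 : ℝ) < x.2 := hx
  obtain ⟨h1, h2⟩ := h.scaled_shift x hx
  have h3 := hw _ h1 h2
  have h4 : ∀ z, fderiv ℝ (fun z => (x.2 ^ d)⁻¹ * χ (x.2⁻¹ • (x.1 - z))) z (hBasis d r) =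
      -x.2⁻¹ * ((x.2 ^ d)⁻¹ * fderiv ℝ χ (x.2⁻¹ • (x.1 - z)) (hBasis d r)) := by
    intro z
    have e1 : HasFDerivAt (fun z => x.2⁻¹ • (x.1 - z))
        (x.2⁻¹ • (-ContinuousLinearMap.id ℝ (HorSpace d))) z :=
      HasFDerivAt.const_smul (f := fun z => x.1 - z) ((hasFDerivAt_id z).const_sub x.1) x.2⁻¹
    have e2 := ((h.smooth.differentiable (by simp) _).hasFDerivAt.comp z e1).const_mul
      (x.2 ^ d)⁻¹
    have e3 := e2.fderiv
    simp only [Function.comp_def] at e3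
    rw [e3]
    simp
    ring
  simp only [h4] at h3
  unfold avg
  have h5 : ∫ z, g z * (-x.2⁻¹ * ((x.2 ^ d)⁻¹ * fderiv ℝ χ (x.2⁻¹ • (x.1 - z)) (hBasis d r))) =
      -x.2⁻¹ * ∫ z, g z * ((x.2 ^ d)⁻¹ * fderiv ℝ χ (x.2⁻¹ • (x.1 - z)) (hBasis d r)) := by
    rw [← integral_const_mul]
    congr 1; funext z; ring
  rw [h5] at h3
  rw [neg_mul, neg_inj, inv_mul_eq_iff_eq_mul₀ hx0.ne'] at h3
  exact h3

theorem avg_eq_integral (χ g : HorSpace d → ℝ) {x : FullSpace d} (hx : x ∈ upper d) :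
    avg χ g x = ∫ y, χ y * g (x.1 - x.2 • y) := by
  have hx0 : (0 : ℝ) < x.2 := hx
  have h1 : avg χ g x = ∫ z, g (x.1 - z) * ((x.2 ^ d)⁻¹ * χ (x.2⁻¹ • z)) := by
    rw [← integral_sub_left_eq_self _ volume x.1]
    simp [avg]
  have h2 := Measure.integral_comp_smul (volume : Measure (HorSpace d))
    (fun z => g (x.1 - z) * ((x.2 ^ d)⁻¹ * χ (x.2⁻¹ • z))) x.2
  rw [← h1, finrank_euclideanSpace, Fintype.card_fin, abs_of_pos (by positivity), smul_eq_mul,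
    eq_comm, inv_mul_eq_iff_eq_mul₀ (by positivity), ← integral_const_mul] at h2
  rw [h2]
  congr 1; funext y
  rw [smul_smul, inv_mul_cancel₀ hx0.ne', one_smul]
  field_simp

theorem avg_sum_kernel {ε : ℝ} {ι : Type*} (s : Finset ι) {χ : ι → HorSpace d → ℝ}
    {g : HorSpace d → ℝ} (h : ∀ i ∈ s, IsKernel ε (χ i)) (hg : LocallyIntegrable g)
    {x : FullSpace d} (hx : x ∈ upper d) :
    avg (fun y => ∑ i ∈ s, χ i y) g x = ∑ i ∈ s, avg (χ i) g x := by
  unfold avg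
  rw [← integral_finsetSum _ fun i hi => integrable_mul_scaled (h i hi) hg hx]
  simp [Finset.mul_sum]

theorem avg_add_kernel {ε : ℝ} {χ₁ χ₂ : HorSpace d → ℝ}
    {g : HorSpace d → ℝ} (h₁ : IsKernel ε χ₁) (h₂ : IsKernel ε χ₂) (hg : LocallyIntegrable g)
    {x : FullSpace d} (hx : x ∈ upper d) :
    avg (fun y => χ₁ y + χ₂ y) g x = avg χ₁ g x + avg χ₂ g x := by
  unfold avg
  rw [← integral_add (integrable_mul_scaled h₁ hg hx) (integrable_mul_scaled h₂ hg hx)]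
  congr 1; funext z; ring

theorem avg_const_mul_kernel (c : ℝ) (χ g : HorSpace d → ℝ) (x : FullSpace d) :
    avg (fun y => c * χ y) g x = c * avg χ g x := by
  unfold avg
  rw [← integral_const_mul]
  congr 1; funext z; ring

theorem avg_add {ε : ℝ} {χ : HorSpace d → ℝ} {g₁ g₂ : HorSpace d → ℝ} (h : IsKernel ε χ)
    (hg₁ : LocallyIntegrable g₁) (hg₂ : LocallyIntegrable g₂) {x : FullSpace d}
    (hx : x ∈ upper d) : avg χ (fun z => g₁ z + g₂ z) x = avg χ g₁ x + avg χ g₂ x := by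
  unfold avg
  rw [← integral_add (integrable_mul_scaled h hg₁ hx) (integrable_mul_scaled h hg₂ hx)]
  congr 1; funext z; ring

theorem avg_const_mul (c : ℝ) (χ g : HorSpace d → ℝ) (x : FullSpace d) :
    avg χ (fun z => c * g z) x = c * avg χ g x := by
  unfold avg
  rw [← integral_const_mul]
  congr 1; funext z; ring

theorem avg_congr_ae {χ g₁ g₂ : HorSpace d → ℝ} (h : g₁ =ᵐ[volume] g₂) (x : FullSpace d) :
    avg χ g₁ x = avg χ g₂ x := by
  unfold avg
  refine integral_congr_ae ?_
  filter_upwards [h] with z hz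
  rw [hz]

/-- A derivative of a mollification, moved onto the mollified function. -/
theorem fderiv_avg_of_isWeakDir {ε : ℝ} {χ g : HorSpace d → ℝ} {g' : Fin d → HorSpace d → ℝ}
    (h : IsKernel ε χ) (hε : 0 ≤ ε) (hg : LocallyIntegrable g)
    (hw : ∀ r, IsWeakDir (hBasis d r) g (g' r)) {x : FullSpace d} (hx : x ∈ upper d)
    (i : Fin (d + 1)) :
    fderiv ℝ (avg χ g) x (fBasis d i) =
      ∑ r, avg (fun y => dirCoef d i r y * χ y) (g' r) x := by
  have hx0 : (0 : ℝ) < x.2 := hx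
  rw [fderiv_avg h hε hg hx]
  unfold kernelDeriv
  rw [avg_sum_kernel _ (fun r _ => (h.mul (contDiff_dirCoef i r)).fderiv _) hg hx, Finset.mul_sum]
  refine Finset.sum_congr rfl fun r _ => ?_
  rw [avg_fderiv_kernel (h.mul (contDiff_dirCoef i r)) (hw r) hx]
  field_simp

end Avg

end

noncomputable section

set_option linter.unusedSectionVars false

/-! ### Limits and integral estimates for mollifications -/

theorem lintegral_rpow_le_measure_univ_rpow_mul {α : Type*} [MeasurableSpace α] (μ : Measure α)
    {p : ℝ} (hp : 1 < p) {f : α → ℝ≥0∞} (hf : AEMeasurable f μ) :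
    (∫⁻ a, f a ∂μ) ^ p ≤ μ univ ^ (p - 1) * ∫⁻ a, f a ^ p ∂μ := by
  have hp0 : 0 < p := by linarith
  have hpq := Real.HolderConjugate.conjExponent hp
  have h := ENNReal.lintegral_mul_le_Lp_mul_Lq μ hpq hf
    (aemeasurable_const (b := (1 : ℝ≥0∞)))
  simp only [Pi.mul_apply, mul_one, ENNReal.one_rpow, lintegral_one] at h
  have h2 := ENNReal.rpow_le_rpow h hp0.le
  rw [ENNReal.mul_rpow_of_nonneg _ _ hp0.le, ← ENNReal.rpow_mul, ← ENNReal.rpow_mul,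
    one_div, inv_mul_cancel₀ hp0.ne', ENNReal.rpow_one] at h2
  have h3 : 1 / Real.conjExponent p * p = p - 1 := by
    unfold Real.conjExponent
    have : p - 1 ≠ 0 := by linarith
    field_simp
  rw [h3, mul_comm] at h2
  exact h2

section Estimates

variable {d : ℕ}

theorem strip_eq_prod (bm bp : ℝ) : strip d bm bp = univ ×ˢ Ioo bm bp := by
  ext x; simp [strip]

theorem measurableSet_strip (bm bp : ℝ) : MeasurableSet (strip d bm bp) := by
  rw [strip_eq_prod]; exact MeasurableSet.univ.prod measurableSet_Ioo

theorem isOpen_strip (bm bp : ℝ) : IsOpen (strip d bm bp) := by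
  rw [strip_eq_prod]; exact isOpen_univ.prod isOpen_Ioo

theorem strip_subset_upper {b : ℝ} : strip d 0 b ⊆ upper d := fun _ hx => hx.1

theorem volume_restrict_strip (bm bp : ℝ) :
    (volume : Measure (FullSpace d)).restrict (strip d bm bp) =
      (volume : Measure (HorSpace d)).prod (volume.restrict (Ioo bm bp)) := by
  rw [strip_eq_prod, Measure.volume_eq_prod, ← Measure.prod_restrict, Measure.restrict_univ]

theorem lintegral_strip {bm bp : ℝ} {f : FullSpace d → ℝ≥0∞}
    (hf : AEMeasurable f (volume.restrict (strip d bm bp))) :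
    ∫⁻ x in strip d bm bp, f x = ∫⁻ x', ∫⁻ t in Ioo bm bp, f (x', t) := by
  rw [volume_restrict_strip] at hf ⊢
  exact lintegral_prod f hf

theorem lintegral_strip_symm {bm bp : ℝ} {f : FullSpace d → ℝ≥0∞}
    (hf : AEMeasurable f (volume.restrict (strip d bm bp))) :
    ∫⁻ x in strip d bm bp, f x = ∫⁻ t in Ioo bm bp, ∫⁻ x', f (x', t) := by
  rw [volume_restrict_strip] at hf ⊢
  exact lintegral_prod_symm f hf

theorem IsKernel.exists_bound {ε : ℝ} {χ : HorSpace d → ℝ} (h : IsKernel ε χ) :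
    ∃ M : ℝ, 0 ≤ M ∧ ∀ y, ‖χ y‖ ≤ M := by
  obtain ⟨M, hM⟩ := h.hasCompactSupport.exists_bound_of_continuous h.smooth.continuous
  exact ⟨M, (norm_nonneg _).trans (hM 0), hM⟩

theorem avg_const (χ : HorSpace d → ℝ) (c : ℝ) {x : FullSpace d} (hx : x ∈ upper d) :
    avg χ (fun _ => c) x = (∫ y, χ y) * c := by
  rw [avg_eq_integral _ _ hx, integral_mul_const]

theorem avg_sub_eq {ε : ℝ} {χ g : HorSpace d → ℝ} (h : IsKernel ε χ)
    (hg : LocallyIntegrable g) (c : ℝ) {x : FullSpace d} (hx : x ∈ upper d) :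
    avg χ g x - (∫ y, χ y) * c = avg χ (fun z => g z - c) x := by
  rw [← avg_const χ c hx]
  have := avg_add h hg (g₂ := fun _ => -c) (locallyIntegrable_const _) hx
  simp only [← sub_eq_add_neg] at this
  rw [this, avg_const χ c hx, avg_const χ (-c) hx]
  ring

theorem enorm_avg_le {ε M : ℝ} {χ : HorSpace d → ℝ} (h : IsKernel ε χ)
    (hM : ∀ y, ‖χ y‖ ≤ M) (g : HorSpace d → ℝ) {x : FullSpace d} (hx : x ∈ upper d) :
    ‖avg χ g x‖ₑ ≤
      ENNReal.ofReal M * ∫⁻ y in Metric.closedBall 0 ε, ‖g (x.1 - x.2 • y)‖ₑ := by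
  rw [avg_eq_integral _ _ hx, ← lintegral_const_mul' _ _ ENNReal.ofReal_ne_top,
    ← lintegral_indicator Metric.isClosed_closedBall.measurableSet]
  refine (enorm_integral_le_lintegral_enorm _).trans (lintegral_mono fun y => ?_)
  by_cases hy : y ∈ Metric.closedBall (0 : HorSpace d) ε
  · rw [indicator_of_mem hy, enorm_mul]
    gcongr
    rw [← ofReal_norm]
    exact ENNReal.ofReal_le_ofReal (hM y)
  · rw [mem_closedBall_zero_iff, not_le] at hy
    simp [h.zero y hy]

/-- Mollifications converge to a multiple of the function, at its Lebesgue points. -/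
theorem ae_tendsto_avg {ε : ℝ} {χ g : HorSpace d → ℝ} (h : IsKernel ε χ) (hε : 0 < ε)
    (hg : LocallyIntegrable g) : ∀ᵐ x' : HorSpace d,
      Filter.Tendsto (fun t : ℝ => avg χ g (x', t)) (nhdsWithin 0 (Ioi 0))
        (nhds ((∫ y, χ y) * g x')) := by
  obtain ⟨M, hM0, hM⟩ := h.exists_bound
  filter_upwards [IsUnifLocDoublingMeasure.ae_tendsto_average_norm_sub volume hg 1] with x' hx'
  have hδ : Filter.Tendsto (fun t : ℝ => ε * t) (nhdsWithin 0 (Ioi 0)) (nhdsWithin 0 (Ioi 0)) := by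
    refine tendsto_nhdsWithin_iff.2 ⟨?_, ?_⟩
    · have : Filter.Tendsto (fun t : ℝ => ε * t) (nhds 0) (nhds (ε * 0)) :=
        (continuous_const_mul ε).tendsto 0
      rw [mul_zero] at this
      exact this.mono_left nhdsWithin_le_nhds
    · filter_upwards [self_mem_nhdsWithin] with t ht
      exact mul_pos hε ht
  have h1 := hx' (fun _ => x') (fun t => ε * t) hδ (by
    filter_upwards [self_mem_nhdsWithin] with t ht
    have : (0 : ℝ) < t := ht
    simp; positivity)
  -- The constant is the sup bound of the kernel times the volume of the ball of radius εt divided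
  -- by t^d.
  have h2 := h1.const_mul (M * (ε ^ d * volume.real (Metric.ball (0 : HorSpace d) 1)))
  rw [mul_zero] at h2
  rw [tendsto_iff_norm_sub_tendsto_zero]
  refine squeeze_zero' (Filter.Eventually.of_forall fun _ => norm_nonneg _) ?_ h2
  filter_upwards [self_mem_nhdsWithin] with t ht
  have ht0 : (0 : ℝ) < t := ht
  have hx : ((x', t) : FullSpace d) ∈ upper d := ht
  rw [avg_sub_eq h hg _ hx]
  have hint : IntegrableOn (fun z => ‖g z - g x'‖) (Metric.closedBall x' (ε * t)) :=
    ((hg.sub (locallyIntegrable_const (g x'))).integrableOn_isCompact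
      (isCompact_closedBall _ _)).norm
  have hvol := Measure.addHaar_real_closedBall (volume : Measure (HorSpace d)) x'
    (r := ε * t) (by positivity)
  rw [finrank_euclideanSpace, Fintype.card_fin] at hvol
  calc ‖avg χ (fun z => g z - g x') (x', t)‖
      ≤ ∫ z in Metric.closedBall x' (ε * t), ‖g z - g x'‖ * ((t ^ d)⁻¹ * M) := by
        unfold avg
        have hz : ∀ z, z ∉ Metric.closedBall x' (ε * t) →
            (g z - g x') * ((t ^ d)⁻¹ * χ (t⁻¹ • (x' - z))) = 0 := by
          intro z hz
          have : χ (t⁻¹ • (x' - z)) = 0 := by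
            apply h.zero
            rw [Metric.mem_closedBall, not_le, dist_comm, dist_eq_norm] at hz
            rw [norm_smul, norm_inv, Real.norm_of_nonneg ht0.le, ← div_eq_inv_mul,
              lt_div_iff₀ ht0]
            exact hz
          simp [this]
        change ‖∫ z, (g z - g x') * ((t ^ d)⁻¹ * χ (t⁻¹ • (x' - z)))‖ ≤ _
        rw [← setIntegral_eq_integral_of_forall_compl_eq_zero hz]
        refine norm_integral_le_of_norm_le (hint.mul_const _) (Filter.Eventually.of_forall ?_)
        intro z
        rw [norm_mul, norm_mul, norm_inv, norm_pow, Real.norm_of_nonneg ht0.le]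
        gcongr
        exact hM _
    _ = M * (ε ^ d * volume.real (Metric.ball (0 : HorSpace d) 1)) *
          ⨍ y in Metric.closedBall x' (ε * t), ‖g y - g x'‖ := by
        rw [integral_mul_const, setAverage_eq, hvol, smul_eq_mul]
        have hb : volume.real (Metric.ball (0 : HorSpace d) 1) ≠ 0 :=
          (ENNReal.toReal_pos (Metric.measure_ball_pos _ _ one_pos).ne' measure_ball_lt_top.ne).ne'
        rw [mul_pow]
        field_simp

theorem lintegral_comp_smul {f : HorSpace d → ℝ≥0∞} (hf : Measurable f) {r : ℝ} (hr : r ≠ 0) :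
    ∫⁻ y, f (r • y) = ENNReal.ofReal |(r ^ d)⁻¹| * ∫⁻ y, f y := by
  rw [← lintegral_map hf (measurable_const_smul r), Measure.map_addHaar_smul _ hr,
    lintegral_smul_measure, finrank_euclideanSpace, Fintype.card_fin, smul_eq_mul]

theorem aemeasurable_avg {ε b p : ℝ} {χ g : HorSpace d → ℝ} (h : IsKernel ε χ) (hε : 0 ≤ ε)
    (hg : LocallyIntegrable g) :
    AEMeasurable (fun x => ‖avg χ g x‖ₑ ^ p) (volume.restrict (strip d 0 b)) := by
  have h1 : ContinuousOn (avg χ g) (strip d 0 b) :=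
    (contDiffOn_avg h hε hg).continuousOn.mono strip_subset_upper
  exact (h1.aemeasurable (measurableSet_strip 0 b)).enorm.pow_const _

theorem enorm_avg_rpow_le {ε M p : ℝ} {χ g : HorSpace d → ℝ} (h : IsKernel ε χ)
    (hM : ∀ y, ‖χ y‖ ≤ M) (hp : 1 < p) (hg : Measurable g) {x : FullSpace d} (hx : x ∈ upper d) :
    ‖avg χ g x‖ₑ ^ p ≤
      (ENNReal.ofReal M ^ p * volume (Metric.closedBall (0 : HorSpace d) ε) ^ (p - 1)) *
        ∫⁻ y in Metric.closedBall 0 ε, ‖g (x.1 - x.2 • y)‖ₑ ^ p := by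
  have hp0 : 0 < p := by linarith
  refine (ENNReal.rpow_le_rpow (enorm_avg_le h hM g hx) hp0.le).trans ?_
  rw [ENNReal.mul_rpow_of_nonneg _ _ hp0.le, mul_assoc]
  gcongr
  have := lintegral_rpow_le_measure_univ_rpow_mul
    (volume.restrict (Metric.closedBall (0 : HorSpace d) ε)) hp
    (f := fun y => ‖g (x.1 - x.2 • y)‖ₑ) (by fun_prop)
  rwa [Measure.restrict_apply_univ] at this

theorem lintegral_Ioi_rpow_neg {c s : ℝ} (hc : 0 < c) (hs : 0 < s) :
    ∫⁻ t in Ioi c, ENNReal.ofReal (t ^ (-(s + 1))) = ENNReal.ofReal (c ^ (-s) / s) := by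
  rw [← ofReal_integral_eq_lintegral_ofReal (integrableOn_Ioi_rpow_of_lt (by linarith) hc)]
  · rw [integral_Ioi_rpow_of_lt (by linarith) hc]
    congr 1
    have : -(s + 1) + 1 = -s := by ring
    rw [this, neg_div_neg_eq]
  · rw [Filter.EventuallyLE, ae_restrict_iff' measurableSet_Ioi]
    filter_upwards with t ht
    exact Real.rpow_nonneg (hc.trans ht).le _

/-- The difference-quotient energy with the kernel `|h|^{-(p+d-1)}`. -/
def diffEnergy (p r : ℝ) (g : HorSpace d → ℝ) : ℝ≥0∞ :=
  ∫⁻ x : HorSpace d, ∫⁻ h in Metric.ball (0 : HorSpace d) r,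
    ‖g (x + h) - g x‖ₑ ^ p * ENNReal.ofReal ((‖h‖ ^ (p + d - 1))⁻¹)

/-- Since χ has mean zero, g may be replaced by g - g(x') in the average. Hölder in y and the
substitution k = -ty bound the slice at height t by t^{-(p+d)} ∫_{|k| ≤ εt} J(k) dk, where J(k) is
the p-th power of the L^p norm of g(·+k) - g. By Tonelli the integral over t ≥ |k|/ε comes next, and
it yields a multiple of |k|^{-(p+d-1)}. The bound is scale invariant, so C is chosen before g and b.
-/
theorem lintegral_avg_le {ε p : ℝ} {χ : HorSpace d → ℝ} (h : IsKernel ε χ) (hε : 0 < ε)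
    (h0 : ∫ y, χ y = 0) (hp : 1 < p) : ∃ C : ℝ≥0∞, C ≠ ⊤ ∧
      ∀ g : HorSpace d → ℝ, Measurable g → LocallyIntegrable g → ∀ b : ℝ, 0 < b →
        ∫⁻ x in strip d 0 b, ‖x.2⁻¹ * avg χ g x‖ₑ ^ p ≤ C * diffEnergy p (ε * b) g := by
  obtain ⟨M, hM0, hM⟩ := h.exists_bound
  have hp0 : 0 < p := by linarith
  have hs : 0 < p + d - 1 := by
    have : (0 : ℝ) ≤ d := Nat.cast_nonneg d
    linarith
  set V := volume (Metric.closedBall (0 : HorSpace d) ε) with hV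
  have hVtop : V ≠ ⊤ := measure_closedBall_lt_top.ne
  set C1 : ℝ≥0∞ := ENNReal.ofReal M ^ p * V ^ (p - 1) with hC1
  set s : ℝ := p + d - 1 with hsdef
  have hC1top : C1 ≠ ⊤ := ENNReal.mul_ne_top (ENNReal.rpow_ne_top_of_nonneg hp0.le
    ENNReal.ofReal_ne_top) (ENNReal.rpow_ne_top_of_nonneg (by linarith) hVtop)
  refine ⟨C1 * ENNReal.ofReal (ε ^ s / s), ENNReal.mul_ne_top hC1top ENNReal.ofReal_ne_top, ?_⟩
  intro g hgm hg b hb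
  set J : HorSpace d → ℝ≥0∞ := fun k => ∫⁻ x, ‖g (x + k) - g x‖ₑ ^ p with hJ
  have hJm : Measurable J := by
    apply Measurable.lintegral_prod_left' (f := fun q : HorSpace d × HorSpace d =>
      ‖g (q.1 + q.2) - g q.1‖ₑ ^ p)
    fun_prop
  have hJ0 : J 0 = 0 := by simp [hJ, hp0]
  have hpt : ∀ t ∈ Ioo 0 b, ∫⁻ x', ‖t⁻¹ * avg χ g (x', t)‖ₑ ^ p ≤
      C1 * ∫⁻ k, (Metric.closedBall (0 : HorSpace d) (ε * t)).indicator
        (fun k => J k * ENNReal.ofReal (t ^ (-(s + 1)))) k := by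
    intro t ht
    have ht0 : 0 < t := ht.1
    have h1 : ∀ x', ‖t⁻¹ * avg χ g (x', t)‖ₑ ^ p ≤ ENNReal.ofReal (t ^ (-p)) *
        (C1 * ∫⁻ y in Metric.closedBall 0 ε, ‖g (x' + (-t) • y) - g x'‖ₑ ^ p) := by
      intro x'
      have hx : ((x', t) : FullSpace d) ∈ upper d := ht0
      have e1 : avg χ g (x', t) = avg χ (fun z => g z - g x') (x', t) := by
        rw [← avg_sub_eq h hg _ hx, h0]; simp
      rw [enorm_mul, ENNReal.mul_rpow_of_nonneg _ _ hp0.le, e1]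
      refine mul_le_mul' ?_ ?_
      · rw [Real.enorm_of_nonneg (by positivity), ENNReal.ofReal_rpow_of_nonneg (by positivity)
          hp0.le, Real.inv_rpow ht0.le, Real.rpow_neg ht0.le]
      · have := enorm_avg_rpow_le h hM hp (g := fun z => g z - g x')
          (hgm.sub_const _) hx
        simp only [sub_eq_add_neg, ← neg_smul] at this ⊢
        exact this
    have h2 : ∫⁻ x', ∫⁻ y in Metric.closedBall (0 : HorSpace d) ε,
        ‖g (x' + (-t) • y) - g x'‖ₑ ^ p = ∫⁻ y in Metric.closedBall (0 : HorSpace d) ε,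
          J ((-t) • y) := by
      rw [lintegral_lintegral_swap]
      fun_prop
    have h3 : ∫⁻ y in Metric.closedBall (0 : HorSpace d) ε, J ((-t) • y) =
        ENNReal.ofReal ((t ^ d)⁻¹) * ∫⁻ k in Metric.closedBall (0 : HorSpace d) (ε * t), J k := by
      rw [← lintegral_indicator Metric.isClosed_closedBall.measurableSet,
        ← lintegral_indicator Metric.isClosed_closedBall.measurableSet]
      have e := lintegral_comp_smul (d := d) (f := (Metric.closedBall (0 : HorSpace d)
        (ε * t)).indicator J) (hJm.indicator Metric.isClosed_closedBall.measurableSet)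
        (r := -t) (by linarith)
      have e2 : |((-t) ^ d)⁻¹| = (t ^ d)⁻¹ := by
        rw [abs_inv, abs_pow, abs_neg, abs_of_pos ht0]
      rw [e2] at e
      rw [← e]
      congr 1; funext y
      have : (-t) • y ∈ Metric.closedBall (0 : HorSpace d) (ε * t) ↔
          y ∈ Metric.closedBall (0 : HorSpace d) ε := by
        rw [mem_closedBall_zero_iff, mem_closedBall_zero_iff, norm_smul, norm_neg,
          Real.norm_of_nonneg ht0.le, mul_comm, mul_le_mul_iff_left₀ ht0]
      by_cases hy : y ∈ Metric.closedBall (0 : HorSpace d) ε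
      · rw [indicator_of_mem hy, indicator_of_mem (this.2 hy)]
      · rw [indicator_of_notMem hy, indicator_of_notMem (mt this.1 hy)]
    calc ∫⁻ x', ‖t⁻¹ * avg χ g (x', t)‖ₑ ^ p
        ≤ ∫⁻ x', ENNReal.ofReal (t ^ (-p)) *
          (C1 * ∫⁻ y in Metric.closedBall 0 ε, ‖g (x' + (-t) • y) - g x'‖ₑ ^ p) :=
          lintegral_mono h1
      _ = C1 * (ENNReal.ofReal (t ^ (-p)) * (ENNReal.ofReal ((t ^ d)⁻¹) *
            ∫⁻ k in Metric.closedBall (0 : HorSpace d) (ε * t), J k)) := by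
          rw [lintegral_const_mul' _ _ ENNReal.ofReal_ne_top, lintegral_const_mul' _ _ hC1top,
            h2, h3]
          ring
      _ = _ := by
          rw [lintegral_indicator Metric.isClosed_closedBall.measurableSet,
            lintegral_mul_const' _ _ ENNReal.ofReal_ne_top, ← mul_assoc (ENNReal.ofReal _),
            ← ENNReal.ofReal_mul (by positivity), mul_comm (∫⁻ k in _, J k)]
          congr 3
          rw [← Real.rpow_natCast, ← Real.rpow_neg ht0.le, ← Real.rpow_add ht0]
          congr 1
          rw [hsdef]; ring
  have hm : AEMeasurable (fun x : FullSpace d => ‖x.2⁻¹ * avg χ g x‖ₑ ^ p)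
      (volume.restrict (strip d 0 b)) := by
    have h1 : ContinuousOn (avg χ g) (strip d 0 b) :=
      (contDiffOn_avg h hε.le hg).continuousOn.mono strip_subset_upper
    exact ((measurable_snd.inv.aemeasurable).mul
      (h1.aemeasurable (measurableSet_strip 0 b))).enorm.pow_const _
  have hcone : MeasurableSet {q : ℝ × HorSpace d | ‖q.2‖ ≤ ε * q.1} :=
    measurableSet_le (by fun_prop) (by fun_prop)
  have hker : ∀ k : HorSpace d, ∫⁻ t in Ioo 0 b, (Metric.closedBall (0 : HorSpace d)
      (ε * t)).indicator (fun k => J k * ENNReal.ofReal (t ^ (-(s + 1)))) k ≤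
      (Metric.ball (0 : HorSpace d) (ε * b)).indicator
        (fun k => J k * ENNReal.ofReal (ε ^ s / s) * ENNReal.ofReal ((‖k‖ ^ s)⁻¹)) k := by
    intro k
    by_cases hk : k ∈ Metric.ball (0 : HorSpace d) (ε * b)
    · rw [indicator_of_mem hk]
      -- At k = 0 the tail integral in t has no positive lower limit and may diverge, but J 0 = 0
      -- kills the integrand.
      rcases eq_or_ne k 0 with rfl | hk0
      · refine le_of_eq_of_le ?_ zero_le
        refine (setLIntegral_congr_fun measurableSet_Ioo (g := fun _ => 0) ?_).trans (by simp)
        intro t _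
        simp [hJ0]
      · have hkn : 0 < ‖k‖ := norm_pos_iff.2 hk0
        have hc : 0 < ‖k‖ / ε := div_pos hkn hε
        calc ∫⁻ t in Ioo 0 b, (Metric.closedBall (0 : HorSpace d)
              (ε * t)).indicator (fun k => J k * ENNReal.ofReal (t ^ (-(s + 1)))) k
            ≤ ∫⁻ t in Ici (‖k‖ / ε), J k * ENNReal.ofReal (t ^ (-(s + 1))) := by
              rw [← lintegral_indicator measurableSet_Ioo, ← lintegral_indicator measurableSet_Ici]
              refine lintegral_mono fun t => ?_
              by_cases ht : k ∈ Metric.closedBall (0 : HorSpace d) (ε * t)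
              · have ht' : t ∈ Ici (‖k‖ / ε) := by
                  rw [mem_closedBall_zero_iff] at ht
                  rw [mem_Ici, div_le_iff₀ hε, mul_comm]; exact ht
                rw [indicator_of_mem ht']
                refine (indicator_le_self _ _ _).trans ?_
                exact indicator_le_self _ _ _
              · have : (fun t => (Metric.closedBall (0 : HorSpace d) (ε * t)).indicator
                    (fun k => J k * ENNReal.ofReal (t ^ (-(s + 1)))) k) t = 0 :=
                  indicator_of_notMem ht _
                refine ((indicator_le_self _ _ t).trans this.le).trans zero_le
          _ = J k * ENNReal.ofReal ((‖k‖ / ε) ^ (-s) / s) := by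
              rw [lintegral_const_mul _ (by fun_prop), setLIntegral_congr Ioi_ae_eq_Ici.symm,
                lintegral_Ioi_rpow_neg hc hs]
          _ = _ := by
              rw [mul_assoc, ← ENNReal.ofReal_mul (by positivity)]
              congr 2
              rw [Real.rpow_neg hc.le, Real.div_rpow hkn.le hε.le]
              field_simp
    · rw [indicator_of_notMem hk, nonpos_iff_eq_zero]
      refine (setLIntegral_congr_fun measurableSet_Ioo (g := fun _ => 0) ?_).trans (by simp)
      intro t ht
      apply indicator_of_notMem
      rw [mem_ball_zero_iff, not_lt] at hk
      rw [mem_closedBall_zero_iff, not_le]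
      exact (mul_lt_mul_of_pos_left ht.2 hε).trans_le hk
  calc ∫⁻ x in strip d 0 b, ‖x.2⁻¹ * avg χ g x‖ₑ ^ p
      = ∫⁻ t in Ioo 0 b, ∫⁻ x', ‖t⁻¹ * avg χ g (x', t)‖ₑ ^ p := lintegral_strip_symm hm
    _ ≤ ∫⁻ t in Ioo 0 b, C1 * ∫⁻ k, (Metric.closedBall (0 : HorSpace d) (ε * t)).indicator
        (fun k => J k * ENNReal.ofReal (t ^ (-(s + 1)))) k :=
        setLIntegral_mono' measurableSet_Ioo hpt
    _ = C1 * ∫⁻ k, ∫⁻ t in Ioo 0 b, (Metric.closedBall (0 : HorSpace d) (ε * t)).indicator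
        (fun k => J k * ENNReal.ofReal (t ^ (-(s + 1)))) k := by
        rw [lintegral_const_mul' _ _ hC1top, lintegral_lintegral_swap]
        have : Measurable (fun q : ℝ × HorSpace d => {q : ℝ × HorSpace d |
            ‖q.2‖ ≤ ε * q.1}.indicator (fun q => J q.2 * ENNReal.ofReal (q.1 ^ (-(s + 1)))) q) :=
          Measurable.indicator (by fun_prop) hcone
        refine Measurable.aemeasurable ?_
        convert this using 1
        funext q
        simp [Function.uncurry, indicator]
    _ ≤ C1 * ∫⁻ k, (Metric.ball (0 : HorSpace d) (ε * b)).indicator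
        (fun k => J k * ENNReal.ofReal (ε ^ s / s) * ENNReal.ofReal ((‖k‖ ^ s)⁻¹)) k := by
        gcongr with k
        exact hker k
    _ = C1 * ENNReal.ofReal (ε ^ s / s) * ∫⁻ k in Metric.ball (0 : HorSpace d) (ε * b),
          J k * ENNReal.ofReal ((‖k‖ ^ s)⁻¹) := by
        rw [lintegral_indicator Metric.isOpen_ball.measurableSet, mul_assoc C1,
          ← lintegral_const_mul' _ _ ENNReal.ofReal_ne_top]
        congr 2; funext k
        ring
    _ = C1 * ENNReal.ofReal (ε ^ s / s) * diffEnergy p (ε * b) g := by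
        congr 1
        unfold diffEnergy
        rw [lintegral_lintegral_swap (by fun_prop)]
        refine lintegral_congr fun k => ?_
        rw [lintegral_mul_const' _ _ ENNReal.ofReal_ne_top]

/-- For fixed t and y the function g is only translated by ty, of length at most εb, so every slice
is controlled by the norm of g on a ball of radius R + εb. -/
theorem lintegral_avg_lt_top {ε p : ℝ} {χ g : HorSpace d → ℝ} (h : IsKernel ε χ) (hε : 0 < ε)
    (hp : 1 < p) (hgm : Measurable g) (hg : LocallyIntegrable g)
    (hgp : ∀ R : ℝ, ∫⁻ x in Metric.closedBall (0 : HorSpace d) R, ‖g x‖ₑ ^ p < ⊤) (R b : ℝ) :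
    ∫⁻ x in strip d 0 b ∩ {x | ‖x.1‖ ≤ R}, ‖avg χ g x‖ₑ ^ p < ⊤ := by
  obtain ⟨M, hM0, hM⟩ := h.exists_bound
  have hp0 : 0 < p := by linarith
  set V := volume (Metric.closedBall (0 : HorSpace d) ε) with hV
  have hVtop : V ≠ ⊤ := measure_closedBall_lt_top.ne
  set C1 : ℝ≥0∞ := ENNReal.ofReal M ^ p * V ^ (p - 1) with hC1
  have hC1top : C1 ≠ ⊤ := ENNReal.mul_ne_top (ENNReal.rpow_ne_top_of_nonneg hp0.le
    ENNReal.ofReal_ne_top) (ENNReal.rpow_ne_top_of_nonneg (by linarith) hVtop)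
  have hms : MeasurableSet {x : FullSpace d | ‖x.1‖ ≤ R} :=
    measurableSet_le (by fun_prop) (by fun_prop)
  set A := ∫⁻ x in Metric.closedBall (0 : HorSpace d) (R + ε * b), ‖g x‖ₑ ^ p with hA
  have hpt : ∀ t ∈ Ioo 0 b, ∫⁻ x', {x : FullSpace d | ‖x.1‖ ≤ R}.indicator
      (fun x => ‖avg χ g x‖ₑ ^ p) (x', t) ≤ C1 * (A * V) := by
    intro t ht
    calc ∫⁻ x', {x : FullSpace d | ‖x.1‖ ≤ R}.indicator (fun x => ‖avg χ g x‖ₑ ^ p) (x', t)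
        ≤ ∫⁻ x', (Metric.closedBall (0 : HorSpace d) R).indicator (fun x' => C1 *
            ∫⁻ y in Metric.closedBall 0 ε, ‖g (x' - t • y)‖ₑ ^ p) x' := by
          refine lintegral_mono fun x' => ?_
          by_cases hx : ‖x'‖ ≤ R
          · rw [indicator_of_mem (by simpa using hx), indicator_of_mem (by simpa using hx)]
            exact enorm_avg_rpow_le h hM hp hgm (x := (x', t)) ht.1
          · rw [indicator_of_notMem (by simpa using hx)]
            exact zero_le
      _ = C1 * ∫⁻ y in Metric.closedBall (0 : HorSpace d) ε,
            ∫⁻ x' in Metric.closedBall (0 : HorSpace d) R, ‖g (x' - t • y)‖ₑ ^ p := by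
          rw [lintegral_indicator Metric.isClosed_closedBall.measurableSet,
            lintegral_const_mul' _ _ hC1top, lintegral_lintegral_swap (by fun_prop)]
      _ ≤ C1 * ∫⁻ y in Metric.closedBall (0 : HorSpace d) ε, A := by
          gcongr 1
          refine setLIntegral_mono' Metric.isClosed_closedBall.measurableSet fun y hy => ?_
          rw [hA, ← lintegral_indicator Metric.isClosed_closedBall.measurableSet,
            ← lintegral_indicator Metric.isClosed_closedBall.measurableSet,
            ← lintegral_sub_right_eq_self ((Metric.closedBall (0 : HorSpace d)
              (R + ε * b)).indicator fun x => ‖g x‖ₑ ^ p) (t • y)]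
          refine lintegral_mono fun x' => ?_
          by_cases hx : x' ∈ Metric.closedBall (0 : HorSpace d) R
          · have : x' - t • y ∈ Metric.closedBall (0 : HorSpace d) (R + ε * b) := by
              rw [mem_closedBall_zero_iff] at hx hy ⊢
              refine (norm_sub_le _ _).trans (add_le_add hx ?_)
              rw [norm_smul, Real.norm_of_nonneg ht.1.le, mul_comm]
              exact mul_le_mul hy ht.2.le ht.1.le hε.le
            rw [indicator_of_mem hx, indicator_of_mem this]
          · rw [indicator_of_notMem hx]
            exact zero_le
      _ = C1 * (A * V) := by rw [setLIntegral_const]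
  rw [inter_comm, ← Measure.restrict_restrict hms, ← lintegral_indicator hms,
    lintegral_strip_symm ((aemeasurable_avg h hε.le hg).indicator hms)]
  refine (setLIntegral_mono' measurableSet_Ioo hpt).trans_lt ?_
  rw [setLIntegral_const]
  exact ENNReal.mul_lt_top (ENNReal.mul_lt_top hC1top.lt_top
    (ENNReal.mul_lt_top (hgp _) hVtop.lt_top)) (by simp)

end Estimates

end

noncomputable section

set_option linter.unusedSectionVars false

/-! ### Derivatives along words and vertical affine maps -/

section Words

variable {d : ℕ}

/-- Classical iterated partial derivative along a word of coordinate directions. -/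
def wordDeriv (w : List (Fin (d + 1))) (f : FullSpace d → ℝ) : FullSpace d → ℝ :=
  iterDirDeriv (w.map (fBasis d)) f

theorem wordDeriv_cons (i : Fin (d + 1)) (w : List (Fin (d + 1))) (f : FullSpace d → ℝ)
    (x : FullSpace d) : wordDeriv (i :: w) f x = fderiv ℝ (wordDeriv w f) x (fBasis d i) := rfl

theorem wordDeriv_append (w₁ w₂ : List (Fin (d + 1))) (f : FullSpace d → ℝ) :
    wordDeriv (w₁ ++ w₂) f = wordDeriv w₁ (wordDeriv w₂ f) := by
  simp [wordDeriv, iterDirDeriv_append]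

theorem wordDeriv_contDiffOn {U : Set (FullSpace d)} (hU : IsOpen U) {f : FullSpace d → ℝ}
    (hf : ContDiffOn ℝ ∞ f U) (w : List (Fin (d + 1))) : ContDiffOn ℝ ∞ (wordDeriv w f) U :=
  iterDirDeriv_contDiffOn hU hf _

theorem wordDeriv_congr {U : Set (FullSpace d)} (hU : IsOpen U) {f g : FullSpace d → ℝ}
    (h : EqOn f g U) (w : List (Fin (d + 1))) : EqOn (wordDeriv w f) (wordDeriv w g) U :=
  iterDirDeriv_congr hU h _

theorem wordDeriv_perm {U : Set (FullSpace d)} (hU : IsOpen U) {f : FullSpace d → ℝ}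
    (hf : ContDiffOn ℝ ∞ f U) {w₁ w₂ : List (Fin (d + 1))} (h : w₁.Perm w₂) :
    EqOn (wordDeriv w₁ f) (wordDeriv w₂ f) U :=
  iterDirDeriv_perm hU hf (h.map _)

theorem fBasis_snd (i : Fin (d + 1)) : (fBasis d i).2 = if i = Fin.last d then 1 else 0 := by
  refine Fin.lastCases ?_ (fun j => ?_) i
  · simp [fBasis]
  · simp [fBasis]

theorem fBasis_castSucc (j : Fin d) : fBasis d j.castSucc = (hBasis d j, 0) := by simp [fBasis]

theorem fBasis_last : fBasis d (Fin.last d) = (0, 1) := by simp [fBasis]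

/-- The affine change of the vertical variable. -/
def vertAffine (c l : ℝ) (x : FullSpace d) : FullSpace d := (x.1, c + l * x.2)

theorem wordDeriv_comp_vertAffine {U V : Set (FullSpace d)} (hU : IsOpen U) (hV : IsOpen V)
    {f : FullSpace d → ℝ} (hf : ContDiffOn ℝ ∞ f U) (c l : ℝ)
    (hVU : ∀ x ∈ V, vertAffine c l x ∈ U) (w : List (Fin (d + 1))) :
    EqOn (wordDeriv w (fun x => f (vertAffine c l x)))
      (fun x => l ^ (w.count (Fin.last d)) * wordDeriv w f (vertAffine c l x)) V := by
  induction w with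
  | nil => intro x _; simp [wordDeriv, iterDirDeriv]
  | cons i w ih =>
    intro x hx
    simp only [wordDeriv_cons]
    rw [fderiv_eqOn_of_isOpen hV ih hx]
    have h1 : HasFDerivAt (vertAffine (d := d) c l)
        ((ContinuousLinearMap.fst ℝ (HorSpace d) ℝ).prod
          (l • ContinuousLinearMap.snd ℝ (HorSpace d) ℝ)) x := by
      refine HasFDerivAt.prodMk hasFDerivAt_fst ?_
      exact HasFDerivAt.const_add c (HasFDerivAt.const_mul hasFDerivAt_snd l)
    have h2 : HasFDerivAt (wordDeriv w f) (fderiv ℝ (wordDeriv w f) (vertAffine c l x))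
        (vertAffine c l x) :=
      ((wordDeriv_contDiffOn hU hf w).differentiableAt_of_isOpen hU (hVU x hx)).hasFDerivAt
    have h3 := ((h2.comp x h1).const_mul (l ^ (w.count (Fin.last d)))).fderiv
    simp only [Function.comp_def] at h3
    rw [h3]
    refine Fin.lastCases ?_ (fun j => ?_) i
    · rw [fBasis_last, List.count_cons_self, pow_succ]
      have : ((0 : HorSpace d), l) = l • ((0 : HorSpace d), (1 : ℝ)) := by simp
      simp only [smul_apply, ContinuousLinearMap.comp_apply,
        ContinuousLinearMap.prod_apply, ContinuousLinearMap.coe_fst', ContinuousLinearMap.coe_snd',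
        smul_eq_mul, mul_one]
      rw [this, map_smul, smul_eq_mul]
      ring
    · rw [fBasis_castSucc, List.count_cons_of_ne (Fin.castSucc_lt_last j).ne]
      simp

end Words

/-! ### Derivatives of the layers t^k (g ∗ ψ_t) -/

section Symbols

variable {d : ℕ}

/-- The functions `G γ`, `|γ| ≤ s`, are measurable, locally in `L^p`, and are the weak derivatives
of `G 0`. -/
structure IsJet (p : ℝ) (s : ℕ) (G : (Fin d → ℕ) → HorSpace d → ℝ) : Prop where
  measurable : ∀ γ, ∑ i, γ i ≤ s → Measurable (G γ)
  locallyIntegrable : ∀ γ, ∑ i, γ i ≤ s → LocallyIntegrable (G γ)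
  lintegral_lt_top : ∀ γ, ∑ i, γ i ≤ s → ∀ R : ℝ,
    ∫⁻ x in Metric.closedBall (0 : HorSpace d) R, ‖G γ x‖ₑ ^ p < ⊤
  isWeakDir : ∀ γ, ∑ i, γ i + 1 ≤ s → ∀ r, IsWeakDir (hBasis d r) (G γ) (G (γ + Pi.single r 1))

theorem sum_add_single (γ : Fin d → ℕ) (r : Fin d) :
    ∑ i, (γ + Pi.single r 1 : Fin d → ℕ) i = ∑ i, γ i + 1 := by
  simp [Finset.sum_add_distrib]

theorem sum_count_eq_length (τ : List (Fin d)) : ∑ i, τ.count i = τ.length := by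
  induction τ with
  | nil => simp
  | cons j τ ih => simp [List.count_cons, Finset.sum_add_distrib, ih]

theorem contDiffOn_pow_mul_avg {ε : ℝ} {χ g : HorSpace d → ℝ} (h : IsKernel ε χ) (hε : 0 ≤ ε)
    (hg : LocallyIntegrable g) (a : ℕ) :
    ContDiffOn ℝ ∞ (fun x => x.2 ^ a * avg χ g x) (upper d) :=
  (contDiff_snd.pow a).contDiffOn.mul (contDiffOn_avg h hε hg)

theorem fderiv_pow_mul_avg {ε : ℝ} {χ g : HorSpace d → ℝ} (h : IsKernel ε χ) (hε : 0 ≤ ε)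
    (hg : LocallyIntegrable g) (a : ℕ) (i : Fin (d + 1)) {x : FullSpace d} (hx : x ∈ upper d) :
    fderiv ℝ (fun x => x.2 ^ (a + 1) * avg χ g x) x (fBasis d i) =
      x.2 ^ a * avg (fun y => ((a + 1 : ℝ) * if i = Fin.last d then 1 else 0) * χ y +
        kernelDeriv i χ y) g x := by
  have hx0 : (0 : ℝ) < x.2 := hx
  have h1 : HasFDerivAt (fun x : FullSpace d => x.2 ^ (a + 1))
      (((a + 1 : ℕ) * x.2 ^ a) • ContinuousLinearMap.snd ℝ (HorSpace d) ℝ) x := by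
    have := (hasFDerivAt_snd (𝕜 := ℝ) (E := HorSpace d) (F := ℝ) (p := x)).pow (a + 1)
    simpa using this
  have h2 := ((contDiffOn_avg h hε hg).differentiableAt_of_isOpen isOpen_upper hx).hasFDerivAt
  have h3 := (h1.mul h2).fderiv
  change fderiv ℝ (fun x => x.2 ^ (a + 1) * avg χ g x) x = _ at h3
  rw [h3, avg_add_kernel (h.mul contDiff_const) (h.kernelDeriv i) hg hx, avg_const_mul_kernel]
  simp only [add_apply, smul_apply, smul_eq_mul,
    ContinuousLinearMap.coe_snd', fBasis_snd]
  rw [fderiv_avg h hε hg hx]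
  push_cast
  field_simp
  ring

/-- Each derivative lowers the power of t by one and replaces χ by `kernelDeriv` of χ, plus a
multiple of χ when it is vertical. As `kernelDeriv` has mean zero, a vertical derivative just
multiplies the mass by the current exponent, whence the descending factorial. -/
theorem wordDeriv_pow_mul_avg {ε : ℝ} (hε : 0 ≤ ε) {χ : HorSpace d → ℝ} (h : IsKernel ε χ)
    (a : ℕ) (w : List (Fin (d + 1))) (hw : w.length ≤ a) :
    ∃ χ' : HorSpace d → ℝ, IsKernel ε χ' ∧
      ((∀ i ∈ w, i = Fin.last d) → ∫ y, χ' y = a.descFactorial w.length * ∫ y, χ y) ∧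
      ∀ g : HorSpace d → ℝ, LocallyIntegrable g → EqOn (wordDeriv w (fun x => x.2 ^ a * avg χ g x))
        (fun x => x.2 ^ (a - w.length) * avg χ' g x) (upper d) := by
  induction w with
  | nil => exact ⟨χ, h, by simp, fun g _ x _ => rfl⟩
  | cons i w ih =>
    rw [List.length_cons] at hw
    obtain ⟨χ', h1, h2, h3⟩ := ih (by omega)
    obtain ⟨b, hb⟩ : ∃ b, a - w.length = b + 1 := ⟨a - w.length - 1, by omega⟩
    refine ⟨fun y => ((b + 1 : ℝ) * if i = Fin.last d then 1 else 0) * χ' y +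
      kernelDeriv i χ' y, (h1.mul contDiff_const).add (h1.kernelDeriv i), ?_, ?_⟩
    · intro hi
      have e1 := h2 fun j hj => hi j (List.mem_cons_of_mem _ hj)
      have e2 : i = Fin.last d := hi i (by simp)
      rw [integral_add (h1.integrable.const_mul _) (h1.kernelDeriv i).integrable,
        h1.integral_kernelDeriv, integral_const_mul, e1, List.length_cons,
        Nat.descFactorial_succ, hb, if_pos e2]
      push_cast; ring
    · intro g hg x hx
      simp only [wordDeriv_cons]
      rw [fderiv_eqOn_of_isOpen isOpen_upper (h3 g hg) hx, hb,
        fderiv_pow_mul_avg h1 hε hg b i hx, List.length_cons]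
      have : a - (w.length + 1) = b := by omega
      rw [this]

theorem fderiv_sum_avg {ε : ℝ} (hε : 0 ≤ ε) {ι : Type} [Fintype ι] {χ g : ι → HorSpace d → ℝ}
    (h : ∀ r, IsKernel ε (χ r)) (hg : ∀ r, LocallyIntegrable (g r)) {x : FullSpace d}
    (hx : x ∈ upper d) (v : FullSpace d) :
    fderiv ℝ (fun x => ∑ r, avg (χ r) (g r) x) x v = ∑ r, fderiv ℝ (avg (χ r) (g r)) x v := by
  rw [fderiv_fun_sum fun r _ =>
    (contDiffOn_avg (h r) hε (hg r)).differentiableAt_of_isOpen isOpen_upper hx]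
  simp

/-- Every derivative is moved onto the mollified function, at the price of a bounded polynomial
factor in the kernel, so no power of t is lost. The kernels are fixed before G, which makes later
constants uniform in the data. -/
theorem wordDeriv_avg_jet {ε p : ℝ} (hε : 0 ≤ ε) {χ : HorSpace d → ℝ} (h : IsKernel ε χ)
    (s : ℕ) (w : List (Fin (d + 1))) (hw : w.length ≤ s) :
    ∃ (ι : Type) (_ : Fintype ι) (χ' : ι → HorSpace d → ℝ) (γ : ι → Fin d → ℕ),
      (∀ r, IsKernel ε (χ' r)) ∧ (∀ r, ∑ i, γ r i = w.length) ∧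
      ∀ G : (Fin d → ℕ) → HorSpace d → ℝ, IsJet p s G → EqOn (wordDeriv w (avg χ (G 0)))
        (fun x => ∑ r, avg (χ' r) (G (γ r)) x) (upper d) := by
  induction w with
  | nil =>
    refine ⟨Unit, inferInstance, fun _ => χ, fun _ => 0, fun _ => h, by simp, ?_⟩
    intro G _ x _
    simp [wordDeriv, iterDirDeriv]
  | cons i w ih =>
    rw [List.length_cons] at hw
    obtain ⟨ι, hι, χ', γ, h1, h2, h3⟩ := ih (by omega)
    refine ⟨ι × Fin d, inferInstance, fun q y => dirCoef d i q.2 y * χ' q.1 y,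
      fun q => γ q.1 + Pi.single q.2 1, fun q => (h1 q.1).mul (contDiff_dirCoef i q.2), ?_, ?_⟩
    · intro q
      rw [sum_add_single, h2, List.length_cons]
    · intro G hG x hx
      have hle : ∀ r, ∑ i, γ r i ≤ s := fun r => by rw [h2]; omega
      simp only [wordDeriv_cons]
      rw [fderiv_eqOn_of_isOpen isOpen_upper (h3 G hG) hx,
        fderiv_sum_avg hε h1 (fun r => hG.locallyIntegrable _ (hle r)) hx, Fintype.sum_prod_type]
      refine Finset.sum_congr rfl fun r _ => ?_
      exact fderiv_avg_of_isWeakDir (h1 r) hε (hG.locallyIntegrable _ (hle r))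
        (hG.isWeakDir (γ r) (by rw [h2]; omega)) hx i

/-- The jet is exhausted after s derivatives. The outermost one is left on the kernel: it costs 1/t
but produces the mean zero needed in `lintegral_avg_le`. -/
theorem wordDeriv_avg_jet_top {ε p : ℝ} (hε : 0 ≤ ε) {χ : HorSpace d → ℝ} (h : IsKernel ε χ)
    (s : ℕ) (w : List (Fin (d + 1))) (hw : w.length = s + 1) :
    ∃ (ι : Type) (_ : Fintype ι) (χ' : ι → HorSpace d → ℝ) (γ : ι → Fin d → ℕ),
      (∀ r, IsKernel ε (χ' r)) ∧ (∀ r, ∫ y, χ' r y = 0) ∧ (∀ r, ∑ i, γ r i = s) ∧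
      ∀ G : (Fin d → ℕ) → HorSpace d → ℝ, IsJet p s G → EqOn (wordDeriv w (avg χ (G 0)))
        (fun x => ∑ r, x.2⁻¹ * avg (χ' r) (G (γ r)) x) (upper d) := by
  obtain _ | ⟨i, w⟩ := w
  · simp at hw
  rw [List.length_cons, Nat.add_right_cancel_iff] at hw
  obtain ⟨ι, hι, χ', γ, h1, h2, h3⟩ := wordDeriv_avg_jet (p := p) hε h s w hw.le
  refine ⟨ι, hι, fun r => kernelDeriv i (χ' r), γ, fun r => (h1 r).kernelDeriv i,
    fun r => (h1 r).integral_kernelDeriv i, fun r => by rw [h2, hw], ?_⟩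
  intro G hG x hx
  have hle : ∀ r, ∑ i, γ r i ≤ s := fun r => by rw [h2]; omega
  simp only [wordDeriv_cons]
  rw [fderiv_eqOn_of_isOpen isOpen_upper (h3 G hG) hx,
    fderiv_sum_avg hε h1 (fun r => hG.locallyIntegrable _ (hle r)) hx]
  exact Finset.sum_congr rfl fun r _ => fderiv_avg (h1 r) hε (hG.locallyIntegrable _ (hle r)) hx i

theorem wordDeriv_horizontal_avg_jet {ε p : ℝ} (hε : 0 ≤ ε) {χ : HorSpace d → ℝ}
    (h : IsKernel ε χ) (s : ℕ) (τ : List (Fin d)) (hw : τ.length ≤ s)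
    {G : (Fin d → ℕ) → HorSpace d → ℝ} (hG : IsJet p s G) :
    EqOn (wordDeriv (τ.map Fin.castSucc) (avg χ (G 0))) (avg χ (G fun i => τ.count i))
      (upper d) := by
  induction τ with
  | nil => intro x _; rfl
  | cons j τ ih =>
    rw [List.length_cons] at hw
    intro x hx
    have hsum : ∑ i, τ.count i = τ.length := sum_count_eq_length τ
    have hloc := hG.locallyIntegrable (fun i => τ.count i) (by rw [hsum]; omega)
    rw [List.map_cons, wordDeriv_cons, fderiv_eqOn_of_isOpen isOpen_upper (ih (by omega)) hx,
      fderiv_avg_of_isWeakDir h hε hloc (hG.isWeakDir (fun i => τ.count i) (by rw [hsum]; omega))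
        hx, Finset.sum_eq_single j]
    · have e1 : (fun y => dirCoef d j.castSucc j y * χ y) = χ := by
        funext y; simp [dirCoef_castSucc]
      have e2 : (fun i => (j :: τ).count i) = (fun i => τ.count i) + Pi.single j 1 := by
        funext i
        simp only [Pi.add_apply, List.count_cons, Pi.single_apply, beq_iff_eq]
        by_cases hij : i = j
        · simp [hij]
        · simp [hij, Ne.symm hij]
      rw [e1, e2]
    · intro r _ hr
      have : (fun y => dirCoef d j.castSucc r y * χ y) = fun _ => 0 := by
        funext y; simp [dirCoef_castSucc, hr.symm]
      rw [this]; simp [avg]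
    · simp

/-- Derivatives of `t^k (g ∗ ψ_t)` up to the order `k + s`. -/
theorem wordDeriv_layer {ε p : ℝ} (hε : 0 ≤ ε) {ψ : HorSpace d → ℝ} (h : IsKernel ε ψ)
    (k s : ℕ) (w : List (Fin (d + 1))) (hw : w.length ≤ k + s) :
    ∃ (a : ℕ) (ι : Type) (_ : Fintype ι) (χ : ι → HorSpace d → ℝ) (γ : ι → Fin d → ℕ),
      (∀ r, IsKernel ε (χ r)) ∧ (∀ r, ∑ i, γ r i ≤ s) ∧
      ∀ G : (Fin d → ℕ) → HorSpace d → ℝ, IsJet p s G →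
        EqOn (wordDeriv w (fun x => x.2 ^ k * avg ψ (G 0) x))
        (fun x => ∑ r, x.2 ^ a * avg (χ r) (G (γ r)) x) (upper d) := by
  rcases le_or_gt w.length k with hk | hk
  · obtain ⟨χ', h1, -, h3⟩ := wordDeriv_pow_mul_avg hε h k w hk
    refine ⟨k - w.length, Unit, inferInstance, fun _ => χ', fun _ => 0, fun _ => h1, by simp, ?_⟩
    intro G hG x hx
    simpa using h3 (G 0) (hG.locallyIntegrable 0 (by simp)) hx
  -- A word acts from its right end, so the last k letters come first and use up t^k; the remaining
  -- ones go onto the jet.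
  · set w₁ := w.take (w.length - k) with hw₁
    set w₂ := w.drop (w.length - k) with hw₂
    have hl1 : w₁.length = w.length - k := by simp [hw₁]
    have hl2 : w₂.length = k := by simp [hw₂]; omega
    obtain ⟨χ', h1, -, h3⟩ := wordDeriv_pow_mul_avg hε h k w₂ hl2.le
    obtain ⟨ι, hι, χ, γ, k1, k2, k3⟩ := wordDeriv_avg_jet (p := p) hε h1 s w₁ (by omega)
    refine ⟨0, ι, hι, χ, γ, k1, fun r => by rw [k2]; omega, ?_⟩
    intro G hG x hx
    have hloc := hG.locallyIntegrable 0 (by simp)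
    rw [← List.take_append_drop (w.length - k) w, ← hw₁, ← hw₂, wordDeriv_append]
    have e : EqOn (wordDeriv w₂ fun x => x.2 ^ k * avg ψ (G 0) x) (avg χ' (G 0)) (upper d) := by
      intro z hz
      rw [h3 (G 0) hloc hz]; simp [hl2]
    rw [wordDeriv_congr isOpen_upper e w₁ hx, k3 G hG hx]
    simp

/-- Derivatives of `t^k (g ∗ ψ_t)` of the order `k + s + 1`. -/
theorem wordDeriv_layer_top {ε p : ℝ} (hε : 0 ≤ ε) {ψ : HorSpace d → ℝ} (h : IsKernel ε ψ)
    (k s : ℕ) (w : List (Fin (d + 1))) (hw : w.length = k + s + 1) :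
    ∃ (ι : Type) (_ : Fintype ι) (χ : ι → HorSpace d → ℝ) (γ : ι → Fin d → ℕ),
      (∀ r, IsKernel ε (χ r)) ∧ (∀ r, ∫ y, χ r y = 0) ∧ (∀ r, ∑ i, γ r i = s) ∧
      ∀ G : (Fin d → ℕ) → HorSpace d → ℝ, IsJet p s G →
        EqOn (wordDeriv w (fun x => x.2 ^ k * avg ψ (G 0) x))
        (fun x => ∑ r, x.2⁻¹ * avg (χ r) (G (γ r)) x) (upper d) := by
  set w₁ := w.take (w.length - k) with hw₁
  set w₂ := w.drop (w.length - k) with hw₂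
  have hl1 : w₁.length = s + 1 := by simp [hw₁]; omega
  have hl2 : w₂.length = k := by simp [hw₂]; omega
  obtain ⟨χ', h1, -, h3⟩ := wordDeriv_pow_mul_avg hε h k w₂ hl2.le
  obtain ⟨ι, hι, χ, γ, k1, k0, k2, k3⟩ := wordDeriv_avg_jet_top (p := p) hε h1 s w₁ hl1
  refine ⟨ι, hι, χ, γ, k1, k0, k2, ?_⟩
  intro G hG x hx
  have hloc := hG.locallyIntegrable 0 (by simp)
  rw [← List.take_append_drop (w.length - k) w, ← hw₁, ← hw₂, wordDeriv_append]
  have e : EqOn (wordDeriv w₂ fun x => x.2 ^ k * avg ψ (G 0) x) (avg χ' (G 0)) (upper d) := by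
    intro z hz
    rw [h3 (G 0) hloc hz]; simp [hl2]
  rw [wordDeriv_congr isOpen_upper e w₁ hx, k3 G hG hx]

/-- The trace of the derivative `∂^τ ∂_N^n` of `t^n (g ∗ ψ_t)`. -/
theorem wordDeriv_layer_diag {ε p : ℝ} (hε : 0 < ε) {ψ : HorSpace d → ℝ} (h : IsKernel ε ψ)
    (n s : ℕ) (τ : List (Fin d)) (hτ : τ.length ≤ s)
    {G : (Fin d → ℕ) → HorSpace d → ℝ} (hG : IsJet p s G) : ∀ᵐ x' : HorSpace d,
      Filter.Tendsto (fun t : ℝ => wordDeriv (τ.map Fin.castSucc ++ List.replicate n (Fin.last d))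
        (fun x => x.2 ^ n * avg ψ (G 0) x) (x', t)) (nhdsWithin 0 (Ioi 0))
        (nhds (n.factorial * (∫ y, ψ y) * G (fun i => τ.count i) x')) := by
  -- The n vertical derivatives use up t^n and multiply the mass by n!; the horizontal ones then
  -- pass onto G without altering the kernel.
  obtain ⟨χ', h1, h2, h3⟩ := wordDeriv_pow_mul_avg hε.le h n (List.replicate n (Fin.last d))
    (by simp)
  have h2' := h2 (by simp)
  rw [List.length_replicate, Nat.descFactorial_self] at h2'
  rw [← h2']
  have hsum : ∑ i, τ.count i = τ.length := sum_count_eq_length τ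
  filter_upwards [ae_tendsto_avg h1 hε
    (hG.locallyIntegrable (fun i => τ.count i) (by rw [hsum]; exact hτ))] with x' hx'
  refine hx'.congr' ?_
  filter_upwards [self_mem_nhdsWithin] with t ht
  have hx : ((x', t) : FullSpace d) ∈ upper d := ht
  rw [wordDeriv_append]
  have e : EqOn (wordDeriv (List.replicate n (Fin.last d)) fun x => x.2 ^ n * avg ψ (G 0) x)
      (avg χ' (G 0)) (upper d) := by
    intro z hz
    rw [h3 (G 0) (hG.locallyIntegrable 0 (by simp)) hz]; simp
  rw [wordDeriv_congr isOpen_upper e _ hx]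
  exact (wordDeriv_horizontal_avg_jet hε.le h1 s τ hτ hG hx).symm

/-- Only the existence of the limit matters. Off the diagonal k = n its value is cancelled by the
choice of `dilCoef`. -/
theorem wordDeriv_layer_tendsto {ε p : ℝ} (hε : 0 < ε) {ψ : HorSpace d → ℝ} (h : IsKernel ε ψ)
    (k s : ℕ) (w : List (Fin (d + 1))) (hw : w.length ≤ k + s)
    {G : (Fin d → ℕ) → HorSpace d → ℝ} (hG : IsJet p s G) : ∃ Λ : HorSpace d → ℝ,
      ∀ᵐ x' : HorSpace d, Filter.Tendsto (fun t : ℝ => wordDeriv w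
        (fun x => x.2 ^ k * avg ψ (G 0) x) (x', t)) (nhdsWithin 0 (Ioi 0)) (nhds (Λ x')) := by
  obtain ⟨a, ι, hι, χ, γ, h1, h2, h3⟩ := wordDeriv_layer (p := p) hε.le h k s w hw
  refine ⟨fun x' => ∑ r, (0 : ℝ) ^ a * ((∫ y, χ r y) * G (γ r) x'), ?_⟩
  have hall := ae_all_iff.2 fun r =>
    ae_tendsto_avg (h1 r) hε (hG.locallyIntegrable (γ r) (h2 r))
  filter_upwards [hall] with x' hx'
  have ht : Filter.Tendsto (fun t : ℝ => t ^ a) (nhdsWithin 0 (Ioi 0)) (nhds (0 ^ a)) :=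
    ((continuous_pow a).tendsto 0).mono_left nhdsWithin_le_nhds
  have := tendsto_finsetSum Finset.univ fun r _ => ht.mul (hx' r)
  refine this.congr' ?_
  filter_upwards [self_mem_nhdsWithin] with t ht
  exact (h3 G hG (show ((x', t) : FullSpace d) ∈ upper d from ht)).symm

end Symbols

end

noncomputable section

set_option linter.unusedSectionVars false

/-! ### Power inequalities for sums and the vertical change of variables -/

theorem enorm_sum_rpow_le {ι : Type*} (s : Finset ι) (f : ι → ℝ) {p : ℝ} (hp : 1 ≤ p) :
    ‖∑ i ∈ s, f i‖ₑ ^ p ≤ (s.card : ℝ≥0∞) ^ (p - 1) * ∑ i ∈ s, ‖f i‖ₑ ^ p :=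
  (ENNReal.rpow_le_rpow (enorm_sum_le s f) (by linarith)).trans
    (ENNReal.rpow_sum_le_const_mul_sum_rpow s _ hp)

theorem natCast_rpow_ne_top (n : ℕ) {q : ℝ} (hq : 0 ≤ q) : (n : ℝ≥0∞) ^ q ≠ ⊤ :=
  ENNReal.rpow_ne_top_of_nonneg hq (ENNReal.natCast_ne_top n)

section VertAffine

variable {d : ℕ}

theorem continuous_vertAffine (c l : ℝ) : Continuous (vertAffine (d := d) c l) := by
  unfold vertAffine; fun_prop

theorem contDiff_vertAffine (c l : ℝ) : ContDiff ℝ ∞ (vertAffine (d := d) c l) := by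
  unfold vertAffine; fun_prop

theorem measurableEmbedding_vertAffine (c : ℝ) {l : ℝ} (hl : l ≠ 0) :
    MeasurableEmbedding (vertAffine (d := d) c l) := by
  refine (continuous_vertAffine c l).measurableEmbedding ?_
  rintro ⟨x, s⟩ ⟨y, t⟩ h
  simp only [vertAffine, Prod.mk.injEq, add_right_inj, mul_eq_mul_left_iff, hl, or_false] at h
  exact Prod.ext h.1 h.2

theorem map_vertAffine (c : ℝ) {l : ℝ} (hl : l ≠ 0) :
    Measure.map (vertAffine (d := d) c l) volume = ENNReal.ofReal |l⁻¹| • volume := by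
  have h1 : Measure.map (fun t : ℝ => c + l * t) volume = ENNReal.ofReal |l⁻¹| • volume := by
    have : (fun t : ℝ => c + l * t) = (fun t => c + t) ∘ (fun t => l * t) := rfl
    rw [this, ← Measure.map_map (by fun_prop) (by fun_prop), Real.map_volume_mul_left hl,
      Measure.map_smul, map_add_left_eq_self]
  have h2 := Measure.map_prod_map (volume : Measure (HorSpace d)) (volume : Measure ℝ)
    measurable_id (show Measurable (fun t : ℝ => c + l * t) by fun_prop)
  rw [h1, Measure.map_id, Measure.prod_smul_right] at h2
  exact h2.symm

theorem setLIntegral_comp_vertAffine (c : ℝ) {l : ℝ} (hl : l ≠ 0) (S : Set (FullSpace d))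
    (F : FullSpace d → ℝ≥0∞) :
    ∫⁻ x in vertAffine c l ⁻¹' S, F (vertAffine c l x) =
      ENNReal.ofReal |l⁻¹| * ∫⁻ x in S, F x := by
  have h := measurableEmbedding_vertAffine (d := d) c hl
  rw [← h.lintegral_map, ← h.restrict_map, map_vertAffine c hl, Measure.restrict_smul,
    lintegral_smul_measure, smul_eq_mul]

end VertAffine

/-! ### Extension of Cauchy data to the half space -/

section HalfSpace

variable {d m : ℕ}

/-- The elementary extension `t^k (g ∗ ψ_t)`. -/
def layer (k : ℕ) (ψ g : HorSpace d → ℝ) (x : FullSpace d) : ℝ := x.2 ^ k * avg ψ g x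

/-- The dilations of the vertical variable. -/
def dilNode (j : Fin m) : ℝ := 1 / ((j : ℝ) + 1)

theorem dilNode_pos (j : Fin m) : 0 < dilNode j := by unfold dilNode; positivity

/-- Dilations of ratio at most 1 map the strip of width b into itself, so the energies of the layers
are needed on that strip only. -/
theorem dilNode_le_one (j : Fin m) : dilNode j ≤ 1 := by
  unfold dilNode
  rw [div_le_one (by positivity)]
  have : (0 : ℝ) ≤ (j : ℕ) := Nat.cast_nonneg _
  linarith

/-- The inverse of the Vandermonde matrix of the dilations. -/
def dilCoef (k j : Fin m) : ℝ := (Matrix.vandermonde (dilNode (m := m)))⁻¹ k j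

/-- The nodes 1/(j+1) are distinct, so their Vandermonde matrix is invertible. Applied to the
factors λ_j^n of an n-th vertical derivative, the relation selects the layer k = n. -/
theorem sum_dilCoef_mul_pow (k n : Fin m) :
    ∑ j, dilCoef k j * dilNode j ^ (n : ℕ) = if k = n then 1 else 0 := by
  have hinj : Function.Injective (dilNode (m := m)) := by
    intro i j hij
    unfold dilNode at hij
    rw [div_eq_div_iff (by positivity) (by positivity)] at hij
    apply Fin.ext
    have : ((j : ℕ) : ℝ) = (i : ℕ) := by linarith
    exact_mod_cast this.symm
  have hdet : IsUnit (Matrix.vandermonde (dilNode (m := m))).det :=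
    (Matrix.det_vandermonde_ne_zero_iff.2 hinj).isUnit
  have h := congrFun (congrFun (Matrix.nonsing_inv_mul _ hdet) k) n
  rw [Matrix.mul_apply, Matrix.one_apply] at h
  exact h

/-- The extension to the half space of the Cauchy data `f`. -/
def halfExt (ψ : HorSpace d → ℝ) (f : Fin m → HorSpace d → ℝ) (x : FullSpace d) : ℝ :=
  ∑ k : Fin m, ∑ j : Fin m, (dilCoef k j * ((k : ℕ).factorial : ℝ)⁻¹) *
    layer k ψ (f k) (vertAffine 0 (dilNode j) x)

theorem vertAffine_dil_mem (j : Fin m) {x : FullSpace d} (hx : x ∈ upper d) :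
    vertAffine 0 (dilNode j) x ∈ upper d := by
  have : (0 : ℝ) < x.2 := hx
  have h2 := dilNode_pos j
  change 0 < 0 + dilNode j * x.2
  positivity

variable {ε p : ℝ} {ψ : HorSpace d → ℝ}

theorem contDiffOn_layer (hε : 0 ≤ ε) (h : IsKernel ε ψ) (k : ℕ) {g : HorSpace d → ℝ}
    (hg : LocallyIntegrable g) : ContDiffOn ℝ ∞ (layer k ψ g) (upper d) :=
  contDiffOn_pow_mul_avg h hε hg k

theorem contDiffOn_layer_dil (hε : 0 ≤ ε) (h : IsKernel ε ψ) (k : ℕ) {g : HorSpace d → ℝ}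
    (hg : LocallyIntegrable g) (j : Fin m) :
    ContDiffOn ℝ ∞ (fun x => layer k ψ g (vertAffine 0 (dilNode j) x)) (upper d) :=
  (contDiffOn_layer hε h k hg).comp (contDiff_vertAffine _ _).contDiffOn
    fun _ hx => vertAffine_dil_mem j hx

theorem contDiffOn_halfExt (hε : 0 ≤ ε) (h : IsKernel ε ψ) {f : Fin m → HorSpace d → ℝ}
    (hf : ∀ k, LocallyIntegrable (f k)) : ContDiffOn ℝ ∞ (halfExt ψ f) (upper d) :=
  ContDiffOn.sum fun k _ => ContDiffOn.sum fun j _ =>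
    contDiffOn_const.mul (contDiffOn_layer_dil hε h k (hf k) j)

theorem wordDeriv_halfExt (hε : 0 ≤ ε) (h : IsKernel ε ψ) {f : Fin m → HorSpace d → ℝ}
    (hf : ∀ k, LocallyIntegrable (f k)) (w : List (Fin (d + 1))) :
    EqOn (wordDeriv w (halfExt ψ f)) (fun x => ∑ k : Fin m, ∑ j : Fin m,
      (dilCoef k j * ((k : ℕ).factorial : ℝ)⁻¹) * (dilNode j ^ (w.count (Fin.last d)) *
        wordDeriv w (layer k ψ (f k)) (vertAffine 0 (dilNode j) x))) (upper d) := by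
  intro x hx
  unfold wordDeriv halfExt
  rw [iterDirDeriv_sum isOpen_upper (Finset.univ : Finset (Fin m)) (fun k _ => ContDiffOn.sum fun j _ =>
    contDiffOn_const.mul (contDiffOn_layer_dil hε h k (hf k) j)) _ hx]
  refine Finset.sum_congr rfl fun k _ => ?_
  rw [iterDirDeriv_sum isOpen_upper (Finset.univ : Finset (Fin m)) (fun j _ =>
    contDiffOn_const.mul (contDiffOn_layer_dil hε h k (hf k) j)) _ hx]
  refine Finset.sum_congr rfl fun j _ => ?_
  rw [iterDirDeriv_const_mul isOpen_upper _ (contDiffOn_layer_dil hε h k (hf k) j) _ hx]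
  simp only
  congr 1
  exact wordDeriv_comp_vertAffine isOpen_upper isOpen_upper (contDiffOn_layer hε h k (hf k)) 0
    (dilNode j) (fun x hx => vertAffine_dil_mem j hx) w hx

theorem halfExt_add (h : IsKernel ε ψ) {f g : Fin m → HorSpace d → ℝ}
    (hf : ∀ k, LocallyIntegrable (f k)) (hg : ∀ k, LocallyIntegrable (g k)) {x : FullSpace d}
    (hx : x ∈ upper d) :
    halfExt ψ (fun k y => f k y + g k y) x = halfExt ψ f x + halfExt ψ g x := by
  simp only [halfExt, ← Finset.sum_add_distrib]
  refine Finset.sum_congr rfl fun k _ => Finset.sum_congr rfl fun j _ => ?_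
  simp only [layer]
  rw [avg_add h (hf k) (hg k) (vertAffine_dil_mem j hx)]
  ring

theorem halfExt_const_mul (c : ℝ) (f : Fin m → HorSpace d → ℝ) (x : FullSpace d) :
    halfExt ψ (fun k y => c * f k y) x = c * halfExt ψ f x := by
  simp only [halfExt, Finset.mul_sum, layer, avg_const_mul]
  refine Finset.sum_congr rfl fun k _ => Finset.sum_congr rfl fun j _ => ?_
  ring

theorem halfExt_congr_ae {f g : Fin m → HorSpace d → ℝ} (h : ∀ k, f k =ᵐ[volume] g k) :
    halfExt ψ f = halfExt ψ g := by
  funext x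
  simp only [halfExt, layer]
  refine Finset.sum_congr rfl fun k _ => Finset.sum_congr rfl fun j _ => ?_
  rw [avg_congr_ae (h k)]

theorem mem_multiIdx {n k : ℕ} {α : Fin n → ℕ} : α ∈ multiIdx n k ↔ ∑ i, α i = k := by
  simp [multiIdx, Finset.mem_piAntidiag]

/-- A word of length k + s + 1 is one letter too long for the jet, so `wordDeriv_layer_top` writes
the derivative as a finite sum of terms to which `lintegral_avg_le` applies. Their kernels are
chosen before G and b, hence so is C. -/
theorem lintegral_wordDeriv_layer_le (hε : 0 < ε) (h : IsKernel ε ψ) (hp : 1 < p) (k s : ℕ)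
    (w : List (Fin (d + 1))) (hw : w.length = k + s + 1) : ∃ C : ℝ≥0∞, C ≠ ⊤ ∧
      ∀ G : (Fin d → ℕ) → HorSpace d → ℝ, IsJet p s G → ∀ b : ℝ, 0 < b →
        ∫⁻ x in strip d 0 b, ‖wordDeriv w (layer k ψ (G 0)) x‖ₑ ^ p ≤
          C * ∑ γ ∈ multiIdx d s, diffEnergy p (ε * b) (G γ) := by
  obtain ⟨ι, hι, χ, γ, h1, h2, h3, h4⟩ := wordDeriv_layer_top (p := p) hε.le h k s w hw
  choose C hC hCb using fun r => lintegral_avg_le (h1 r) hε (h2 r) hp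
  refine ⟨((Finset.univ : Finset ι).card : ℝ≥0∞) ^ (p - 1) * ∑ r, C r,
    ENNReal.mul_ne_top (natCast_rpow_ne_top (Finset.univ : Finset ι).card (by linarith))
      (ENNReal.sum_ne_top.2 fun r _ => hC r), ?_⟩
  intro G hG b hb
  have hloc : ∀ r, LocallyIntegrable (G (γ r)) := fun r => hG.locallyIntegrable _ (h3 r).le
  calc ∫⁻ x in strip d 0 b, ‖wordDeriv w (layer k ψ (G 0)) x‖ₑ ^ p
      ≤ ∫⁻ x in strip d 0 b, ((Finset.univ : Finset ι).card : ℝ≥0∞) ^ (p - 1) *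
          ∑ r, ‖x.2⁻¹ * avg (χ r) (G (γ r)) x‖ₑ ^ p := by
        refine setLIntegral_mono' (measurableSet_strip 0 b) fun x hx => ?_
        have e := h4 G hG (strip_subset_upper hx)
        change wordDeriv w (layer k ψ (G 0)) x = _ at e
        rw [e]
        exact enorm_sum_rpow_le _ _ hp.le
    _ = ((Finset.univ : Finset ι).card : ℝ≥0∞) ^ (p - 1) * ∑ r,
          ∫⁻ x in strip d 0 b, ‖x.2⁻¹ * avg (χ r) (G (γ r)) x‖ₑ ^ p := by
        rw [lintegral_const_mul' _ _ (natCast_rpow_ne_top _ (by linarith)), lintegral_finsetSum']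
        intro r _
        have hc : ContinuousOn (avg (χ r) (G (γ r))) (strip d 0 b) :=
          (contDiffOn_avg (h1 r) hε.le (hloc r)).continuousOn.mono strip_subset_upper
        exact ((measurable_snd.inv.aemeasurable).mul
          (hc.aemeasurable (measurableSet_strip 0 b))).enorm.pow_const _
    _ ≤ ((Finset.univ : Finset ι).card : ℝ≥0∞) ^ (p - 1) * ∑ r,
          C r * ∑ γ ∈ multiIdx d s, diffEnergy p (ε * b) (G γ) := by
        gcongr with r
        refine (hCb r _ (hG.measurable _ (h3 r).le) (hloc r) b hb).trans ?_
        gcongr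
        exact Finset.single_le_sum (f := fun γ => diffEnergy p (ε * b) (G γ))
          (fun _ _ => zero_le) (mem_multiIdx.2 (h3 r))
    _ = _ := by rw [← Finset.sum_mul, mul_assoc]

theorem lintegral_wordDeriv_layer_lt_top (hε : 0 < ε) (h : IsKernel ε ψ) (hp : 1 < p) (k s : ℕ)
    (w : List (Fin (d + 1))) (hw : w.length ≤ k + s) {G : (Fin d → ℕ) → HorSpace d → ℝ}
    (hG : IsJet p s G) (R b : ℝ) :
    ∫⁻ x in strip d 0 b ∩ {x | ‖x.1‖ ≤ R}, ‖wordDeriv w (layer k ψ (G 0)) x‖ₑ ^ p < ⊤ := by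
  obtain ⟨a, ι, hι, χ, γ, h1, h2, h3⟩ := wordDeriv_layer (p := p) hε.le h k s w hw
  have hms : MeasurableSet (strip d 0 b ∩ {x | ‖x.1‖ ≤ R}) :=
    (measurableSet_strip 0 b).inter (measurableSet_le (by fun_prop) (by fun_prop))
  have hp0 : 0 ≤ p := by linarith
  have hloc : ∀ r, LocallyIntegrable (G (γ r)) := fun r => hG.locallyIntegrable _ (h2 r)
  have hK1 : ((Finset.univ : Finset ι).card : ℝ≥0∞) ^ (p - 1) ≠ ⊤ :=
    natCast_rpow_ne_top (Finset.univ : Finset ι).card (by linarith)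
  have hK2 : ENNReal.ofReal (b ^ a) ^ p ≠ ⊤ :=
    ENNReal.rpow_ne_top_of_nonneg hp0 ENNReal.ofReal_ne_top
  calc ∫⁻ x in strip d 0 b ∩ {x | ‖x.1‖ ≤ R}, ‖wordDeriv w (layer k ψ (G 0)) x‖ₑ ^ p
      ≤ ∫⁻ x in strip d 0 b ∩ {x | ‖x.1‖ ≤ R}, ((Finset.univ : Finset ι).card : ℝ≥0∞) ^ (p - 1) *
          ∑ r, ENNReal.ofReal (b ^ a) ^ p * ‖avg (χ r) (G (γ r)) x‖ₑ ^ p := by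
        refine setLIntegral_mono' hms fun x hx => ?_
        have e := h3 G hG (strip_subset_upper hx.1)
        change wordDeriv w (layer k ψ (G 0)) x = _ at e
        rw [e]
        refine (enorm_sum_rpow_le _ _ hp.le).trans ?_
        gcongr with r
        rw [enorm_mul, ENNReal.mul_rpow_of_nonneg _ _ hp0]
        gcongr
        have hx0 : 0 < x.2 := hx.1.1
        rw [Real.enorm_of_nonneg (by positivity)]
        exact ENNReal.ofReal_le_ofReal (pow_le_pow_left₀ hx0.le hx.1.2.le a)
    _ = ((Finset.univ : Finset ι).card : ℝ≥0∞) ^ (p - 1) * ∑ r, ENNReal.ofReal (b ^ a) ^ p *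
          ∫⁻ x in strip d 0 b ∩ {x | ‖x.1‖ ≤ R}, ‖avg (χ r) (G (γ r)) x‖ₑ ^ p := by
        rw [lintegral_const_mul' _ _ hK1, lintegral_finsetSum']
        · simp_rw [lintegral_const_mul' _ _ hK2]
        · intro r _
          exact ((aemeasurable_avg (h1 r) hε.le (hloc r)).mono_measure
            (Measure.restrict_mono inter_subset_left le_rfl)).const_mul _
    _ < ⊤ := by
        refine ENNReal.mul_lt_top hK1.lt_top (ENNReal.sum_lt_top.2 fun r _ => ?_)
        exact ENNReal.mul_lt_top hK2.lt_top (lintegral_avg_lt_top (h1 r) hε hp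
          (hG.measurable _ (h2 r)) (hloc r) (hG.lintegral_lt_top _ (h2 r)) R b)

/-- The pointwise bound of a derivative of the extension by those of its layers. -/
theorem enorm_wordDeriv_halfExt_rpow_le (hε : 0 ≤ ε) (h : IsKernel ε ψ) (hp : 1 < p)
    (w : List (Fin (d + 1))) : ∃ A : Fin m → Fin m → ℝ≥0∞, (∀ k j, A k j ≠ ⊤) ∧
      ∀ f : Fin m → HorSpace d → ℝ, (∀ k, LocallyIntegrable (f k)) → ∀ x ∈ upper d,
        ‖wordDeriv w (halfExt ψ f) x‖ₑ ^ p ≤ ∑ k, ∑ j, A k j *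
          ‖wordDeriv w (layer k ψ (f k)) (vertAffine 0 (dilNode j) x)‖ₑ ^ p := by
  have hp0 : 0 ≤ p := by linarith
  refine ⟨fun k j => ((Finset.univ : Finset (Fin m)).card : ℝ≥0∞) ^ (p - 1) * (((Finset.univ : Finset (Fin m)).card : ℝ≥0∞) ^ (p - 1) *
    ‖dilCoef k j * ((k : ℕ).factorial : ℝ)⁻¹ * dilNode j ^ (w.count (Fin.last d))‖ₑ ^ p), ?_, ?_⟩
  · intro k j
    have := natCast_rpow_ne_top (Finset.univ : Finset (Fin m)).card (q := p - 1) (by linarith)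
    exact ENNReal.mul_ne_top this (ENNReal.mul_ne_top this
      (ENNReal.rpow_ne_top_of_nonneg hp0 enorm_ne_top))
  · intro f hf x hx
    rw [wordDeriv_halfExt hε h hf w hx]
    refine (enorm_sum_rpow_le _ _ hp.le).trans ?_
    rw [Finset.mul_sum]
    refine Finset.sum_le_sum fun k _ => ?_
    refine (mul_le_mul_right (enorm_sum_rpow_le _ _ hp.le) _).trans ?_
    rw [Finset.mul_sum, Finset.mul_sum]
    refine Finset.sum_le_sum fun j _ => le_of_eq ?_
    rw [← mul_assoc (dilCoef k j * _), enorm_mul, ENNReal.mul_rpow_of_nonneg _ _ hp0]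
    ring

/-- Undoing the dilation of ratio λ_j costs 1/λ_j and maps the set onto its part below height λ_j b.
The horizontal constraint P is unaffected, so one statement serves the global and the local
estimates. -/
theorem setLIntegral_wordDeriv_halfExt_le (hε : 0 ≤ ε) (h : IsKernel ε ψ) (hp : 1 < p)
    (w : List (Fin (d + 1))) : ∃ A : Fin m → ℝ≥0∞, (∀ k, A k ≠ ⊤) ∧
      ∀ f : Fin m → HorSpace d → ℝ, (∀ k, LocallyIntegrable (f k)) → ∀ b : ℝ, 0 < b →
      ∀ P : Set (HorSpace d), MeasurableSet P →
        ∫⁻ x in strip d 0 b ∩ {x | x.1 ∈ P}, ‖wordDeriv w (halfExt ψ f) x‖ₑ ^ p ≤ ∑ k, A k *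
          ∫⁻ x in strip d 0 b ∩ {x | x.1 ∈ P}, ‖wordDeriv w (layer k ψ (f k)) x‖ₑ ^ p := by
  obtain ⟨A, hA, hAb⟩ := enorm_wordDeriv_halfExt_rpow_le (m := m) hε h hp w
  refine ⟨fun k => ∑ j, A k j * ENNReal.ofReal |(dilNode j)⁻¹|, fun k =>
    ENNReal.sum_ne_top.2 fun j _ => ENNReal.mul_ne_top (hA k j) ENNReal.ofReal_ne_top, ?_⟩
  intro f hf b hb P hP
  set S := strip d 0 b ∩ {x | x.1 ∈ P} with hS
  have hms : MeasurableSet S := (measurableSet_strip 0 b).inter (measurable_fst hP)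
  have hSu : S ⊆ upper d := inter_subset_left.trans strip_subset_upper
  have hmeas : ∀ (k j : Fin m), AEMeasurable (fun x =>
      ‖wordDeriv w (layer k ψ (f k)) (vertAffine 0 (dilNode j) x)‖ₑ ^ p) (volume.restrict S) := by
    intro k j
    have hc : ContinuousOn (fun x => wordDeriv w (layer k ψ (f k)) (vertAffine 0 (dilNode j) x))
        S := ((wordDeriv_contDiffOn isOpen_upper (contDiffOn_layer hε h k (hf k)) w).continuousOn.comp
          (continuous_vertAffine _ _).continuousOn fun x hx => vertAffine_dil_mem j (hSu hx))
    exact (hc.aemeasurable hms).enorm.pow_const _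
  calc ∫⁻ x in S, ‖wordDeriv w (halfExt ψ f) x‖ₑ ^ p
      ≤ ∫⁻ x in S, ∑ k, ∑ j, A k j *
          ‖wordDeriv w (layer k ψ (f k)) (vertAffine 0 (dilNode j) x)‖ₑ ^ p :=
        setLIntegral_mono' hms fun x hx => hAb f hf x (hSu hx)
    _ = ∑ k, ∑ j, A k j * ∫⁻ x in S,
          ‖wordDeriv w (layer k ψ (f k)) (vertAffine 0 (dilNode j) x)‖ₑ ^ p := by
        rw [lintegral_finsetSum' _ fun k _ =>
          Finset.aemeasurable_fun_sum _ fun j _ => (hmeas k j).const_mul _]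
        refine Finset.sum_congr rfl fun k _ => ?_
        rw [lintegral_finsetSum' _ fun j _ => (hmeas k j).const_mul _]
        exact Finset.sum_congr rfl fun j _ => lintegral_const_mul' _ _ (hA k j)
    _ ≤ _ := by
        refine Finset.sum_le_sum fun k _ => ?_
        rw [Finset.sum_mul]
        refine Finset.sum_le_sum fun j _ => ?_
        rw [mul_assoc]
        gcongr
        have hl := dilNode_pos j
        have hpre : S = vertAffine 0 (dilNode j) ⁻¹'
            (strip d 0 (dilNode j * b) ∩ {x | x.1 ∈ P}) := by
          ext x
          simp [hS, strip, vertAffine, hl]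
        conv_lhs => rw [hpre]
        rw [setLIntegral_comp_vertAffine 0 hl.ne' _
          (fun x => ‖wordDeriv w (layer k ψ (f k)) x‖ₑ ^ p)]
        gcongr 1
        refine lintegral_mono_set (inter_subset_inter_left _ ?_)
        intro x hx
        exact ⟨hx.1, hx.2.trans_le (mul_le_of_le_one_left hb.le (dilNode_le_one j))⟩

theorem lintegral_wordDeriv_halfExt_le (hε : 0 < ε) (h : IsKernel ε ψ) (hp : 1 < p)
    (w : List (Fin (d + 1))) (hw : w.length = m) : ∃ C : ℝ≥0∞, C ≠ ⊤ ∧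
      ∀ G : Fin m → (Fin d → ℕ) → HorSpace d → ℝ, (∀ k : Fin m, IsJet p (m - 1 - k) (G k)) →
      ∀ b : ℝ, 0 < b → ∫⁻ x in strip d 0 b, ‖wordDeriv w (halfExt ψ fun k => G k 0) x‖ₑ ^ p ≤
        C * ∑ k : Fin m, ∑ γ ∈ multiIdx d (m - 1 - k), diffEnergy p (ε * b) (G k γ) := by
  obtain ⟨A, hA, hAb⟩ := setLIntegral_wordDeriv_halfExt_le (m := m) hε.le h hp w
  choose C hC hCb using fun k : Fin m =>
    lintegral_wordDeriv_layer_le (p := p) hε h hp k (m - 1 - k) w (by have := k.isLt; omega)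
  refine ⟨∑ k, A k * C k, ENNReal.sum_ne_top.2 fun k _ => ENNReal.mul_ne_top (hA k) (hC k), ?_⟩
  intro G hG b hb
  have h1 := hAb (fun k => G k 0) (fun k => (hG k).locallyIntegrable 0 (by simp)) b hb univ
    MeasurableSet.univ
  simp only [mem_univ, ofPred_true, inter_univ] at h1
  refine h1.trans ?_
  rw [Finset.sum_mul]
  refine Finset.sum_le_sum fun k _ => ?_
  rw [mul_assoc]
  gcongr
  refine (hCb k (G k) (hG k) b hb).trans ?_
  gcongr
  exact Finset.single_le_sum (f := fun k : Fin m =>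
    ∑ γ ∈ multiIdx d (m - 1 - k), diffEnergy p (ε * b) (G k γ)) (fun _ _ => zero_le)
    (Finset.mem_univ k)

theorem lintegral_wordDeriv_halfExt_lt_top (hε : 0 < ε) (h : IsKernel ε ψ) (hp : 1 < p)
    (w : List (Fin (d + 1))) (hw : w.length < m) {G : Fin m → (Fin d → ℕ) → HorSpace d → ℝ}
    (hG : ∀ k : Fin m, IsJet p (m - 1 - k) (G k)) (R : ℝ) {b : ℝ} (hb : 0 < b) :
    ∫⁻ x in strip d 0 b ∩ {x | ‖x.1‖ ≤ R}, ‖wordDeriv w (halfExt ψ fun k => G k 0) x‖ₑ ^ p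
      < ⊤ := by
  obtain ⟨A, hA, hAb⟩ := setLIntegral_wordDeriv_halfExt_le (m := m) hε.le h hp w
  refine (hAb (fun k => G k 0) (fun k => (hG k).locallyIntegrable 0 (by simp)) b hb
    {y | ‖y‖ ≤ R} (measurableSet_le (by fun_prop) (by fun_prop))).trans_lt ?_
  refine ENNReal.sum_lt_top.2 fun k _ => ENNReal.mul_lt_top (hA k).lt_top ?_
  exact lintegral_wordDeriv_layer_lt_top hε h hp k (m - 1 - k) w (by have := k.isLt; omega)
    (hG k) R b

/-- The traces of the derivatives of the extension. -/
theorem ae_tendsto_wordDeriv_halfExt (hε : 0 < ε) (h : IsKernel ε ψ) (hψ : ∫ y, ψ y = 1)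
    (τ : List (Fin d)) (n : ℕ) (hn : τ.length + n < m)
    {G : Fin m → (Fin d → ℕ) → HorSpace d → ℝ} (hG : ∀ k : Fin m, IsJet p (m - 1 - k) (G k)) :
    ∀ᵐ x' : HorSpace d, Filter.Tendsto (fun t : ℝ =>
      wordDeriv (τ.map Fin.castSucc ++ List.replicate n (Fin.last d))
        (halfExt ψ fun k => G k 0) (x', t)) (nhdsWithin 0 (Ioi 0))
        (nhds (G ⟨n, by omega⟩ (fun i => τ.count i) x')) := by
  set w := τ.map Fin.castSucc ++ List.replicate n (Fin.last d) with hw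
  have hwl : w.length < m := by simpa [hw] using hn
  have hcount : w.count (Fin.last d) = n := by
    rw [hw, List.count_append, List.count_replicate_self, List.count_eq_zero_of_not_mem]
    · simp
    · simp [(Fin.castSucc_lt_last _).ne]
  have hdiag := wordDeriv_layer_diag hε h n (m - 1 - n) τ (by omega) (hG ⟨n, by omega⟩)
  choose Λ hΛ using fun k : Fin m => wordDeriv_layer_tendsto (p := p) hε h k (m - 1 - k) w
    (by have := k.isLt; omega) (hG k)
  filter_upwards [hdiag, ae_all_iff.2 hΛ] with x' hd hL
  have hdil : ∀ j : Fin m, Filter.Tendsto (fun t : ℝ => dilNode j * t) (nhdsWithin 0 (Ioi 0))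
      (nhdsWithin 0 (Ioi 0)) := by
    intro j
    refine tendsto_nhdsWithin_iff.2 ⟨?_, ?_⟩
    · have : Filter.Tendsto (fun t : ℝ => dilNode j * t) (nhds 0) (nhds (dilNode j * 0)) :=
        (continuous_const_mul _).tendsto 0
      rw [mul_zero] at this
      exact this.mono_left nhdsWithin_le_nhds
    · filter_upwards [self_mem_nhdsWithin] with t ht
      exact mul_pos (dilNode_pos j) ht
  -- Only the limit of the n-th layer has to be identified, by uniqueness of limits.
  have hΛn : Λ ⟨n, by omega⟩ x' = n.factorial * G ⟨n, by omega⟩ (fun i => τ.count i) x' := by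
    rw [hψ, mul_one] at hd
    exact tendsto_nhds_unique (hL ⟨n, by omega⟩) hd
  have hlim := tendsto_finsetSum Finset.univ fun (k : Fin m) _ =>
    tendsto_finsetSum Finset.univ fun (j : Fin m) _ =>
      (((hL k).comp (hdil j)).const_mul (dilNode j ^ (w.count (Fin.last d)))).const_mul
        (dilCoef k j * ((k : ℕ).factorial : ℝ)⁻¹)
  have hval : ∑ k : Fin m, ∑ j : Fin m, dilCoef k j * ((k : ℕ).factorial : ℝ)⁻¹ *
      (dilNode j ^ (w.count (Fin.last d)) * Λ k x') =
        G ⟨n, by omega⟩ (fun i => τ.count i) x' := by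
    rw [hcount]
    have e : ∀ k : Fin m, ∑ j : Fin m, dilCoef k j * ((k : ℕ).factorial : ℝ)⁻¹ *
        (dilNode j ^ n * Λ k x') = (if k = ⟨n, by omega⟩ then 1 else 0) *
          (((k : ℕ).factorial : ℝ)⁻¹ * Λ k x') := by
      intro k
      rw [← sum_dilCoef_mul_pow k ⟨n, by omega⟩, Finset.sum_mul]
      exact Finset.sum_congr rfl fun j _ => by ring
    rw [Finset.sum_congr rfl fun k _ => e k, Finset.sum_eq_single ⟨n, by omega⟩]
    · rw [if_pos rfl, hΛn]
      have : ((n.factorial : ℕ) : ℝ) ≠ 0 := by exact_mod_cast n.factorial_ne_zero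
      simp only
      field_simp
    · intro k _ hk
      simp [hk]
    · simp
  rw [hval] at hlim
  refine hlim.congr' ?_
  filter_upwards [self_mem_nhdsWithin] with t ht
  rw [wordDeriv_halfExt hε.le h (fun k => (hG k).locallyIntegrable 0 (by simp)) w
    (show ((x', t) : FullSpace d) ∈ upper d from ht)]
  simp only [vertAffine, zero_add, Function.comp]
  rfl

end HalfSpace

/-! ### Taylor expansion from the boundary -/

section Taylor

/-- Here G k is the k-th derivative of G 0 and F k its one-sided limit at 0. For q = 0 this is the
fundamental theorem of calculus. In general the remainder has as derivative the remainder of lower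
order for the shifted sequences, bounded by induction; the mean value inequality between s and t,
with s → 0, gives one more factor b. -/
theorem norm_sub_taylor_le {b B : ℝ} (hB : 0 ≤ B) (q : ℕ) (G : ℕ → ℝ → ℝ) (F : ℕ → ℝ)
    (hder : ∀ k ≤ q, ∀ t ∈ Ioo 0 b, HasDerivAt (G k) (G (k + 1) t) t)
    (hlim : ∀ k ≤ q, Filter.Tendsto (G k) (nhdsWithin 0 (Ioi 0)) (nhds (F k)))
    (hint : IntegrableOn (G (q + 1)) (Ioo 0 b)) (hle : ∫ t in Ioo 0 b, ‖G (q + 1) t‖ ≤ B)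
    {t : ℝ} (ht : t ∈ Ioo 0 b) :
    ‖G 0 t - ∑ k ∈ Finset.range (q + 1), F k * t ^ k / k.factorial‖ ≤ b ^ q * B := by
  induction q generalizing G F t with
  | zero =>
    have hsub : Ioc 0 t ⊆ Ioo 0 b := fun s hs => ⟨hs.1, hs.2.trans_lt ht.2⟩
    have h1 := intervalIntegral.integral_eq_sub_of_hasDerivAt_of_tendsto (f := G 0) (f' := G 1)
      ht.1 (fun s hs => hder 0 le_rfl s ⟨hs.1, hs.2.trans ht.2⟩)
      ((intervalIntegrable_iff_integrableOn_Ioc_of_le ht.1.le).2 (hint.mono_set hsub))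
      (hlim 0 le_rfl)
      ((hder 0 le_rfl t ht).continuousAt.tendsto.mono_left nhdsWithin_le_nhds)
    simp only [zero_add, Finset.range_one, Finset.sum_singleton, pow_zero, mul_one,
      Nat.factorial_zero, Nat.cast_one, div_one, one_mul]
    rw [← h1, intervalIntegral.integral_of_le ht.1.le]
    refine (norm_integral_le_integral_norm _).trans (le_trans ?_ hle)
    exact setIntegral_mono_set hint.norm (Filter.Eventually.of_forall fun _ => norm_nonneg _)
      hsub.eventuallyLE
  | succ q ih =>
    have hb : 0 < b := ht.1.trans ht.2
    set R : ℝ → ℝ := fun s => G 0 s - ∑ k ∈ Finset.range (q + 2), F k * s ^ k / k.factorial with hR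
    have hRd : ∀ s ∈ Ioo 0 b, HasDerivAt R
        (G 1 s - ∑ k ∈ Finset.range (q + 1), F (k + 1) * s ^ k / k.factorial) s := by
      intro s hs
      have hp : HasDerivAt (fun s : ℝ => ∑ k ∈ Finset.range (q + 2), F k * s ^ k / k.factorial)
          (∑ k ∈ Finset.range (q + 1), F (k + 1) * s ^ k / k.factorial) s := by
        have : HasDerivAt (fun s : ℝ => ∑ k ∈ Finset.range (q + 2), F k * s ^ k / k.factorial)
            (∑ k ∈ Finset.range (q + 2), F k * (k * s ^ (k - 1)) / k.factorial) s :=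
          HasDerivAt.fun_sum fun k _ => ((hasDerivAt_pow k s).const_mul (F k)).div_const _
        rw [Finset.sum_range_succ'] at this
        convert this using 1
        simp only [Nat.cast_zero, zero_mul, mul_zero, zero_div, add_zero]
        refine Finset.sum_congr rfl fun k _ => ?_
        rw [Nat.factorial_succ, Nat.add_sub_cancel]
        push_cast
        field_simp
      exact (hder 0 (Nat.zero_le _) s hs).sub hp
    have hRb : ∀ s ∈ Ioo 0 b,
        ‖G 1 s - ∑ k ∈ Finset.range (q + 1), F (k + 1) * s ^ k / k.factorial‖ ≤ b ^ q * B :=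
      fun s hs => ih (fun k => G (k + 1)) (fun k => F (k + 1))
        (fun k hk => hder (k + 1) (by omega)) (fun k hk => hlim (k + 1) (by omega)) hint hle hs
    have hmv : ∀ s ∈ Ioo 0 b, ‖R t - R s‖ ≤ b ^ q * B * b := by
      intro s hs
      have := (convex_Ioo 0 b).norm_image_sub_le_of_norm_hasDerivWithin_le
        (fun s hs => (hRd s hs).hasDerivWithinAt) hRb hs ht
      refine this.trans ?_
      gcongr
      rw [Real.norm_eq_abs, abs_le]
      constructor <;> linarith [hs.1, hs.2, ht.1, ht.2]
    have hR0 : Filter.Tendsto R (nhdsWithin 0 (Ioi 0)) (nhds 0) := by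
      have hp : Filter.Tendsto (fun s : ℝ => ∑ k ∈ Finset.range (q + 2), F k * s ^ k / k.factorial)
          (nhdsWithin 0 (Ioi 0)) (nhds (F 0)) := by
        have hc : Continuous (fun s : ℝ => ∑ k ∈ Finset.range (q + 2),
          F k * s ^ k / k.factorial) := by fun_prop
        have := hc.tendsto 0
        rw [Finset.sum_range_succ'] at this
        simp only [ne_eq, Nat.add_eq_zero_iff, one_ne_zero, and_false, not_false_eq_true, zero_pow,
          mul_zero, zero_div, Finset.sum_const_zero, pow_zero, mul_one, Nat.factorial_zero,
          Nat.cast_one, div_one, zero_add] at this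
        exact this.mono_left nhdsWithin_le_nhds
      have := (hlim 0 (Nat.zero_le _)).sub hp
      rwa [sub_self] at this
    have hfin : Filter.Tendsto (fun s => ‖R t - R s‖) (nhdsWithin 0 (Ioi 0)) (nhds ‖R t - 0‖) :=
      (hR0.const_sub (R t)).norm
    have := le_of_tendsto hfin (by
      filter_upwards [Ioo_mem_nhdsGT hb] with s hs using hmv s hs)
    rw [sub_zero] at this
    refine this.trans (le_of_eq ?_)
    ring

/-- No integrability of the top derivative is required: if its integral diverges, the right side is
infinite because b > 0. -/
theorem enorm_sub_taylor_le {b : ℝ} (q : ℕ) (G : ℕ → ℝ → ℝ) (F : ℕ → ℝ)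
    (hder : ∀ k ≤ q, ∀ t ∈ Ioo 0 b, HasDerivAt (G k) (G (k + 1) t) t)
    (hcont : ContinuousOn (G (q + 1)) (Ioo 0 b))
    (hlim : ∀ k ≤ q, Filter.Tendsto (G k) (nhdsWithin 0 (Ioi 0)) (nhds (F k)))
    {t : ℝ} (ht : t ∈ Ioo 0 b) :
    ‖G 0 t - ∑ k ∈ Finset.range (q + 1), F k * t ^ k / k.factorial‖ₑ ≤
      ENNReal.ofReal (b ^ q) * ∫⁻ s in Ioo 0 b, ‖G (q + 1) s‖ₑ := by
  have hb : 0 < b := ht.1.trans ht.2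
  by_cases htop : ∫⁻ s in Ioo 0 b, ‖G (q + 1) s‖ₑ = ⊤
  · rw [htop, ENNReal.mul_top (by simp; positivity)]
    exact le_top
  · have hint : IntegrableOn (G (q + 1)) (Ioo 0 b) :=
      ⟨hcont.aestronglyMeasurable measurableSet_Ioo, lt_top_iff_ne_top.2 htop⟩
    have hnn : 0 ≤ ∫ s in Ioo 0 b, ‖G (q + 1) s‖ := integral_nonneg fun _ => norm_nonneg _
    have := norm_sub_taylor_le hnn q G F hder hlim hint le_rfl ht
    rw [← ofReal_integral_norm_eq_lintegral_enorm hint, ← ENNReal.ofReal_mul (by positivity),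
      ← ofReal_norm]
    exact ENNReal.ofReal_le_ofReal this

variable {d m : ℕ} {ε p : ℝ} {ψ : HorSpace d → ℝ}

theorem hasDerivAt_wordDeriv_vertical {U : Set (FullSpace d)} (hU : IsOpen U)
    {f : FullSpace d → ℝ} (hf : ContDiffOn ℝ ∞ f U) (w : List (Fin (d + 1))) {x' : HorSpace d}
    {t : ℝ} (hx : ((x', t) : FullSpace d) ∈ U) :
    HasDerivAt (fun s => wordDeriv w f (x', s)) (wordDeriv (Fin.last d :: w) f (x', t)) t := by
  have h1 := ((wordDeriv_contDiffOn hU hf w).differentiableAt_of_isOpen hU hx).hasFDerivAt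
  have h2 : HasDerivAt (fun s : ℝ => ((x', s) : FullSpace d)) ((0 : HorSpace d), (1 : ℝ)) t :=
    (hasDerivAt_const t x').prodMk (hasDerivAt_id t)
  have h3 := h1.comp_hasDerivAt t h2
  rw [wordDeriv_cons, fBasis_last]
  exact h3

/-- The `β`-th derivative of the datum number `j`; zero if there is no such datum. -/
def dataAt (G : Fin m → (Fin d → ℕ) → HorSpace d → ℝ) (j : ℕ) (β : Fin d → ℕ)
    (x : HorSpace d) : ℝ := if h : j < m then G ⟨j, h⟩ β x else 0

/-- The derivatives of the extension are close to the Taylor polynomials of the data. -/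
theorem ae_enorm_wordDeriv_halfExt_sub_taylor_le (hε : 0 < ε) (h : IsKernel ε ψ)
    (hψ : ∫ y, ψ y = 1) (τ : List (Fin d)) (n : ℕ) (hn : τ.length + n < m)
    {G : Fin m → (Fin d → ℕ) → HorSpace d → ℝ} (hG : ∀ k : Fin m, IsJet p (m - 1 - k) (G k)) :
    ∀ᵐ x' : HorSpace d, ∀ b : ℝ, ∀ t ∈ Ioo 0 b,
      ‖wordDeriv (τ.map Fin.castSucc ++ List.replicate n (Fin.last d))
        (halfExt ψ fun k => G k 0) (x', t) - ∑ k ∈ Finset.range (m - τ.length - n),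
          dataAt G (k + n) (fun i => τ.count i) x' * t ^ k / k.factorial‖ₑ ≤
      ENNReal.ofReal (b ^ (m - 1 - τ.length - n)) * ∫⁻ s in Ioo 0 b,
        ‖wordDeriv (List.replicate (m - τ.length - n) (Fin.last d) ++
          (τ.map Fin.castSucc ++ List.replicate n (Fin.last d)))
          (halfExt ψ fun k => G k 0) (x', s)‖ₑ := by
  set u := halfExt ψ fun k => G k 0 with hu
  have husm : ContDiffOn ℝ ∞ u (upper d) :=
    contDiffOn_halfExt hε.le h fun k => (hG k).locallyIntegrable 0 (by simp)
  set w := τ.map Fin.castSucc ++ List.replicate n (Fin.last d) with hw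
  have hlim := ae_all_iff.2 fun k : Fin (m - τ.length - n) =>
    ae_tendsto_wordDeriv_halfExt hε h hψ τ (k + n) (by have := k.isLt; omega) hG
  filter_upwards [hlim] with x' hx' b t ht
  obtain ⟨q, hq⟩ : ∃ q, m - τ.length - n = q + 1 := ⟨m - τ.length - n - 1, by omega⟩
  have hq' : m - 1 - τ.length - n = q := by omega
  set F : ℕ → ℝ := fun k => dataAt G (k + n) (fun i => τ.count i) x' with hF
  have key := enorm_sub_taylor_le (b := b) q
    (fun k s => wordDeriv (List.replicate k (Fin.last d) ++ w) u (x', s)) F ?_ ?_ ?_ ht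
  · rw [← hq] at key
    rw [hq']
    refine le_trans (le_of_eq ?_) key
    rfl
  · intro k hk s hs
    exact hasDerivAt_wordDeriv_vertical isOpen_upper husm (List.replicate k (Fin.last d) ++ w) hs.1
  · have := (wordDeriv_contDiffOn isOpen_upper husm
      (List.replicate (q + 1) (Fin.last d) ++ w)).continuousOn
    exact this.comp (by fun_prop) fun s hs => hs.1
  · intro k hk
    have hk' : k + n < m := by omega
    have := hx' ⟨k, by omega⟩
    simp only [hF, dataAt, hk', dif_pos]
    refine this.congr' ?_
    filter_upwards [self_mem_nhdsWithin] with s hs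
    -- The limits are known for words whose vertical letters all stand at the end; the k letters of
    -- the Taylor expansion stand in front and are permuted.
    refine wordDeriv_perm isOpen_upper husm ?_ (show ((x', s) : FullSpace d) ∈ upper d from hs)
    rw [hw, List.replicate_add]
    have e1 : (τ.map Fin.castSucc ++ (List.replicate k (Fin.last d) ++
        List.replicate n (Fin.last d))).Perm ((List.replicate k (Fin.last d) ++
          List.replicate n (Fin.last d)) ++ τ.map Fin.castSucc) := List.perm_append_comm
    refine e1.trans ?_
    rw [List.append_assoc]
    exact List.Perm.append_left _ List.perm_append_comm

end Taylor

end

noncomputable section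

set_option linter.unusedSectionVars false

/-! ### Transfer to either face of the strip -/

section Side

variable {d m : ℕ} {ε p : ℝ} {ψ : HorSpace d → ℝ}

theorem exists_isKernel_integral_eq_one (d : ℕ) {ε : ℝ} (hε : 0 < ε) :
    ∃ ψ : HorSpace d → ℝ, IsKernel ε ψ ∧ ∫ y, ψ y = 1 := by
  let B : ContDiffBump (0 : HorSpace d) := ⟨ε / 2, ε, by positivity, by linarith⟩
  refine ⟨B.normed volume, isKernel_of_tsupport B.contDiff_normed ?_, B.integral_normed⟩
  rw [B.tsupport_normed_eq]

theorem IsWeakDir.const_mul {v : HorSpace d} {g g' : HorSpace d → ℝ} (h : IsWeakDir v g g')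
    (c : ℝ) : IsWeakDir v (fun x => c * g x) (fun x => c * g' x) := by
  intro φ hφ hc
  simp only [mul_assoc]
  rw [integral_const_mul, integral_const_mul, h φ hφ hc, mul_neg]

theorem IsJet.const_mul {s : ℕ} {G : (Fin d → ℕ) → HorSpace d → ℝ} (h : IsJet p s G)
    (hp : 0 ≤ p) (c : ℝ) : IsJet p s (fun γ x => c * G γ x) where
  measurable γ hγ := (h.measurable γ hγ).const_mul c
  locallyIntegrable γ hγ := (h.locallyIntegrable γ hγ).smul c
  lintegral_lt_top γ hγ R := by
    simp only [enorm_mul, ENNReal.mul_rpow_of_nonneg _ _ hp]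
    have : ‖c‖ₑ ^ p ≠ ⊤ := ENNReal.rpow_ne_top_of_nonneg hp enorm_ne_top
    rw [lintegral_const_mul' _ _ this]
    exact ENNReal.mul_lt_top this.lt_top (h.lintegral_lt_top γ hγ R)
  isWeakDir γ hγ r := (h.isWeakDir γ hγ r).const_mul c

/-- The reflection or translation `s ↦ σ (s - c)` maps the interval `(b⁻, b⁺)` onto
`(0, b⁺ - b⁻)`. -/
structure SideGeom (σ c bm bp : ℝ) : Prop where
  sign : σ = 1 ∨ σ = -1
  mem_iff : ∀ s, -(σ * c) + σ * s ∈ Ioo 0 (bp - bm) ↔ s ∈ Ioo bm bp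

theorem sideGeom_lower (bm bp : ℝ) : SideGeom 1 bm bm bp :=
  ⟨Or.inl rfl, fun s => by constructor <;> rintro ⟨h1, h2⟩ <;> constructor <;> linarith⟩

theorem sideGeom_upper (bm bp : ℝ) : SideGeom (-1) bp bm bp :=
  ⟨Or.inr rfl, fun s => by constructor <;> rintro ⟨h1, h2⟩ <;> constructor <;> linarith⟩

theorem SideGeom.ne_zero {σ c bm bp : ℝ} (h : SideGeom σ c bm bp) : σ ≠ 0 := by
  rcases h.sign with h | h <;> rw [h] <;> norm_num

theorem SideGeom.mul_self {σ c bm bp : ℝ} (h : SideGeom σ c bm bp) : σ * σ = 1 := by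
  rcases h.sign with h | h <;> rw [h] <;> norm_num

theorem SideGeom.pow_mul_self {σ c bm bp : ℝ} (h : SideGeom σ c bm bp) (n : ℕ) :
    σ ^ n * σ ^ n = 1 := by
  rw [← mul_pow, h.mul_self, one_pow]

theorem SideGeom.enorm_pow {σ c bm bp : ℝ} (h : SideGeom σ c bm bp) (n : ℕ) :
    ‖σ ^ n‖ₑ = 1 := by
  have : ‖σ‖ₑ = 1 := by rcases h.sign with h | h <;> rw [h] <;> simp
  rw [_root_.enorm_pow, this, one_pow]

theorem SideGeom.preimage_strip {σ c bm bp : ℝ} (h : SideGeom σ c bm bp) :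
    vertAffine (-(σ * c)) σ ⁻¹' strip d 0 (bp - bm) = strip d bm bp := by
  ext x
  exact h.mem_iff x.2

/-- The extension of the Cauchy data `f` on the hyperplane `x_N = c`, to the side given by `σ`. -/
def sideExt (σ c : ℝ) (ψ : HorSpace d → ℝ) (f : Fin m → HorSpace d → ℝ) (x : FullSpace d) : ℝ :=
  halfExt ψ (fun k y => σ ^ (k : ℕ) * f k y) (vertAffine (-(σ * c)) σ x)

theorem isOpen_preimage_upper (σ c : ℝ) :
    IsOpen (vertAffine (d := d) (-(σ * c)) σ ⁻¹' upper d) :=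
  isOpen_upper.preimage (continuous_vertAffine _ _)

theorem SideGeom.strip_subset {σ c bm bp : ℝ} (h : SideGeom σ c bm bp) :
    strip d bm bp ⊆ vertAffine (-(σ * c)) σ ⁻¹' upper d := by
  rw [← h.preimage_strip]
  exact preimage_mono strip_subset_upper

theorem contDiffOn_sideExt (hε : 0 ≤ ε) (h : IsKernel ε ψ) {f : Fin m → HorSpace d → ℝ}
    (hf : ∀ k, LocallyIntegrable (f k)) (σ c : ℝ) :
    ContDiffOn ℝ ∞ (sideExt σ c ψ f) (vertAffine (-(σ * c)) σ ⁻¹' upper d) :=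
  (contDiffOn_halfExt hε h fun k => (hf k).smul (σ ^ (k : ℕ))).comp
    (contDiff_vertAffine _ _).contDiffOn fun _ hx => hx

theorem wordDeriv_sideExt (hε : 0 ≤ ε) (h : IsKernel ε ψ) {f : Fin m → HorSpace d → ℝ}
    (hf : ∀ k, LocallyIntegrable (f k)) (σ c : ℝ) (w : List (Fin (d + 1))) :
    EqOn (wordDeriv w (sideExt σ c ψ f)) (fun x => σ ^ (w.count (Fin.last d)) *
      wordDeriv w (halfExt ψ fun k y => σ ^ (k : ℕ) * f k y) (vertAffine (-(σ * c)) σ x))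
      (vertAffine (-(σ * c)) σ ⁻¹' upper d) :=
  wordDeriv_comp_vertAffine isOpen_upper (isOpen_preimage_upper σ c)
    (contDiffOn_halfExt hε h fun k => (hf k).smul (σ ^ (k : ℕ))) _ _ (fun _ hx => hx) w

theorem sideExt_add (h : IsKernel ε ψ) {f g : Fin m → HorSpace d → ℝ}
    (hf : ∀ k, LocallyIntegrable (f k)) (hg : ∀ k, LocallyIntegrable (g k)) {σ c : ℝ}
    {x : FullSpace d} (hx : vertAffine (-(σ * c)) σ x ∈ upper d) :
    sideExt σ c ψ (fun k y => f k y + g k y) x = sideExt σ c ψ f x + sideExt σ c ψ g x := by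
  unfold sideExt
  rw [← halfExt_add (f := fun k y => σ ^ (k : ℕ) * f k y) (g := fun k y => σ ^ (k : ℕ) * g k y) h
    (fun k => (hf k).smul (σ ^ (k : ℕ))) (fun k => (hg k).smul (σ ^ (k : ℕ))) hx]
  congr 1
  funext k y
  ring

theorem sideExt_const_mul (a : ℝ) (f : Fin m → HorSpace d → ℝ) (σ c : ℝ) (x : FullSpace d) :
    sideExt σ c ψ (fun k y => a * f k y) x = a * sideExt σ c ψ f x := by
  unfold sideExt
  rw [← halfExt_const_mul]
  congr 1
  funext k y
  ring

theorem sideExt_congr_ae {f g : Fin m → HorSpace d → ℝ} (h : ∀ k, f k =ᵐ[volume] g k)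
    (σ c : ℝ) : sideExt σ c ψ f = sideExt σ c ψ g := by
  funext x
  unfold sideExt
  rw [halfExt_congr_ae (g := fun k y => σ ^ (k : ℕ) * g k y)]
  intro k
  filter_upwards [h k] with y hy
  rw [hy]

theorem diffEnergy_const_mul_pow {σ c bm bp : ℝ} (h : SideGeom σ c bm bp) (n : ℕ) (p r : ℝ)
    (g : HorSpace d → ℝ) : diffEnergy p r (fun x => σ ^ n * g x) = diffEnergy p r g := by
  unfold diffEnergy
  simp only [← mul_sub, enorm_mul, h.enorm_pow, one_mul]

theorem enorm_wordDeriv_sideExt (hε : 0 ≤ ε) (h : IsKernel ε ψ) {f : Fin m → HorSpace d → ℝ}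
    (hf : ∀ k, LocallyIntegrable (f k)) {σ c bm bp : ℝ} (hg : SideGeom σ c bm bp)
    (w : List (Fin (d + 1))) {x : FullSpace d} (hx : vertAffine (-(σ * c)) σ x ∈ upper d) :
    ‖wordDeriv w (sideExt σ c ψ f) x‖ₑ =
      ‖wordDeriv w (halfExt ψ fun k y => σ ^ (k : ℕ) * f k y) (vertAffine (-(σ * c)) σ x)‖ₑ := by
  rw [wordDeriv_sideExt hε h hf σ c w hx, enorm_mul, hg.enorm_pow, one_mul]

theorem lintegral_wordDeriv_sideExt_eq (hε : 0 ≤ ε) (h : IsKernel ε ψ)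
    {f : Fin m → HorSpace d → ℝ} (hf : ∀ k, LocallyIntegrable (f k)) {σ c bm bp : ℝ}
    (hg : SideGeom σ c bm bp) (w : List (Fin (d + 1))) (P : Set (HorSpace d))
    (hP : MeasurableSet P) :
    ∫⁻ x in strip d bm bp ∩ {x | x.1 ∈ P}, ‖wordDeriv w (sideExt σ c ψ f) x‖ₑ ^ p =
      ∫⁻ x in strip d 0 (bp - bm) ∩ {x | x.1 ∈ P},
        ‖wordDeriv w (halfExt ψ fun k y => σ ^ (k : ℕ) * f k y) x‖ₑ ^ p := by
  have h1 := setLIntegral_comp_vertAffine (-(σ * c)) hg.ne_zero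
    (strip d 0 (bp - bm) ∩ {x | x.1 ∈ P})
    (fun x => ‖wordDeriv w (halfExt ψ fun k y => σ ^ (k : ℕ) * f k y) x‖ₑ ^ p)
  have habs : |σ⁻¹| = 1 := by rcases hg.sign with h | h <;> rw [h] <;> simp
  rw [habs, ENNReal.ofReal_one, one_mul, preimage_inter, hg.preimage_strip] at h1
  rw [← h1]
  refine setLIntegral_congr_fun ((measurableSet_strip bm bp).inter (measurable_fst hP)) ?_
  intro x hx
  simp only
  rw [enorm_wordDeriv_sideExt hε h hf hg w (hg.strip_subset hx.1)]

theorem lintegral_wordDeriv_sideExt_le (hε : 0 < ε) (h : IsKernel ε ψ) (hp : 1 < p)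
    (w : List (Fin (d + 1))) (hw : w.length = m) : ∃ C : ℝ≥0∞, C ≠ ⊤ ∧
      ∀ G : Fin m → (Fin d → ℕ) → HorSpace d → ℝ, (∀ k : Fin m, IsJet p (m - 1 - k) (G k)) →
      ∀ σ c bm bp : ℝ, bm < bp → SideGeom σ c bm bp →
        ∫⁻ x in strip d bm bp, ‖wordDeriv w (sideExt σ c ψ fun k => G k 0) x‖ₑ ^ p ≤
        C * ∑ k : Fin m, ∑ γ ∈ multiIdx d (m - 1 - k), diffEnergy p (ε * (bp - bm)) (G k γ) := by
  obtain ⟨C, hC, hCb⟩ := lintegral_wordDeriv_halfExt_le (m := m) hε h hp w hw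
  refine ⟨C, hC, ?_⟩
  intro G hG σ c bm bp hb hg
  have h1 := lintegral_wordDeriv_sideExt_eq (p := p) hε.le h
    (fun k => (hG k).locallyIntegrable 0 (by simp)) hg w univ MeasurableSet.univ
  simp only [mem_univ, ofPred_true, inter_univ] at h1
  rw [h1]
  have h2 := hCb (fun k γ x => σ ^ (k : ℕ) * G k γ x)
    (fun k => (hG k).const_mul (by linarith) _) (bp - bm) (by linarith)
  simpa only [diffEnergy_const_mul_pow hg] using h2

theorem lintegral_wordDeriv_sideExt_lt_top (hε : 0 < ε) (h : IsKernel ε ψ) (hp : 1 < p)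
    (w : List (Fin (d + 1))) (hw : w.length < m) {G : Fin m → (Fin d → ℕ) → HorSpace d → ℝ}
    (hG : ∀ k : Fin m, IsJet p (m - 1 - k) (G k)) {σ c bm bp : ℝ} (hb : bm < bp)
    (hg : SideGeom σ c bm bp) (R : ℝ) :
    ∫⁻ x in strip d bm bp ∩ {x | ‖x.1‖ ≤ R},
      ‖wordDeriv w (sideExt σ c ψ fun k => G k 0) x‖ₑ ^ p < ⊤ := by
  have h1 := lintegral_wordDeriv_sideExt_eq (p := p) hε.le h
    (fun k => (hG k).locallyIntegrable 0 (by simp)) hg w {y | ‖y‖ ≤ R}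
    (measurableSet_le (by fun_prop) (by fun_prop))
  simp only [mem_ofPred_eq] at h1
  rw [h1]
  exact lintegral_wordDeriv_halfExt_lt_top hε h hp w hw
    (G := fun k γ x => σ ^ (k : ℕ) * G k γ x) (fun k => (hG k).const_mul (by linarith) _) R
    (by linarith)

/-- A reflection changes the sign of odd normal derivatives. The factor σ^n of the chain rule
cancels the factor σ^n put on the n-th datum in `sideExt`. -/
theorem ae_tendsto_wordDeriv_sideExt (hε : 0 < ε) (h : IsKernel ε ψ) (hψ : ∫ y, ψ y = 1)
    (hp : 0 ≤ p) (n : ℕ) (hn : n < m)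
    {G : Fin m → (Fin d → ℕ) → HorSpace d → ℝ} (hG : ∀ k : Fin m, IsJet p (m - 1 - k) (G k))
    {σ c bm bp : ℝ} (hg : SideGeom σ c bm bp) {l : Filter ℝ}
    (hl : Filter.Tendsto (fun s => -(σ * c) + σ * s) l (nhdsWithin 0 (Ioi 0))) :
    ∀ᵐ x' : HorSpace d, Filter.Tendsto (fun s : ℝ => wordDeriv (List.replicate n (Fin.last d))
        (sideExt σ c ψ fun k => G k 0) (x', s)) l (nhds (G ⟨n, hn⟩ 0 x')) := by
  have h1 := ae_tendsto_wordDeriv_halfExt (p := p) (m := m) hε h hψ [] n (by simpa using hn)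
    (G := fun k γ x => σ ^ (k : ℕ) * G k γ x) (fun k => (hG k).const_mul hp _)
  filter_upwards [h1] with x' hx'
  have h2 := (hx'.comp hl).const_mul (σ ^ n)
  simp only [List.map_nil, List.nil_append, List.count_nil] at h2
  have e : σ ^ n * (σ ^ n * G ⟨n, hn⟩ (fun _ => 0) x') = G ⟨n, hn⟩ 0 x' := by
    rw [← mul_assoc, hg.pow_mul_self, one_mul]; rfl
  rw [e] at h2
  refine h2.congr' ?_
  filter_upwards [hl self_mem_nhdsWithin] with s hs
  rw [wordDeriv_sideExt hε.le h (fun k => (hG k).locallyIntegrable 0 (by simp)) σ c _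
    (show vertAffine (-(σ * c)) σ ((x', s) : FullSpace d) ∈ upper d from hs),
    List.count_replicate_self]
  rfl

theorem lintegral_Ioo_comp_sideGeom {σ c bm bp : ℝ} (hg : SideGeom σ c bm bp) (F : ℝ → ℝ≥0∞) :
    ∫⁻ s in Ioo bm bp, F (-(σ * c) + σ * s) = ∫⁻ t in Ioo 0 (bp - bm), F t := by
  have hpre : (fun s => -(σ * c) + σ * s) ⁻¹' Ioo 0 (bp - bm) = Ioo bm bp :=
    Set.ext hg.mem_iff
  have hemb : MeasurableEmbedding (fun s : ℝ => -(σ * c) + σ * s) := by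
    refine Continuous.measurableEmbedding (by fun_prop) ?_
    intro s t hst
    simpa [hg.ne_zero] using hst
  have hmap : Measure.map (fun s : ℝ => -(σ * c) + σ * s) volume = volume := by
    have h1 : (fun s : ℝ => -(σ * c) + σ * s) = (fun t => -(σ * c) + t) ∘ (fun s => σ * s) := rfl
    have habs : |σ⁻¹| = 1 := by rcases hg.sign with h | h <;> rw [h] <;> simp
    rw [h1, ← Measure.map_map (by fun_prop) (by fun_prop), Real.map_volume_mul_left hg.ne_zero,
      habs, ENNReal.ofReal_one, one_smul, map_add_left_eq_self]
  rw [← hpre, ← hemb.lintegral_map, ← hemb.restrict_map, hmap]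

/-- In the k-th Taylor term the signs σ^n from the derivative, σ^{k+n} from the datum and σ^k from
(σ(s-c))^k multiply to 1, so the polynomial is centred at the face with the original data as
coefficients. -/
theorem ae_enorm_wordDeriv_sideExt_sub_taylor_le (hε : 0 < ε) (h : IsKernel ε ψ)
    (hψ : ∫ y, ψ y = 1) (hp : 0 ≤ p) (τ : List (Fin d)) (n : ℕ) (hn : τ.length + n < m)
    {G : Fin m → (Fin d → ℕ) → HorSpace d → ℝ} (hG : ∀ k : Fin m, IsJet p (m - 1 - k) (G k))
    {σ c bm bp : ℝ} (hg : SideGeom σ c bm bp) :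
    ∀ᵐ x' : HorSpace d, ∀ s ∈ Ioo bm bp,
      ‖wordDeriv (τ.map Fin.castSucc ++ List.replicate n (Fin.last d))
        (sideExt σ c ψ fun k => G k 0) (x', s) - ∑ k ∈ Finset.range (m - τ.length - n),
          dataAt G (k + n) (fun i => τ.count i) x' * (s - c) ^ k / k.factorial‖ₑ ≤
      ENNReal.ofReal ((bp - bm) ^ (m - 1 - τ.length - n)) * ∫⁻ s in Ioo bm bp,
        ‖wordDeriv (List.replicate (m - τ.length - n) (Fin.last d) ++
          (τ.map Fin.castSucc ++ List.replicate n (Fin.last d)))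
          (sideExt σ c ψ fun k => G k 0) (x', s)‖ₑ := by
  have hloc : ∀ k, LocallyIntegrable (G k 0) := fun k => (hG k).locallyIntegrable 0 (by simp)
  have h1 := ae_enorm_wordDeriv_halfExt_sub_taylor_le (p := p) (m := m) hε h hψ τ n hn
    (G := fun k γ x => σ ^ (k : ℕ) * G k γ x) (fun k => (hG k).const_mul hp _)
  filter_upwards [h1] with x' hx' s hs
  have hs' := (hg.mem_iff s).2 hs
  have key := hx' (bp - bm) _ hs'
  rw [← lintegral_Ioo_comp_sideGeom hg] at key
  have e1 : ∀ s ∈ Ioo bm bp, vertAffine (-(σ * c)) σ ((x', s) : FullSpace d) ∈ upper d :=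
    fun s hs => ((hg.mem_iff s).2 hs).1
  have e2 : ∫⁻ s in Ioo bm bp, ‖wordDeriv (List.replicate (m - τ.length - n) (Fin.last d) ++
          (τ.map Fin.castSucc ++ List.replicate n (Fin.last d)))
          (sideExt σ c ψ fun k => G k 0) (x', s)‖ₑ =
      ∫⁻ s in Ioo bm bp, ‖wordDeriv (List.replicate (m - τ.length - n) (Fin.last d) ++
          (τ.map Fin.castSucc ++ List.replicate n (Fin.last d)))
          (halfExt ψ fun k y => σ ^ (k : ℕ) * G k 0 y) (x', -(σ * c) + σ * s)‖ₑ :=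
    setLIntegral_congr_fun measurableSet_Ioo fun s hs =>
      enorm_wordDeriv_sideExt hε.le h hloc hg _ (e1 s hs)
  rw [e2]
  refine le_trans (le_of_eq ?_) key
  have hcount : (τ.map Fin.castSucc ++ List.replicate n (Fin.last d)).count (Fin.last d) = n := by
    rw [List.count_append, List.count_replicate_self, List.count_eq_zero_of_not_mem]
    · simp
    · simp [(Fin.castSucc_lt_last _).ne]
  rw [wordDeriv_sideExt hε.le h hloc σ c _ (e1 s hs), hcount]
  have e3 : ∑ k ∈ Finset.range (m - τ.length - n),
      dataAt G (k + n) (fun i => τ.count i) x' * (s - c) ^ k / k.factorial =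
      σ ^ n * ∑ k ∈ Finset.range (m - τ.length - n), dataAt (fun (k : Fin m) γ x =>
        σ ^ (k : ℕ) * G k γ x) (k + n) (fun i => τ.count i) x' * (-(σ * c) + σ * s) ^ k /
          k.factorial := by
    rw [Finset.mul_sum]
    refine Finset.sum_congr rfl fun k hk => ?_
    have hk' : k + n < m := by have := Finset.mem_range.1 hk; omega
    simp only [dataAt, hk', dif_pos]
    have : -(σ * c) + σ * s = σ * (s - c) := by ring
    rw [this, mul_pow, pow_add]
    have h2 := hg.pow_mul_self n
    have h3 := hg.pow_mul_self k
    have : σ ^ n * (σ ^ k * σ ^ n * G ⟨k + n, hk'⟩ (fun i => τ.count i) x' *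
        (σ ^ k * (s - c) ^ k) / k.factorial) = (σ ^ n * σ ^ n) * (σ ^ k * σ ^ k) *
        (G ⟨k + n, hk'⟩ (fun i => τ.count i) x' * (s - c) ^ k / k.factorial) := by ring
    rw [this, h2, h3, one_mul, one_mul]
  rw [e3, ← mul_sub, enorm_mul, hg.enorm_pow, one_mul]
  rfl

end Side

end

noncomputable section

set_option linter.unusedSectionVars false

/-! ### Leibniz rule, normal form of words, shift of Taylor polynomials -/

section Leibniz

variable {d : ℕ}

theorem wordDeriv_sub {U : Set (FullSpace d)} (hU : IsOpen U) {f g : FullSpace d → ℝ}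
    (hf : ContDiffOn ℝ ∞ f U) (hg : ContDiffOn ℝ ∞ g U) (w : List (Fin (d + 1))) :
    EqOn (wordDeriv w (fun x => f x - g x)) (fun x => wordDeriv w f x - wordDeriv w g x) U := by
  intro x hx
  have h1 : (fun x => f x - g x) = fun x => f x + (-1) * g x := by funext x; ring
  rw [h1]
  unfold wordDeriv
  rw [iterDirDeriv_add hU hf (contDiffOn_const.mul hg) _ hx]
  simp only
  rw [iterDirDeriv_const_mul hU (-1) hg _ hx]
  ring

theorem wordDeriv_add {U : Set (FullSpace d)} (hU : IsOpen U) {f g : FullSpace d → ℝ}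
    (hf : ContDiffOn ℝ ∞ f U) (hg : ContDiffOn ℝ ∞ g U) (w : List (Fin (d + 1))) :
    EqOn (wordDeriv w (fun x => f x + g x)) (fun x => wordDeriv w f x + wordDeriv w g x) U :=
  iterDirDeriv_add hU hf hg _

/-- The Leibniz rule for a product with a function of the vertical variable. -/
theorem wordDeriv_vertical_mul (w : List (Fin (d + 1))) :
    ∃ (ι : Type) (_ : Fintype ι) (j : ι → ℕ) (v : ι → List (Fin (d + 1))),
      (∀ r, j r + (v r).length = w.length) ∧
      ∀ (U : Set (FullSpace d)), IsOpen U → ∀ D : FullSpace d → ℝ, ContDiffOn ℝ ∞ D U →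
      ∀ θ : ℕ → ℝ → ℝ, (∀ j s, HasDerivAt (θ j) (θ (j + 1) s) s) →
        EqOn (wordDeriv w (fun x => θ 0 x.2 * D x))
          (fun x => ∑ r, θ (j r) x.2 * wordDeriv (v r) D x) U := by
  induction w with
  | nil =>
    refine ⟨Unit, inferInstance, fun _ => 0, fun _ => [], by simp, ?_⟩
    intro U _ D _ θ _ x _
    simp [wordDeriv, iterDirDeriv]
  | cons i w ih =>
    obtain ⟨ι, hι, j, v, h1, h2⟩ := ih
    have hstep : ∀ (U : Set (FullSpace d)), IsOpen U → ∀ D : FullSpace d → ℝ,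
        ContDiffOn ℝ ∞ D U → ∀ θ : ℕ → ℝ → ℝ, (∀ j s, HasDerivAt (θ j) (θ (j + 1) s) s) →
        ∀ x ∈ U, wordDeriv (i :: w) (fun x => θ 0 x.2 * D x) x =
          ∑ r, (θ (j r) x.2 * wordDeriv (i :: v r) D x +
            (θ (j r + 1) x.2 * if i = Fin.last d then 1 else 0) * wordDeriv (v r) D x) := by
      intro U hU D hD θ hθ x hx
      have hfd : ∀ r, HasFDerivAt (fun x : FullSpace d => θ (j r) x.2 * wordDeriv (v r) D x)
          (θ (j r) x.2 • fderiv ℝ (wordDeriv (v r) D) x +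
            wordDeriv (v r) D x • (θ (j r + 1) x.2 • ContinuousLinearMap.snd ℝ (HorSpace d) ℝ))
          x := by
        intro r
        have e1 : HasFDerivAt (fun x : FullSpace d => θ (j r) x.2)
            (θ (j r + 1) x.2 • ContinuousLinearMap.snd ℝ (HorSpace d) ℝ) x :=
          (hθ (j r) x.2).comp_hasFDerivAt x hasFDerivAt_snd
        exact e1.mul ((wordDeriv_contDiffOn hU hD (v r)).differentiableAt_of_isOpen hU
          hx).hasFDerivAt
      rw [wordDeriv_cons, fderiv_eqOn_of_isOpen hU (h2 U hU D hD θ hθ) hx,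
        (HasFDerivAt.fun_sum fun r _ => hfd r).fderiv]
      simp only [sum_apply, add_apply, smul_apply, smul_eq_mul,
        ContinuousLinearMap.coe_snd', fBasis_snd, wordDeriv_cons]
      exact Finset.sum_congr rfl fun r _ => by ring
    by_cases hi : i = Fin.last d
    · refine ⟨ι ⊕ ι, inferInstance, Sum.elim j (fun r => j r + 1),
        Sum.elim (fun r => i :: v r) v, ?_, ?_⟩
      · rintro (r | r)
        · simp only [Sum.elim_inl, List.length_cons]; have := h1 r; omega
        · simp only [Sum.elim_inr, List.length_cons]; have := h1 r; omega
      · intro U hU D hD θ hθ x hx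
        rw [hstep U hU D hD θ hθ x hx]
        simp [hi, Finset.sum_add_distrib]
    · refine ⟨ι, inferInstance, j, fun r => i :: v r, ?_, ?_⟩
      · intro r
        simp only [List.length_cons]; have := h1 r; omega
      · intro U hU D hD θ hθ x hx
        rw [hstep U hU D hD θ hθ x hx]
        simp [hi]

/-- The Taylor estimates are stated for horizontal letters followed by vertical ones; on smooth
functions every word can be brought to that form. -/
theorem exists_perm_normal_form (w : List (Fin (d + 1))) : ∃ (τ : List (Fin d)) (n : ℕ),
    w.Perm (τ.map Fin.castSucc ++ List.replicate n (Fin.last d)) := by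
  induction w with
  | nil => exact ⟨[], 0, by simp⟩
  | cons i w ih =>
    obtain ⟨τ, n, h⟩ := ih
    refine Fin.lastCases (motive := fun i => ∃ (τ : List (Fin d)) (n : ℕ),
      (i :: w).Perm (τ.map Fin.castSucc ++ List.replicate n (Fin.last d))) ?_ (fun j => ?_) i
    · refine ⟨τ, n + 1, (h.cons _).trans ?_⟩
      rw [List.replicate_succ]
      exact List.perm_middle.symm
    · exact ⟨j :: τ, n, h.cons _⟩

end Leibniz

/-- Moving the centre of a Taylor polynomial turns its k-th coefficient into the truncated Taylor
polynomial, with K - k terms, of the shifted sequence. Induction on K isolates the coefficient a K,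
for which this is the binomial theorem. The sums defining Q arise in this way. -/
theorem sum_taylor_shift (K : ℕ) (a : ℕ → ℝ) (x y : ℝ) :
    ∑ k ∈ Finset.range K, a k * (x + y) ^ k / k.factorial =
      ∑ k ∈ Finset.range K, (∑ j ∈ Finset.range (K - k), a (k + j) * y ^ j / j.factorial) *
        (x ^ k / k.factorial) := by
  induction K with
  | zero => simp
  | succ K ih =>
    have h1 : ∀ k ∈ Finset.range (K + 1), (∑ j ∈ Finset.range (K + 1 - k),
        a (k + j) * y ^ j / j.factorial) * (x ^ k / k.factorial) =
        (∑ j ∈ Finset.range (K - k), a (k + j) * y ^ j / j.factorial) * (x ^ k / k.factorial) +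
          a K * y ^ (K - k) / (K - k).factorial * (x ^ k / k.factorial) := by
      intro k hk
      have hk' : k ≤ K := by have := Finset.mem_range.1 hk; omega
      have : K + 1 - k = (K - k) + 1 := by omega
      rw [this, Finset.sum_range_succ, add_mul]
      have : k + (K - k) = K := by omega
      rw [this]
    rw [Finset.sum_range_succ, ih, Finset.sum_congr rfl h1, Finset.sum_add_distrib,
      Finset.sum_range_succ (fun k => (∑ j ∈ Finset.range (K - k),
        a (k + j) * y ^ j / j.factorial) * (x ^ k / k.factorial))]
    simp only [Nat.sub_self, Finset.range_zero, Finset.sum_empty, zero_mul, add_zero]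
    congr 1
    rw [add_pow, Finset.mul_sum, Finset.sum_div]
    refine Finset.sum_congr rfl fun k hk => ?_
    have hk' : k ≤ K := by have := Finset.mem_range.1 hk; omega
    rw [Nat.cast_choose ℝ hk']
    have e1 : (K.factorial : ℝ) ≠ 0 := by exact_mod_cast K.factorial_ne_zero
    have e2 : (k.factorial : ℝ) ≠ 0 := by exact_mod_cast k.factorial_ne_zero
    have e3 : ((K - k).factorial : ℝ) ≠ 0 := by exact_mod_cast (K - k).factorial_ne_zero
    field_simp

theorem ENNReal.add_rpow_le_two (a b : ℝ≥0∞) {p : ℝ} (hp : 1 ≤ p) :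
    (a + b) ^ p ≤ 2 ^ (p - 1) * (a ^ p + b ^ p) := by
  have := ENNReal.rpow_add_le_mul_rpow_add_rpow a b hp
  simpa using this

/-! ### Difference of two functions expanded from opposite faces -/

section Difference

variable {d : ℕ} {p : ℝ}

/-- The difference of two functions whose derivatives are close to polynomials in the vertical
variable, in terms of the coefficients of the difference of these polynomials. -/
theorem lintegral_sub_le_of_taylor (hp : 1 < p) (q : ℕ) {bm bp : ℝ} (hb : bm < bp)
    {Vm Vp Wm Wp : FullSpace d → ℝ} (hVm : ContinuousOn Vm (strip d bm bp))
    (hVp : ContinuousOn Vp (strip d bm bp)) (hWm : ContinuousOn Wm (strip d bm bp))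
    (hWp : ContinuousOn Wp (strip d bm bp)) {Am Ap : ℕ → HorSpace d → ℝ}
    {Q : ℕ → HorSpace d → ℝ} (hQm : ∀ k ∈ Finset.range (q + 1), Measurable (Q k))
    (hQ : ∀ k x, Q k x = ∑ j ∈ Finset.range (q + 1 - k),
      (Ap (k + j) x * (-((bp - bm) / 2)) ^ j / j.factorial -
        Am (k + j) x * ((bp - bm) / 2) ^ j / j.factorial))
    (hm : ∀ᵐ x' : HorSpace d, ∀ s ∈ Ioo bm bp, ‖Vm (x', s) -
      ∑ k ∈ Finset.range (q + 1), Am k x' * (s - bm) ^ k / k.factorial‖ₑ ≤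
        ENNReal.ofReal ((bp - bm) ^ q) * ∫⁻ s in Ioo bm bp, ‖Wm (x', s)‖ₑ)
    (hpl : ∀ᵐ x' : HorSpace d, ∀ s ∈ Ioo bm bp, ‖Vp (x', s) -
      ∑ k ∈ Finset.range (q + 1), Ap k x' * (s - bp) ^ k / k.factorial‖ₑ ≤
        ENNReal.ofReal ((bp - bm) ^ q) * ∫⁻ s in Ioo bm bp, ‖Wp (x', s)‖ₑ) :
    ∫⁻ x in strip d bm bp, ‖Vm x - Vp x‖ₑ ^ p ≤
      2 ^ (p - 1) * 2 ^ (p - 1) * ((q + 1 : ℕ) : ℝ≥0∞) ^ (p - 1) *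
      ((∑ k ∈ Finset.range (q + 1), ENNReal.ofReal ((bp - bm) ^ ((k : ℝ) * p + 1)) *
          ∫⁻ x, ‖Q k x‖ₑ ^ p) +
        ENNReal.ofReal ((bp - bm) ^ (((q : ℝ) + 1) * p)) *
          ((∫⁻ x in strip d bm bp, ‖Wm x‖ₑ ^ p) + ∫⁻ x in strip d bm bp, ‖Wp x‖ₑ ^ p)) := by
  set b := bp - bm with hbdef
  have hb0 : 0 < b := by linarith
  have hp0 : 0 < p := by linarith
  have h2top : (2 : ℝ≥0∞) ^ (p - 1) ≠ ⊤ :=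
    ENNReal.rpow_ne_top_of_nonneg (by linarith) (by norm_num)
  have h2one : (1 : ℝ≥0∞) ≤ 2 ^ (p - 1) := ENNReal.one_le_rpow (by norm_num) (by linarith)
  have hNtop : ((q + 1 : ℕ) : ℝ≥0∞) ^ (p - 1) ≠ ⊤ := natCast_rpow_ne_top _ (by linarith)
  have hNone : (1 : ℝ≥0∞) ≤ ((q + 1 : ℕ) : ℝ≥0∞) ^ (p - 1) :=
    ENNReal.one_le_rpow (by simp) (by linarith)
  have haem : ∀ W : FullSpace d → ℝ, ContinuousOn W (strip d bm bp) →
      AEMeasurable (fun x => ‖W x‖ₑ ^ p) (volume.restrict (strip d bm bp)) := fun W hW =>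
    (hW.aemeasurable (measurableSet_strip bm bp)).enorm.pow_const _
  set I : (FullSpace d → ℝ) → HorSpace d → ℝ≥0∞ := fun W x' =>
    ∫⁻ s in Ioo bm bp, ‖W (x', s)‖ₑ ^ p with hI
  have hIm : ∀ W : FullSpace d → ℝ, ContinuousOn W (strip d bm bp) → AEMeasurable (I W) := by
    intro W hW
    have := haem W hW
    rw [volume_restrict_strip] at this
    exact this.lintegral_prod_right'
  have hIint : ∀ W : FullSpace d → ℝ, ContinuousOn W (strip d bm bp) →
      ∫⁻ x', I W x' = ∫⁻ x in strip d bm bp, ‖W x‖ₑ ^ p := fun W hW =>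
    (lintegral_strip (haem W hW)).symm
  -- Hölder on a line of length b gives b^{p-1}. Together with b^{qp} and one more b, from
  -- integrating a bound constant in s, the exponent is (q+1)p.
  have hjens : ∀ W : FullSpace d → ℝ, ContinuousOn W (strip d bm bp) → ∀ x',
      (ENNReal.ofReal (b ^ q) * ∫⁻ s in Ioo bm bp, ‖W (x', s)‖ₑ) ^ p * ENNReal.ofReal b ≤
        ENNReal.ofReal (b ^ (((q : ℝ) + 1) * p)) * I W x' := by
    intro W hW x'
    have hc : ContinuousOn (fun s => W (x', s)) (Ioo bm bp) :=
      hW.comp (by fun_prop) fun s hs => hs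
    have := lintegral_rpow_le_measure_univ_rpow_mul (volume.restrict (Ioo bm bp)) hp
      (f := fun s => ‖W (x', s)‖ₑ) (hc.aemeasurable measurableSet_Ioo).enorm
    rw [Measure.restrict_apply_univ, Real.volume_Ioo, ← hbdef] at this
    rw [ENNReal.mul_rpow_of_nonneg _ _ hp0.le]
    calc ENNReal.ofReal (b ^ q) ^ p * (∫⁻ s in Ioo bm bp, ‖W (x', s)‖ₑ) ^ p * ENNReal.ofReal b
        ≤ ENNReal.ofReal (b ^ q) ^ p * (ENNReal.ofReal b ^ (p - 1) * I W x') *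
          ENNReal.ofReal b := by gcongr
      _ = (ENNReal.ofReal (b ^ q) ^ p * (ENNReal.ofReal b ^ (p - 1) * ENNReal.ofReal b)) *
          I W x' := by ring
      _ = _ := by
        congr 1
        rw [ENNReal.ofReal_rpow_of_nonneg (by positivity) hp0.le,
          ENNReal.ofReal_rpow_of_nonneg hb0.le (by linarith),
          ← ENNReal.ofReal_mul (by positivity), ← ENNReal.ofReal_mul (by positivity)]
        congr 1
        rw [← Real.rpow_natCast b q, ← Real.rpow_mul hb0.le]
        nth_rewrite 3 [← Real.rpow_one b]
        rw [← Real.rpow_add hb0, ← Real.rpow_add hb0]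
        congr 1
        ring
  -- Both polynomials are re-expanded about the midpoint, which is b/2 above the lower face and b/2
  -- below the upper one.
  have hpoly : ∀ x' s, (∑ k ∈ Finset.range (q + 1), Ap k x' * (s - bp) ^ k / k.factorial) -
      ∑ k ∈ Finset.range (q + 1), Am k x' * (s - bm) ^ k / k.factorial =
      ∑ k ∈ Finset.range (q + 1), Q k x' * ((s - (bm + bp) / 2) ^ k / k.factorial) := by
    intro x' s
    have e1 : s - bp = (s - (bm + bp) / 2) + -(b / 2) := by rw [hbdef]; ring
    have e2 : s - bm = (s - (bm + bp) / 2) + b / 2 := by rw [hbdef]; ring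
    rw [e1, e2, sum_taylor_shift (q + 1) (fun k => Ap k x'),
      sum_taylor_shift (q + 1) (fun k => Am k x'), ← Finset.sum_sub_distrib]
    refine Finset.sum_congr rfl fun k _ => ?_
    rw [hQ, Finset.sum_sub_distrib, sub_mul]
  have hpolyb : ∀ x', ∀ s ∈ Ioo bm bp,
      ‖∑ k ∈ Finset.range (q + 1), Q k x' * ((s - (bm + bp) / 2) ^ k / k.factorial)‖ₑ ^ p ≤
      ((q + 1 : ℕ) : ℝ≥0∞) ^ (p - 1) * ∑ k ∈ Finset.range (q + 1),
        ENNReal.ofReal (b ^ ((k : ℝ) * p)) * ‖Q k x'‖ₑ ^ p := by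
    intro x' s hs
    refine (enorm_sum_rpow_le _ _ hp.le).trans ?_
    rw [Finset.card_range]
    gcongr with k _
    rw [enorm_mul, ENNReal.mul_rpow_of_nonneg _ _ hp0.le, mul_comm]
    gcongr
    rw [Real.rpow_mul hb0.le, Real.rpow_natCast, ← ENNReal.ofReal_rpow_of_nonneg (by positivity)
      hp0.le]
    refine ENNReal.rpow_le_rpow ?_ hp0.le
    rw [← ofReal_norm]
    refine ENNReal.ofReal_le_ofReal ?_
    rw [norm_div, norm_pow, Real.norm_of_nonneg (Nat.cast_nonneg k.factorial)]
    have e1 : ‖s - (bm + bp) / 2‖ ≤ b := by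
      rw [Real.norm_eq_abs, abs_le]
      constructor <;> linarith [hs.1, hs.2]
    have e2 : (1 : ℝ) ≤ k.factorial := by exact_mod_cast k.factorial_pos
    calc ‖s - (bm + bp) / 2‖ ^ k / k.factorial ≤ ‖s - (bm + bp) / 2‖ ^ k :=
          div_le_self (by positivity) e2
      _ ≤ b ^ k := by gcongr
  have hpt : ∀ᵐ x' : HorSpace d, ∫⁻ s in Ioo bm bp, ‖Vm (x', s) - Vp (x', s)‖ₑ ^ p ≤
      2 ^ (p - 1) * 2 ^ (p - 1) * ((q + 1 : ℕ) : ℝ≥0∞) ^ (p - 1) *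
        ((∑ k ∈ Finset.range (q + 1), ENNReal.ofReal (b ^ ((k : ℝ) * p + 1)) * ‖Q k x'‖ₑ ^ p) +
          ENNReal.ofReal (b ^ (((q : ℝ) + 1) * p)) * (I Wm x' + I Wp x')) := by
    filter_upwards [hm, hpl] with x' h1 h2
    set Bm := ENNReal.ofReal (b ^ q) * ∫⁻ s in Ioo bm bp, ‖Wm (x', s)‖ₑ with hBm
    set Bp := ENNReal.ofReal (b ^ q) * ∫⁻ s in Ioo bm bp, ‖Wp (x', s)‖ₑ with hBp
    set SQ := ∑ k ∈ Finset.range (q + 1), ENNReal.ofReal (b ^ ((k : ℝ) * p)) * ‖Q k x'‖ₑ ^ p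
      with hSQ
    set N := ((q + 1 : ℕ) : ℝ≥0∞) ^ (p - 1) with hN
    have hs : ∀ s ∈ Ioo bm bp, ‖Vm (x', s) - Vp (x', s)‖ₑ ^ p ≤
        2 ^ (p - 1) * 2 ^ (p - 1) * N * (SQ + (Bm ^ p + Bp ^ p)) := by
      intro s hs
      set P := ∑ k ∈ Finset.range (q + 1), Q k x' * ((s - (bm + bp) / 2) ^ k / k.factorial) with hP
      have e1 : Vm (x', s) - Vp (x', s) = (-P) + ((Vm (x', s) -
          ∑ k ∈ Finset.range (q + 1), Am k x' * (s - bm) ^ k / k.factorial) -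
          (Vp (x', s) - ∑ k ∈ Finset.range (q + 1), Ap k x' * (s - bp) ^ k / k.factorial)) := by
        rw [hP, ← hpoly]; ring
      have e2 : ‖Vm (x', s) - Vp (x', s)‖ₑ ≤ ‖P‖ₑ + (Bm + Bp) := by
        rw [e1]
        refine (enorm_add_le _ _).trans (add_le_add (by rw [enorm_neg]) ?_)
        exact (enorm_sub_le).trans (add_le_add (h1 s hs) (h2 s hs))
      calc ‖Vm (x', s) - Vp (x', s)‖ₑ ^ p ≤ (‖P‖ₑ + (Bm + Bp)) ^ p :=
            ENNReal.rpow_le_rpow e2 hp0.le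
        _ ≤ 2 ^ (p - 1) * (‖P‖ₑ ^ p + (Bm + Bp) ^ p) := ENNReal.add_rpow_le_two _ _ hp.le
        _ ≤ 2 ^ (p - 1) * (N * SQ + 2 ^ (p - 1) * (Bm ^ p + Bp ^ p)) := by
            gcongr
            · exact hpolyb x' s hs
            · exact ENNReal.add_rpow_le_two _ _ hp.le
        _ ≤ 2 ^ (p - 1) * (2 ^ (p - 1) * N * SQ + 2 ^ (p - 1) * N * (Bm ^ p + Bp ^ p)) := by
            gcongr
            · exact le_mul_of_one_le_left zero_le h2one
            · exact le_mul_of_one_le_right zero_le hNone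
        _ = _ := by ring
    refine (setLIntegral_mono' measurableSet_Ioo hs).trans ?_
    rw [setLIntegral_const, Real.volume_Ioo, ← hbdef, mul_assoc]
    gcongr 1
    rw [add_mul, add_mul, mul_add]
    refine add_le_add (le_of_eq ?_) (add_le_add (hjens Wm hWm x') (hjens Wp hWp x'))
    rw [hSQ, Finset.sum_mul]
    refine Finset.sum_congr rfl fun k _ => ?_
    rw [mul_right_comm, ← ENNReal.ofReal_mul (by positivity), Real.rpow_add hb0, Real.rpow_one]
  have hsubm : AEMeasurable (fun x => ‖Vm x - Vp x‖ₑ ^ p) (volume.restrict (strip d bm bp)) :=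
    haem (fun x => Vm x - Vp x) (hVm.sub hVp)
  rw [lintegral_strip hsubm]
  refine (lintegral_mono_ae hpt).trans (le_of_eq ?_)
  rw [lintegral_const_mul' _ _ (ENNReal.mul_ne_top (ENNReal.mul_ne_top h2top h2top) hNtop)]
  congr 1
  have hQae : ∀ k ∈ Finset.range (q + 1), AEMeasurable (fun x' =>
      ENNReal.ofReal (b ^ ((k : ℝ) * p + 1)) * ‖Q k x'‖ₑ ^ p) := fun k hk =>
    ((hQm k hk).enorm.pow_const _).aemeasurable.const_mul _
  rw [lintegral_add_left' (Finset.aemeasurable_fun_sum _ hQae), lintegral_finsetSum' _ hQae,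
    lintegral_const_mul' _ _ ENNReal.ofReal_ne_top, lintegral_add_left' (hIm Wm hWm),
    hIint Wm hWm, hIint Wp hWp]
  congr 1
  exact Finset.sum_congr rfl fun k _ => lintegral_const_mul' _ _ ENNReal.ofReal_ne_top

end Difference

end

noncomputable section

set_option linter.unusedSectionVars false

/-! ### Gluing the two extensions with a cutoff -/

section Glue

variable {d m : ℕ} {ε p : ℝ} {ψ : HorSpace d → ℝ}

/-- The mismatch at the middle of the strip of the Taylor polynomials of the two families. -/
def midMismatch (Gm Gp : Fin m → (Fin d → ℕ) → HorSpace d → ℝ) (b : ℝ) (i n : ℕ)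
    (β : Fin d → ℕ) (x : HorSpace d) : ℝ :=
  ∑ j ∈ Finset.range (m - i - n), (dataAt Gp (j + n) β x * (-(b / 2)) ^ j / j.factorial -
    dataAt Gm (j + n) β x * (b / 2) ^ j / j.factorial)

/-- The weighted sum of the energies of the mismatches. -/
def mismatchEnergy (p : ℝ) (Gm Gp : Fin m → (Fin d → ℕ) → HorSpace d → ℝ) (b : ℝ) : ℝ≥0∞ :=
  ∑ n ∈ Finset.range m, ∑ i ∈ Finset.range (m - n),
    ENNReal.ofReal (b ^ (((n : ℝ) + i - m) * p + 1)) *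
      ∑ β ∈ multiIdx d i, ∫⁻ x, ‖midMismatch Gm Gp b i n β x‖ₑ ^ p

/-- The sum of the difference-quotient energies of the top order derivatives. -/
def dataEnergy (p r : ℝ) (G : Fin m → (Fin d → ℕ) → HorSpace d → ℝ) : ℝ≥0∞ :=
  ∑ k : Fin m, ∑ γ ∈ multiIdx d (m - 1 - k), diffEnergy p r (G k γ)

theorem contDiffOn_sideExt_strip (hε : 0 ≤ ε) (h : IsKernel ε ψ)
    {G : Fin m → (Fin d → ℕ) → HorSpace d → ℝ} (hG : ∀ k : Fin m, IsJet p (m - 1 - k) (G k))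
    {σ c bm bp : ℝ} (hg : SideGeom σ c bm bp) :
    ContDiffOn ℝ ∞ (sideExt σ c ψ fun k => G k 0) (strip d bm bp) :=
  (contDiffOn_sideExt hε h (fun k => (hG k).locallyIntegrable 0 (by simp)) σ c).mono hg.strip_subset

theorem measurable_dataAt {G : Fin m → (Fin d → ℕ) → HorSpace d → ℝ}
    (hG : ∀ k : Fin m, IsJet p (m - 1 - k) (G k)) (j : ℕ) (β : Fin d → ℕ)
    (h : j < m → ∑ i, β i ≤ m - 1 - j) : Measurable (dataAt G j β) := by
  by_cases hj : j < m
  · have : dataAt G j β = G ⟨j, hj⟩ β := by funext x; simp [dataAt, hj]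
    rw [this]
    exact (hG ⟨j, hj⟩).measurable β (h hj)
  · have : dataAt G j β = fun _ => 0 := by funext x; simp [dataAt, hj]
    rw [this]
    exact measurable_const

theorem measurable_midMismatch {Gm Gp : Fin m → (Fin d → ℕ) → HorSpace d → ℝ}
    (hGm : ∀ k : Fin m, IsJet p (m - 1 - k) (Gm k)) (hGp : ∀ k : Fin m, IsJet p (m - 1 - k) (Gp k))
    (b : ℝ) (n : ℕ) (β : Fin d → ℕ) : Measurable (midMismatch Gm Gp b (∑ i, β i) n β) := by
  refine Finset.measurable_fun_sum _ fun j hj => ?_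
  have hj' := Finset.mem_range.1 hj
  have h1 := measurable_dataAt hGp (j + n) β (by omega)
  have h2 := measurable_dataAt hGm (j + n) β (by omega)
  exact ((h1.mul_const _).div_const _).sub ((h2.mul_const _).div_const _)

/-- In normal form the word v has horizontal part τ and n vertical letters; Taylor expansion to
order q = m - |v| - 1 leaves remainders containing exactly m derivatives. The weight b^{(|v|-m)p}
then cancels the power b^{(q+1)p} in front of the remainders and gives the mismatch of index n + k
its prescribed power. -/
theorem weighted_lintegral_sub_lt_order (hε : 0 < ε) (h : IsKernel ε ψ) (hψ : ∫ y, ψ y = 1)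
    (hp : 1 < p) (v : List (Fin (d + 1))) (hv : v.length < m) : ∃ C : ℝ≥0∞, C ≠ ⊤ ∧
      ∀ Gm Gp : Fin m → (Fin d → ℕ) → HorSpace d → ℝ,
        (∀ k : Fin m, IsJet p (m - 1 - k) (Gm k)) → (∀ k : Fin m, IsJet p (m - 1 - k) (Gp k)) →
      ∀ bm bp : ℝ, bm < bp →
        ENNReal.ofReal ((bp - bm) ^ (((v.length : ℝ) - m) * p)) *
          ∫⁻ x in strip d bm bp, ‖wordDeriv v (sideExt 1 bm ψ fun k => Gm k 0) x -
            wordDeriv v (sideExt (-1) bp ψ fun k => Gp k 0) x‖ₑ ^ p ≤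
        C * (mismatchEnergy p Gm Gp (bp - bm) + (dataEnergy p (ε * (bp - bm)) Gm +
          dataEnergy p (ε * (bp - bm)) Gp)) := by
  obtain ⟨τ, n, hperm⟩ := exists_perm_normal_form v
  have hlen : v.length = τ.length + n := by rw [hperm.length_eq]; simp
  obtain ⟨q, hq⟩ : ∃ q, m - τ.length - n = q + 1 := ⟨m - τ.length - n - 1, by omega⟩
  have hq' : m - 1 - τ.length - n = q := by omega
  set w₀ := τ.map Fin.castSucc ++ List.replicate n (Fin.last d) with hw₀
  set w₁ := List.replicate (q + 1) (Fin.last d) ++ w₀ with hw₁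
  have hw₁l : w₁.length = m := by simp [hw₁, hw₀]; omega
  obtain ⟨C₁, hC₁, hE⟩ := lintegral_wordDeriv_sideExt_le (m := m) (p := p) hε h hp w₁ hw₁l
  set C₀ : ℝ≥0∞ := 2 ^ (p - 1) * 2 ^ (p - 1) * ((q + 1 : ℕ) : ℝ≥0∞) ^ (p - 1) with hC₀
  have h2top : (2 : ℝ≥0∞) ^ (p - 1) ≠ ⊤ :=
    ENNReal.rpow_ne_top_of_nonneg (by linarith) (by norm_num)
  have hC₀top : C₀ ≠ ⊤ := ENNReal.mul_ne_top (ENNReal.mul_ne_top h2top h2top)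
    (natCast_rpow_ne_top _ (by linarith))
  refine ⟨C₀ * ((q + 1 : ℕ) + C₁), ENNReal.mul_ne_top hC₀top
    (ENNReal.add_ne_top.2 ⟨ENNReal.natCast_ne_top _, hC₁⟩), ?_⟩
  intro Gm Gp hGm hGp bm bp hb
  have hb0 : 0 < bp - bm := by linarith
  set b := bp - bm with hbdef
  set um := sideExt 1 bm ψ fun k => Gm k 0 with hum
  set up := sideExt (-1) bp ψ fun k => Gp k 0 with hup
  set β : Fin d → ℕ := fun i => τ.count i with hβ
  have hβsum : ∑ i, β i = τ.length := sum_count_eq_length τ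
  have hgm := sideGeom_lower bm bp
  have hgp := sideGeom_upper bm bp
  have hsm := contDiffOn_sideExt_strip hε.le h hGm hgm
  have hsp := contDiffOn_sideExt_strip hε.le h hGp hgp
  have hopen := isOpen_strip (d := d) bm bp
  have hTm := ae_enorm_wordDeriv_sideExt_sub_taylor_le hε h hψ (by linarith) τ n (by omega) hGm hgm
  have hTp := ae_enorm_wordDeriv_sideExt_sub_taylor_le hε h hψ (by linarith) τ n (by omega) hGp hgp
  rw [hq, hq'] at hTm hTp
  have key := lintegral_sub_le_of_taylor hp q hb
    (wordDeriv_contDiffOn hopen hsm w₀).continuousOn (wordDeriv_contDiffOn hopen hsp w₀).continuousOn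
    (wordDeriv_contDiffOn hopen hsm w₁).continuousOn (wordDeriv_contDiffOn hopen hsp w₁).continuousOn
    (Q := fun k => midMismatch Gm Gp b τ.length (n + k) β) (fun k _ => by
      rw [← hβsum]; exact measurable_midMismatch hGm hGp b (n + k) β) (fun k x => by
      have e : m - τ.length - (n + k) = q + 1 - k := by omega
      simp only [midMismatch, e]
      refine Finset.sum_congr rfl fun j _ => ?_
      have e2 : j + (n + k) = k + j + n := by omega
      rw [e2]) hTm hTp
  rw [← hC₀] at key
  have hcongr : ∫⁻ x in strip d bm bp, ‖wordDeriv v um x - wordDeriv v up x‖ₑ ^ p =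
      ∫⁻ x in strip d bm bp, ‖wordDeriv w₀ um x - wordDeriv w₀ up x‖ₑ ^ p := by
    refine setLIntegral_congr_fun (measurableSet_strip bm bp) fun x hx => ?_
    rw [wordDeriv_perm hopen hsm hperm hx, wordDeriv_perm hopen hsp hperm hx]
  rw [hcongr]
  have hml : ((v.length : ℝ) - m) = -((q : ℝ) + 1) := by
    have : (m : ℝ) = τ.length + n + (q + 1) := by
      have : m = τ.length + n + (q + 1) := by omega
      exact_mod_cast this
    rw [this, hlen]; push_cast; ring
  set B := ENNReal.ofReal (b ^ (((v.length : ℝ) - m) * p)) with hB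
  have hEm := hE Gm hGm 1 bm bm bp hb hgm
  have hEp := hE Gp hGp (-1) bp bm bp hb hgp
  -- The exponent (|v|-m)p + kp + 1 is that of the summand (n+k, |τ|) of `mismatchEnergy`, so this
  -- term is dominated by the whole sum.
  have hQ : ∀ k ∈ Finset.range (q + 1), B * (ENNReal.ofReal (b ^ ((k : ℝ) * p + 1)) *
      ∫⁻ x, ‖midMismatch Gm Gp b τ.length (n + k) β x‖ₑ ^ p) ≤ mismatchEnergy p Gm Gp b := by
    intro k hk
    have hk' := Finset.mem_range.1 hk
    rw [hB, ← mul_assoc, ← ENNReal.ofReal_mul (by positivity), ← Real.rpow_add hb0]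
    have e : ((v.length : ℝ) - m) * p + (k * p + 1) =
        (((n + k : ℕ) : ℝ) + τ.length - m) * p + 1 := by
      rw [hlen]; push_cast; ring
    rw [e]
    calc _ ≤ ENNReal.ofReal (b ^ ((((n + k : ℕ) : ℝ) + τ.length - m) * p + 1)) *
          ∑ β ∈ multiIdx d τ.length, ∫⁻ x, ‖midMismatch Gm Gp b τ.length (n + k) β x‖ₑ ^ p := by
          gcongr
          exact Finset.single_le_sum (f := fun β =>
            ∫⁻ x, ‖midMismatch Gm Gp b τ.length (n + k) β x‖ₑ ^ p) (fun _ _ => zero_le)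
            (mem_multiIdx.2 hβsum)
      _ ≤ _ := by
          refine le_trans ?_ (Finset.single_le_sum (f := fun n => ∑ i ∈ Finset.range (m - n),
            ENNReal.ofReal (b ^ (((n : ℝ) + i - m) * p + 1)) *
            ∑ β ∈ multiIdx d i, ∫⁻ x, ‖midMismatch Gm Gp b i n β x‖ₑ ^ p) (fun _ _ => zero_le)
            (Finset.mem_range.2 (show n + k < m by omega)))
          exact Finset.single_le_sum (f := fun i : ℕ =>
            ENNReal.ofReal (b ^ ((((n + k : ℕ) : ℝ) + i - m) * p + 1)) *
            ∑ β ∈ multiIdx d i, ∫⁻ x, ‖midMismatch Gm Gp b i (n + k) β x‖ₑ ^ p)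
            (fun _ _ => zero_le) (Finset.mem_range.2 (show τ.length < m - (n + k) by omega))
  -- The weight exactly absorbs the power of b in front of the remainders.
  have hone : B * ENNReal.ofReal (b ^ (((q : ℝ) + 1) * p)) = 1 := by
    rw [hB, ← ENNReal.ofReal_mul (by positivity), ← Real.rpow_add hb0, hml]
    have : -((q : ℝ) + 1) * p + (q + 1) * p = 0 := by ring
    rw [this, Real.rpow_zero, ENNReal.ofReal_one]
  calc B * ∫⁻ x in strip d bm bp, ‖wordDeriv w₀ um x - wordDeriv w₀ up x‖ₑ ^ p
      ≤ B * (C₀ * ((∑ k ∈ Finset.range (q + 1), ENNReal.ofReal (b ^ ((k : ℝ) * p + 1)) *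
          ∫⁻ x, ‖midMismatch Gm Gp b τ.length (n + k) β x‖ₑ ^ p) +
        ENNReal.ofReal (b ^ (((q : ℝ) + 1) * p)) *
          ((∫⁻ x in strip d bm bp, ‖wordDeriv w₁ um x‖ₑ ^ p) +
            ∫⁻ x in strip d bm bp, ‖wordDeriv w₁ up x‖ₑ ^ p))) := by gcongr
    _ = C₀ * ((∑ k ∈ Finset.range (q + 1), B * (ENNReal.ofReal (b ^ ((k : ℝ) * p + 1)) *
          ∫⁻ x, ‖midMismatch Gm Gp b τ.length (n + k) β x‖ₑ ^ p)) +
          ((∫⁻ x in strip d bm bp, ‖wordDeriv w₁ um x‖ₑ ^ p) +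
            ∫⁻ x in strip d bm bp, ‖wordDeriv w₁ up x‖ₑ ^ p)) := by
        rw [mul_left_comm, mul_add, Finset.mul_sum, ← mul_assoc B (ENNReal.ofReal _), hone, one_mul]
    _ ≤ C₀ * ((∑ k ∈ Finset.range (q + 1), mismatchEnergy p Gm Gp b) +
          (C₁ * dataEnergy p (ε * b) Gm + C₁ * dataEnergy p (ε * b) Gp)) := by
        gcongr with k hk
        · exact hQ k hk
        · exact hEm
        · exact hEp
    _ ≤ _ := by
        rw [Finset.sum_const, Finset.card_range, nsmul_eq_mul, mul_assoc C₀]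
        refine mul_le_mul' le_rfl ?_
        rw [add_mul, ← mul_add C₁]
        exact add_le_add (mul_le_mul' le_rfl le_self_add) (mul_le_mul' le_rfl le_add_self)

/-- At order |v| = m there is nothing to expand: the weight is 1 and both top order energies are
already bounded. -/
theorem weighted_lintegral_sub_le (hε : 0 < ε) (h : IsKernel ε ψ) (hψ : ∫ y, ψ y = 1)
    (hp : 1 < p) (v : List (Fin (d + 1))) (hv : v.length ≤ m) : ∃ C : ℝ≥0∞, C ≠ ⊤ ∧
      ∀ Gm Gp : Fin m → (Fin d → ℕ) → HorSpace d → ℝ,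
        (∀ k : Fin m, IsJet p (m - 1 - k) (Gm k)) → (∀ k : Fin m, IsJet p (m - 1 - k) (Gp k)) →
      ∀ bm bp : ℝ, bm < bp →
        ENNReal.ofReal ((bp - bm) ^ (((v.length : ℝ) - m) * p)) *
          ∫⁻ x in strip d bm bp, ‖wordDeriv v (sideExt 1 bm ψ fun k => Gm k 0) x -
            wordDeriv v (sideExt (-1) bp ψ fun k => Gp k 0) x‖ₑ ^ p ≤
        C * (mismatchEnergy p Gm Gp (bp - bm) + (dataEnergy p (ε * (bp - bm)) Gm +
          dataEnergy p (ε * (bp - bm)) Gp)) := by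
  rcases hv.lt_or_eq with hv | hv
  · exact weighted_lintegral_sub_lt_order hε h hψ hp v hv
  obtain ⟨C₁, hC₁, hE⟩ := lintegral_wordDeriv_sideExt_le (m := m) (p := p) hε h hp v hv
  have h2top : (2 : ℝ≥0∞) ^ (p - 1) ≠ ⊤ :=
    ENNReal.rpow_ne_top_of_nonneg (by linarith) (by norm_num)
  refine ⟨2 ^ (p - 1) * C₁, ENNReal.mul_ne_top h2top hC₁, ?_⟩
  intro Gm Gp hGm hGp bm bp hb
  have hsm := contDiffOn_sideExt_strip hε.le h hGm (sideGeom_lower bm bp)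
  have hmeas : AEMeasurable (fun x => ‖wordDeriv v (sideExt 1 bm ψ fun k => Gm k 0) x‖ₑ ^ p)
      (volume.restrict (strip d bm bp)) := ((wordDeriv_contDiffOn (isOpen_strip bm bp) hsm v).continuousOn.aemeasurable
    (measurableSet_strip bm bp)).enorm.pow_const p
  rw [hv, sub_self, zero_mul, Real.rpow_zero, ENNReal.ofReal_one, one_mul]
  calc _ ≤ ∫⁻ x in strip d bm bp, 2 ^ (p - 1) *
        (‖wordDeriv v (sideExt 1 bm ψ fun k => Gm k 0) x‖ₑ ^ p +
          ‖wordDeriv v (sideExt (-1) bp ψ fun k => Gp k 0) x‖ₑ ^ p) := by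
        refine lintegral_mono fun x => ?_
        exact (ENNReal.rpow_le_rpow enorm_sub_le (by linarith)).trans
          (ENNReal.add_rpow_le_two _ _ hp.le)
    _ ≤ 2 ^ (p - 1) * (C₁ * dataEnergy p (ε * (bp - bm)) Gm +
          C₁ * dataEnergy p (ε * (bp - bm)) Gp) := by
        rw [lintegral_const_mul' _ _ h2top, lintegral_add_left' hmeas]
        gcongr
        · exact hE Gm hGm 1 bm bm bp hb (sideGeom_lower bm bp)
        · exact hE Gp hGp (-1) bp bm bp hb (sideGeom_upper bm bp)
    _ ≤ _ := by
        rw [← mul_add, mul_assoc]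
        exact mul_le_mul' le_rfl (mul_le_mul' le_rfl le_add_self)

/-- A smooth function that is `1` near `0` and below, and `0` near `1` and above. -/
def cutoffProfile (s : ℝ) : ℝ := Real.smoothTransition (2 - 3 * s)

theorem contDiff_cutoffProfile : ContDiff ℝ ∞ cutoffProfile :=
  Real.smoothTransition.contDiff.comp (by fun_prop)

/-- The derivatives of the cutoff function of the strip. -/
def cutoffSeq (bm b : ℝ) (j : ℕ) (s : ℝ) : ℝ :=
  (b⁻¹) ^ j * iteratedDeriv j cutoffProfile ((s - bm) / b)

theorem hasDerivAt_cutoffSeq (bm b : ℝ) (j : ℕ) (s : ℝ) :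
    HasDerivAt (cutoffSeq bm b j) (cutoffSeq bm b (j + 1) s) s := by
  have h1 : HasDerivAt (iteratedDeriv j cutoffProfile)
      (iteratedDeriv (j + 1) cutoffProfile ((s - bm) / b)) ((s - bm) / b) := by
    rw [iteratedDeriv_succ]
    refine (DifferentiableAt.hasDerivAt ?_)
    exact (contDiff_cutoffProfile.differentiable_iteratedDeriv j
      (by exact_mod_cast ENat.natCast_lt_top j)) _
  have h2 : HasDerivAt (fun s => (s - bm) / b) (1 / b) s :=
    ((hasDerivAt_id s).sub_const bm).div_const b
  have h3 := (h1.comp s h2).const_mul ((b⁻¹) ^ j)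
  refine h3.congr_deriv ?_
  unfold cutoffSeq
  rw [pow_succ]; ring

theorem contDiff_cutoffSeq_zero (bm b : ℝ) : ContDiff ℝ ∞ (cutoffSeq bm b 0) := by
  have : cutoffSeq bm b 0 = fun s => cutoffProfile ((s - bm) / b) := by
    funext s; simp [cutoffSeq]
  rw [this]
  exact contDiff_cutoffProfile.comp (by fun_prop)

theorem cutoffSeq_zero_eq_one {bm b s : ℝ} (hb : 0 < b) (h : s ≤ bm + b / 3) :
    cutoffSeq bm b 0 s = 1 := by
  simp only [cutoffSeq, pow_zero, one_mul, iteratedDeriv_zero, cutoffProfile]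
  apply Real.smoothTransition.one_of_one_le
  have : (s - bm) / b ≤ 1 / 3 := by rw [div_le_iff₀ hb]; linarith
  linarith

theorem cutoffSeq_zero_eq_zero {bm b s : ℝ} (hb : 0 < b) (h : bm + 2 * b / 3 ≤ s) :
    cutoffSeq bm b 0 s = 0 := by
  simp only [cutoffSeq, pow_zero, one_mul, iteratedDeriv_zero, cutoffProfile]
  apply Real.smoothTransition.zero_of_nonpos
  have : 2 / 3 ≤ (s - bm) / b := by rw [le_div_iff₀ hb]; linarith
  linarith

/-- The profile is evaluated on the fixed compact interval [0,1], so M depends on j alone and each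
derivative costs one factor 1/b. -/
theorem exists_cutoffSeq_bound (j : ℕ) : ∃ M : ℝ, 0 ≤ M ∧ ∀ bm bp : ℝ, bm < bp →
    ∀ s ∈ Ioo bm bp, ‖cutoffSeq bm (bp - bm) j s‖ ≤ M * ((bp - bm)⁻¹) ^ j := by
  have hc : Continuous (iteratedDeriv j cutoffProfile) :=
    contDiff_cutoffProfile.continuous_iteratedDeriv j (by exact_mod_cast le_top)
  obtain ⟨M, hM⟩ := isCompact_Icc.exists_bound_of_continuousOn (s := Icc (0 : ℝ) 1)
    hc.continuousOn
  refine ⟨M, (norm_nonneg _).trans (hM 0 (by simp)), ?_⟩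
  intro bm bp hb s hs
  have hb0 : 0 < bp - bm := by linarith
  unfold cutoffSeq
  rw [norm_mul, mul_comm, norm_pow, norm_inv, Real.norm_of_nonneg hb0.le]
  gcongr
  refine hM _ ⟨div_nonneg (by linarith [hs.1]) hb0.le, ?_⟩
  rw [div_le_one hb0]; linarith [hs.2]

/-- The extension of both families of data to the strip. -/
def stripExt (ψ : HorSpace d → ℝ) (bm bp : ℝ) (fm fp : Fin m → HorSpace d → ℝ)
    (x : FullSpace d) : ℝ :=
  sideExt (-1) bp ψ fp x +
    cutoffSeq bm (bp - bm) 0 x.2 * (sideExt 1 bm ψ fm x - sideExt (-1) bp ψ fp x)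

theorem contDiffOn_stripExt (hε : 0 ≤ ε) (h : IsKernel ε ψ)
    {Gm Gp : Fin m → (Fin d → ℕ) → HorSpace d → ℝ}
    (hGm : ∀ k : Fin m, IsJet p (m - 1 - k) (Gm k)) (hGp : ∀ k : Fin m, IsJet p (m - 1 - k) (Gp k))
    (bm bp : ℝ) : ContDiffOn ℝ ∞ (stripExt ψ bm bp (fun k => Gm k 0) (fun k => Gp k 0))
      (strip d bm bp) := by
  have hsm := contDiffOn_sideExt_strip hε h hGm (sideGeom_lower bm bp)
  have hsp := contDiffOn_sideExt_strip hε h hGp (sideGeom_upper bm bp)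
  exact hsp.add (((contDiff_cutoffSeq_zero bm (bp - bm)).comp contDiff_snd).contDiffOn.mul
    (hsm.sub hsp))

/-- The pointwise bound of the derivatives of the glued extension. -/
theorem enorm_wordDeriv_stripExt_rpow_le (hε : 0 ≤ ε) (h : IsKernel ε ψ) (hp : 1 < p)
    (w : List (Fin (d + 1))) : ∃ (ι : Type) (_ : Fintype ι) (v : ι → List (Fin (d + 1)))
      (A : ι → ℝ≥0∞), (∀ r, (v r).length ≤ w.length) ∧ (∀ r, A r ≠ ⊤) ∧
      ∀ Gm Gp : Fin m → (Fin d → ℕ) → HorSpace d → ℝ,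
        (∀ k : Fin m, IsJet p (m - 1 - k) (Gm k)) → (∀ k : Fin m, IsJet p (m - 1 - k) (Gp k)) →
      ∀ bm bp : ℝ, bm < bp → ∀ x ∈ strip d bm bp,
        ‖wordDeriv w (stripExt ψ bm bp (fun k => Gm k 0) (fun k => Gp k 0)) x‖ₑ ^ p ≤
          2 ^ (p - 1) * ‖wordDeriv w (sideExt (-1) bp ψ fun k => Gp k 0) x‖ₑ ^ p +
          ∑ r, A r * (ENNReal.ofReal ((bp - bm) ^ ((((v r).length : ℝ) - w.length) * p)) *
            ‖wordDeriv (v r) (sideExt 1 bm ψ fun k => Gm k 0) x -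
              wordDeriv (v r) (sideExt (-1) bp ψ fun k => Gp k 0) x‖ₑ ^ p) := by
  obtain ⟨ι, hι, j, v, h1, h2⟩ := wordDeriv_vertical_mul w
  choose M hM0 hM using exists_cutoffSeq_bound
  have hp0 : 0 ≤ p := by linarith
  have h2top : (2 : ℝ≥0∞) ^ (p - 1) ≠ ⊤ :=
    ENNReal.rpow_ne_top_of_nonneg (by linarith) (by norm_num)
  refine ⟨ι, hι, v, fun r => 2 ^ (p - 1) * (((Finset.univ : Finset ι).card : ℝ≥0∞) ^ (p - 1) *
    ENNReal.ofReal (M (j r)) ^ p), fun r => by have := h1 r; omega, fun r =>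
    ENNReal.mul_ne_top h2top (ENNReal.mul_ne_top (natCast_rpow_ne_top _ (by linarith))
      (ENNReal.rpow_ne_top_of_nonneg hp0 ENNReal.ofReal_ne_top)), ?_⟩
  intro Gm Gp hGm hGp bm bp hb x hx
  have hb0 : 0 < bp - bm := by linarith
  have hopen := isOpen_strip (d := d) bm bp
  have hsm := contDiffOn_sideExt_strip hε h hGm (sideGeom_lower bm bp)
  have hsp := contDiffOn_sideExt_strip hε h hGp (sideGeom_upper bm bp)
  have hcut : ContDiffOn ℝ ∞ (fun x : FullSpace d => cutoffSeq bm (bp - bm) 0 x.2)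
      (strip d bm bp) :=
    ((contDiff_cutoffSeq_zero bm (bp - bm)).comp contDiff_snd).contDiffOn
  unfold stripExt
  rw [wordDeriv_add hopen hsp (hcut.mul (hsm.sub hsp)) w hx]
  simp only
  rw [h2 _ hopen _ (hsm.sub hsp) _ (hasDerivAt_cutoffSeq bm (bp - bm)) hx]
  refine (ENNReal.rpow_le_rpow (enorm_add_le _ _) hp0).trans
    ((ENNReal.add_rpow_le_two _ _ hp.le).trans ?_)
  rw [mul_add]
  refine add_le_add le_rfl ?_
  refine (mul_le_mul_right (enorm_sum_rpow_le _ _ hp.le) _).trans ?_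
  rw [Finset.mul_sum, Finset.mul_sum]
  refine Finset.sum_le_sum fun r _ => ?_
  rw [mul_assoc, mul_assoc]
  gcongr
  rw [wordDeriv_sub hopen hsm hsp (v r) hx, enorm_mul, ENNReal.mul_rpow_of_nonneg _ _ hp0,
    ← mul_assoc]
  gcongr
  -- In each Leibniz term the letters not in v r fall on the cutoff; their number j r gives the
  -- power of 1/b.
  have e1 : (((v r).length : ℝ) - w.length) * p = -((j r : ℝ) * p) := by
    have := h1 r
    have : (w.length : ℝ) = j r + (v r).length := by exact_mod_cast this.symm
    rw [this]; ring
  rw [e1, Real.rpow_neg hb0.le, Real.rpow_mul hb0.le, Real.rpow_natCast,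
    ← Real.inv_rpow (by positivity), ← inv_pow, ← ENNReal.ofReal_rpow_of_nonneg (by positivity) hp0,
    ← ENNReal.mul_rpow_of_nonneg _ _ hp0, ← ENNReal.ofReal_mul (hM0 _)]
  refine ENNReal.rpow_le_rpow ?_ hp0
  rw [← ofReal_norm]
  exact ENNReal.ofReal_le_ofReal (hM (j r) bm bp hb x.2 hx)

theorem lintegral_wordDeriv_stripExt_le (hε : 0 < ε) (h : IsKernel ε ψ) (hψ : ∫ y, ψ y = 1)
    (hp : 1 < p) (w : List (Fin (d + 1))) (hw : w.length = m) : ∃ C : ℝ≥0∞, C ≠ ⊤ ∧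
      ∀ Gm Gp : Fin m → (Fin d → ℕ) → HorSpace d → ℝ,
        (∀ k : Fin m, IsJet p (m - 1 - k) (Gm k)) → (∀ k : Fin m, IsJet p (m - 1 - k) (Gp k)) →
      ∀ bm bp : ℝ, bm < bp → ∫⁻ x in strip d bm bp,
        ‖wordDeriv w (stripExt ψ bm bp (fun k => Gm k 0) (fun k => Gp k 0)) x‖ₑ ^ p ≤
        C * (mismatchEnergy p Gm Gp (bp - bm) + (dataEnergy p (ε * (bp - bm)) Gm +
          dataEnergy p (ε * (bp - bm)) Gp)) := by
  obtain ⟨ι, hι, v, A, h1, hA, h2⟩ := enorm_wordDeriv_stripExt_rpow_le (m := m) hε.le h hp w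
  obtain ⟨C₁, hC₁, hE⟩ := lintegral_wordDeriv_sideExt_le (m := m) (p := p) hε h hp w hw
  choose C hC hCb using fun r => weighted_lintegral_sub_le (m := m) hε h hψ hp (v r)
    ((h1 r).trans hw.le)
  have h2top : (2 : ℝ≥0∞) ^ (p - 1) ≠ ⊤ :=
    ENNReal.rpow_ne_top_of_nonneg (by linarith) (by norm_num)
  refine ⟨2 ^ (p - 1) * C₁ + ∑ r, A r * C r, ENNReal.add_ne_top.2 ⟨ENNReal.mul_ne_top h2top hC₁,
    ENNReal.sum_ne_top.2 fun r _ => ENNReal.mul_ne_top (hA r) (hC r)⟩, ?_⟩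
  intro Gm Gp hGm hGp bm bp hb
  have hopen := isOpen_strip (d := d) bm bp
  have hsm := contDiffOn_sideExt_strip hε.le h hGm (sideGeom_lower bm bp)
  have hsp := contDiffOn_sideExt_strip hε.le h hGp (sideGeom_upper bm bp)
  have hms := measurableSet_strip (d := d) bm bp
  set X := mismatchEnergy p Gm Gp (bp - bm) + (dataEnergy p (ε * (bp - bm)) Gm +
          dataEnergy p (ε * (bp - bm)) Gp) with hX
  have hm1 : AEMeasurable (fun x => 2 ^ (p - 1) *
      ‖wordDeriv w (sideExt (-1) bp ψ fun k => Gp k 0) x‖ₑ ^ p) (volume.restrict (strip d bm bp)) :=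
    (((wordDeriv_contDiffOn hopen hsp w).continuousOn.aemeasurable hms).enorm.pow_const
      _).const_mul _
  have hm2 : ∀ r, AEMeasurable (fun x => A r *
      (ENNReal.ofReal ((bp - bm) ^ ((((v r).length : ℝ) - w.length) * p)) *
        ‖wordDeriv (v r) (sideExt 1 bm ψ fun k => Gm k 0) x -
              wordDeriv (v r) (sideExt (-1) bp ψ fun k => Gp k 0) x‖ₑ ^ p))
      (volume.restrict (strip d bm bp)) := fun r =>
    (((((wordDeriv_contDiffOn hopen hsm (v r)).continuousOn.sub
      (wordDeriv_contDiffOn hopen hsp (v r)).continuousOn).aemeasurable hms).enorm.pow_const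
        _).const_mul _).const_mul _
  refine (setLIntegral_mono' hms (h2 Gm Gp hGm hGp bm bp hb)).trans ?_
  rw [lintegral_add_left' hm1, lintegral_finsetSum' _ fun r _ => hm2 r,
    lintegral_const_mul' _ _ h2top, add_mul, Finset.sum_mul]
  refine add_le_add ?_ (Finset.sum_le_sum fun r _ => ?_)
  · rw [mul_assoc]
    gcongr
    refine (hE Gp hGp (-1) bp bm bp hb (sideGeom_upper bm bp)).trans ?_
    gcongr
    exact le_add_self.trans le_add_self
  · rw [lintegral_const_mul' _ _ (hA r), lintegral_const_mul' _ _ ENNReal.ofReal_ne_top, mul_assoc,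
      hw]
    exact mul_le_mul' le_rfl (hCb r Gm Gp hGm hGp bm bp hb)

/-- Below order m only local finiteness is at stake, so the difference of the two extensions is
split by the triangle inequality, with no gain from the compatibility of the data. -/
theorem lintegral_wordDeriv_stripExt_lt_top (hε : 0 < ε) (h : IsKernel ε ψ)
    (hp : 1 < p) (w : List (Fin (d + 1))) (hw : w.length < m)
    {Gm Gp : Fin m → (Fin d → ℕ) → HorSpace d → ℝ}
    (hGm : ∀ k : Fin m, IsJet p (m - 1 - k) (Gm k)) (hGp : ∀ k : Fin m, IsJet p (m - 1 - k) (Gp k))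
    {bm bp : ℝ} (hb : bm < bp) (R : ℝ) : ∫⁻ x in strip d bm bp ∩ {x | ‖x.1‖ ≤ R},
      ‖wordDeriv w (stripExt ψ bm bp (fun k => Gm k 0) (fun k => Gp k 0)) x‖ₑ ^ p < ⊤ := by
  obtain ⟨ι, hι, v, A, h1, hA, h2⟩ := enorm_wordDeriv_stripExt_rpow_le (m := m) hε.le h hp w
  have h2top : (2 : ℝ≥0∞) ^ (p - 1) ≠ ⊤ :=
    ENNReal.rpow_ne_top_of_nonneg (by linarith) (by norm_num)
  have hopen := isOpen_strip (d := d) bm bp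
  have hsm := contDiffOn_sideExt_strip hε.le h hGm (sideGeom_lower bm bp)
  have hsp := contDiffOn_sideExt_strip hε.le h hGp (sideGeom_upper bm bp)
  set S := strip d bm bp ∩ {x : FullSpace d | ‖x.1‖ ≤ R} with hS
  have hms : MeasurableSet S :=
    (measurableSet_strip bm bp).inter (measurableSet_le (by fun_prop) (by fun_prop))
  have hcm : ∀ v, AEMeasurable (fun x => ‖wordDeriv v (sideExt 1 bm ψ fun k => Gm k 0) x‖ₑ ^ p)
      (volume.restrict S) := fun v =>
    (((wordDeriv_contDiffOn hopen hsm v).continuousOn.mono inter_subset_left).aemeasurable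
      hms).enorm.pow_const _
  have hcp : ∀ v, AEMeasurable (fun x => ‖wordDeriv v (sideExt (-1) bp ψ fun k => Gp k 0) x‖ₑ ^ p)
      (volume.restrict S) := fun v =>
    (((wordDeriv_contDiffOn hopen hsp v).continuousOn.mono inter_subset_left).aemeasurable
      hms).enorm.pow_const _
  have hfm : ∀ v : List (Fin (d + 1)), v.length < m →
      ∫⁻ x in S, ‖wordDeriv v (sideExt 1 bm ψ fun k => Gm k 0) x‖ₑ ^ p < ⊤ := fun v hv =>
    lintegral_wordDeriv_sideExt_lt_top hε h hp v hv hGm hb (sideGeom_lower bm bp) R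
  have hfp : ∀ v : List (Fin (d + 1)), v.length < m →
      ∫⁻ x in S, ‖wordDeriv v (sideExt (-1) bp ψ fun k => Gp k 0) x‖ₑ ^ p < ⊤ := fun v hv =>
    lintegral_wordDeriv_sideExt_lt_top hε h hp v hv hGp hb (sideGeom_upper bm bp) R
  have hsum : ∀ r, AEMeasurable (fun x => A r *
      (ENNReal.ofReal ((bp - bm) ^ ((((v r).length : ℝ) - w.length) * p)) *
        (2 ^ (p - 1) * (‖wordDeriv (v r) (sideExt 1 bm ψ fun k => Gm k 0) x‖ₑ ^ p +
          ‖wordDeriv (v r) (sideExt (-1) bp ψ fun k => Gp k 0) x‖ₑ ^ p)))) (volume.restrict S) :=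
    fun r => ((((hcm (v r)).add (hcp (v r))).const_mul _).const_mul _).const_mul _
  calc _ ≤ ∫⁻ x in S, (2 ^ (p - 1) * ‖wordDeriv w (sideExt (-1) bp ψ fun k => Gp k 0) x‖ₑ ^ p +
          ∑ r, A r * (ENNReal.ofReal ((bp - bm) ^ ((((v r).length : ℝ) - w.length) * p)) *
            (2 ^ (p - 1) * (‖wordDeriv (v r) (sideExt 1 bm ψ fun k => Gm k 0) x‖ₑ ^ p +
              ‖wordDeriv (v r) (sideExt (-1) bp ψ fun k => Gp k 0) x‖ₑ ^ p)))) := by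
        refine setLIntegral_mono' hms fun x hx => ?_
        refine (h2 Gm Gp hGm hGp bm bp hb x hx.1).trans ?_
        gcongr with r
        exact (ENNReal.rpow_le_rpow enorm_sub_le (by linarith)).trans
          (ENNReal.add_rpow_le_two _ _ hp.le)
    _ < ⊤ := by
        rw [lintegral_add_left' ((hcp w).const_mul _), lintegral_const_mul' _ _ h2top,
          lintegral_finsetSum' _ fun r _ => hsum r]
        refine ENNReal.add_lt_top.2 ⟨ENNReal.mul_lt_top h2top.lt_top (hfp w hw),
          ENNReal.sum_lt_top.2 fun r _ => ?_⟩
        rw [lintegral_const_mul' _ _ (hA r), lintegral_const_mul' _ _ ENNReal.ofReal_ne_top,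
          lintegral_const_mul' _ _ h2top, lintegral_add_left' (hcm _)]
        have hv := (h1 r).trans_lt hw
        exact ENNReal.mul_lt_top (hA r).lt_top (ENNReal.mul_lt_top ENNReal.ofReal_lt_top
          (ENNReal.mul_lt_top h2top.lt_top (ENNReal.add_lt_top.2 ⟨hfm _ hv, hfp _ hv⟩)))

/-- The boundary values of the vertical derivatives of the glued extension. -/
theorem ae_tendsto_wordDeriv_stripExt_lower (hε : 0 < ε) (h : IsKernel ε ψ) (hψ : ∫ y, ψ y = 1)
    (hp : 0 ≤ p) (n : ℕ) (hn : n < m) {Gm Gp : Fin m → (Fin d → ℕ) → HorSpace d → ℝ}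
    (hGm : ∀ k : Fin m, IsJet p (m - 1 - k) (Gm k)) {bm bp : ℝ} (hb : bm < bp) :
    ∀ᵐ x' : HorSpace d, Filter.Tendsto (fun s : ℝ => wordDeriv (List.replicate n (Fin.last d))
      (stripExt ψ bm bp (fun k => Gm k 0) (fun k => Gp k 0)) (x', s)) (nhdsWithin bm (Ioi bm))
      (nhds (Gm ⟨n, hn⟩ 0 x')) := by
  have hl : Filter.Tendsto (fun s => -(1 * bm) + 1 * s) (nhdsWithin bm (Ioi bm))
      (nhdsWithin 0 (Ioi 0)) := by
    refine tendsto_nhdsWithin_iff.2 ⟨?_, ?_⟩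
    · have : Filter.Tendsto (fun s => -(1 * bm) + 1 * s) (nhds bm) (nhds (-(1 * bm) + 1 * bm)) :=
        Continuous.tendsto (by fun_prop) bm
      rw [neg_add_cancel] at this
      exact this.mono_left nhdsWithin_le_nhds
    · filter_upwards [self_mem_nhdsWithin] with s hs
      have : bm < s := hs
      simp only [mem_Ioi]; linarith
  filter_upwards [ae_tendsto_wordDeriv_sideExt hε h hψ hp n hn hGm (sideGeom_lower bm bp) hl]
    with x' hx'
  refine hx'.congr' ?_
  -- The cutoff equals 1 on the whole lower third of the strip, so there all derivatives agree with
  -- those of the lower extension.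
  have hopen := isOpen_strip (d := d) bm (bm + (bp - bm) / 3)
  have heq : EqOn (sideExt 1 bm ψ fun k => Gm k 0)
      (stripExt ψ bm bp (fun k => Gm k 0) (fun k => Gp k 0))
      (strip d bm (bm + (bp - bm) / 3)) := by
    intro x hx
    simp only [stripExt]
    rw [cutoffSeq_zero_eq_one (by linarith) hx.2.le]
    ring
  filter_upwards [Ioo_mem_nhdsGT (show bm < bm + (bp - bm) / 3 by linarith)] with s hs
  exact wordDeriv_congr hopen heq _ hs

theorem ae_tendsto_wordDeriv_stripExt_upper (hε : 0 < ε) (h : IsKernel ε ψ) (hψ : ∫ y, ψ y = 1)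
    (hp : 0 ≤ p) (n : ℕ) (hn : n < m) {Gm Gp : Fin m → (Fin d → ℕ) → HorSpace d → ℝ}
    (hGp : ∀ k : Fin m, IsJet p (m - 1 - k) (Gp k)) {bm bp : ℝ} (hb : bm < bp) :
    ∀ᵐ x' : HorSpace d, Filter.Tendsto (fun s : ℝ => wordDeriv (List.replicate n (Fin.last d))
      (stripExt ψ bm bp (fun k => Gm k 0) (fun k => Gp k 0)) (x', s)) (nhdsWithin bp (Iio bp))
      (nhds (Gp ⟨n, hn⟩ 0 x')) := by
  have hl : Filter.Tendsto (fun s => -((-1) * bp) + (-1) * s) (nhdsWithin bp (Iio bp))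
      (nhdsWithin 0 (Ioi 0)) := by
    refine tendsto_nhdsWithin_iff.2 ⟨?_, ?_⟩
    · have : Filter.Tendsto (fun s => -((-1) * bp) + (-1) * s) (nhds bp)
          (nhds (-((-1) * bp) + (-1) * bp)) := Continuous.tendsto (by fun_prop) bp
      rw [neg_add_cancel] at this
      exact this.mono_left nhdsWithin_le_nhds
    · filter_upwards [self_mem_nhdsWithin] with s hs
      have : s < bp := hs
      simp only [mem_Ioi]; linarith
  filter_upwards [ae_tendsto_wordDeriv_sideExt hε h hψ hp n hn hGp (sideGeom_upper bm bp) hl]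
    with x' hx'
  refine hx'.congr' ?_
  have hopen := isOpen_strip (d := d) (bm + 2 * (bp - bm) / 3) bp
  have heq : EqOn (sideExt (-1) bp ψ fun k => Gp k 0)
      (stripExt ψ bm bp (fun k => Gm k 0) (fun k => Gp k 0))
      (strip d (bm + 2 * (bp - bm) / 3) bp) := by
    intro x hx
    simp only [stripExt]
    rw [cutoffSeq_zero_eq_zero (by linarith) hx.1.le]
    ring
  filter_upwards [Ioo_mem_nhdsLT (show bm + 2 * (bp - bm) / 3 < bp by linarith)] with s hs
  exact wordDeriv_congr hopen heq _ hs

end Glue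

end

noncomputable section

set_option linter.unusedSectionVars false

/-! ### Traces by integration by parts in the strip -/

section Trace

variable {d : ℕ} {p bm bp : ℝ}

instance isAddHaarMeasure_volume_fullSpace :
    (volume : Measure (FullSpace d)).IsAddHaarMeasure :=
  inferInstanceAs ((volume : Measure (HorSpace d)).prod (volume : Measure ℝ)).IsAddHaarMeasure

theorem integrableOn_mul_of_hasCompactSupport {E : Type*} [NormedAddCommGroup E]
    [MeasureSpace E] [OpensMeasurableSpace E] {S : Set E} (hS : MeasurableSet S) {v φ : E → ℝ}
    (hv : ∀ R : ℝ, IntegrableOn v (S ∩ Metric.closedBall 0 R)) (hφ : Continuous φ)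
    (hc : HasCompactSupport φ) : IntegrableOn (fun x => v x * φ x) S := by
  obtain ⟨R, hR⟩ := hc.isCompact.isBounded.subset_closedBall 0
  obtain ⟨M, hM⟩ := hc.exists_bound_of_continuous hφ
  have h1 : IntegrableOn (fun x => v x * φ x) (S ∩ Metric.closedBall 0 R) :=
    (hv R).mul_bdd hφ.aestronglyMeasurable (Filter.Eventually.of_forall hM)
  refine h1.of_forall_sdiff_eq_zero hS fun x hx => ?_
  have : x ∉ tsupport φ := fun hx' => hx.2 ⟨hx.1, hR hx'⟩
  rw [image_eq_zero_of_notMem_tsupport this, mul_zero]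

theorem HasCompactSupport.comp_mk_left {ψ : FullSpace d → ℝ} (hc : HasCompactSupport ψ) (s : ℝ) :
    HasCompactSupport fun x' : HorSpace d => ψ (x', s) := by
  obtain ⟨R, hR⟩ := hc.isCompact.isBounded.subset_closedBall 0
  refine HasCompactSupport.intro (isCompact_closedBall (0 : HorSpace d) R) fun x' hx' => ?_
  refine image_eq_zero_of_notMem_tsupport fun h => hx' ?_
  have h1 := hR h
  rw [mem_closedBall_zero_iff] at h1 ⊢
  exact (norm_fst_le (x', s)).trans h1

theorem hasDerivAt_comp_mk_right {v : FullSpace d → ℝ} {x' : HorSpace d} {s : ℝ}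
    (hv : DifferentiableAt ℝ v (x', s)) :
    HasDerivAt (fun s => v (x', s)) (fderiv ℝ v (x', s) (fBasis d (Fin.last d))) s := by
  rw [fBasis_last]
  have h1 : HasDerivAt (fun s : ℝ => (x', s)) ((0 : HorSpace d), (1 : ℝ)) s :=
    (hasDerivAt_const s x').prodMk (hasDerivAt_id s)
  exact hv.hasFDerivAt.comp_hasDerivAt s h1

theorem hasFDerivAt_comp_mk_left {v : FullSpace d → ℝ} {x' : HorSpace d} {s : ℝ}
    (hv : DifferentiableAt ℝ v (x', s)) :
    HasFDerivAt (fun x' => v (x', s))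
      ((fderiv ℝ v (x', s)).comp (ContinuousLinearMap.inl ℝ (HorSpace d) ℝ)) x' := by
  have h1 : HasFDerivAt (fun x' : HorSpace d => (x', s))
      (ContinuousLinearMap.inl ℝ (HorSpace d) ℝ) x' := hasFDerivAt_prodMk_left x' s
  exact hv.hasFDerivAt.comp x' h1

theorem MemLpLoc.locallyIntegrable (hp : 1 ≤ p) {g : HorSpace d → ℝ} (hg : MemLpLoc p g) :
    LocallyIntegrable g :=
  locallyIntegrable_iff.2 fun K hK => by
    have : IsFiniteMeasure (volume.restrict K) := isFiniteMeasure_restrict.2 hK.measure_lt_top.ne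
    exact (hg K hK).integrable (by simpa using hp)

/-- The divergence theorem in the strip for the vertical direction. -/
theorem setIntegral_strip_vertical (hb : bm < bp) {v ψ : FullSpace d → ℝ} {gm gp : HorSpace d → ℝ}
    (hv : ContDiffOn ℝ ∞ v (strip d bm bp)) (hψ : ContDiff ℝ 1 ψ) (hc : HasCompactSupport ψ)
    (hgm : LocallyIntegrable gm) (hgp : LocallyIntegrable gp)
    (hm : ∀ᵐ x', Filter.Tendsto (fun s => v (x', s)) (nhdsWithin bm (Ioi bm)) (nhds (gm x')))
    (hp : ∀ᵐ x', Filter.Tendsto (fun s => v (x', s)) (nhdsWithin bp (Iio bp)) (nhds (gp x')))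
    (hint : IntegrableOn (fun x => v x * fderiv ℝ ψ x (fBasis d (Fin.last d)) +
      fderiv ℝ v x (fBasis d (Fin.last d)) * ψ x) (strip d bm bp)) :
    ∫ x in strip d bm bp, (v x * fderiv ℝ ψ x (fBasis d (Fin.last d)) +
      fderiv ℝ v x (fBasis d (Fin.last d)) * ψ x) =
      (∫ x', ψ (x', bp) * gp x') - ∫ x', ψ (x', bm) * gm x' := by
  have hi : ∀ (s : ℝ) {g : HorSpace d → ℝ}, LocallyIntegrable g →
      Integrable fun x' => ψ (x', s) * g x' := fun s g hg =>
    hg.integrable_smul_left_of_hasCompactSupport (hψ.continuous.comp (by fun_prop))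
      (hc.comp_mk_left s)
  unfold IntegrableOn at hint
  rw [volume_restrict_strip] at hint ⊢
  rw [integral_prod _ hint, ← integral_sub (hi bp hgp) (hi bm hgm)]
  refine integral_congr_ae ?_
  filter_upwards [hm, hp, hint.prod_right_ae] with x' h1 h2 h3
  have hψc : ∀ s, Filter.Tendsto (fun s => ψ (x', s)) (nhds s) (nhds (ψ (x', s))) := fun s =>
    (hψ.continuous.comp (by fun_prop : Continuous fun s : ℝ => (x', s))).tendsto s
  -- On almost every vertical line the derivative of vψ is integrable by Fubini and vψ has limits at
  -- both ends. This suffices for the fundamental theorem of calculus.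
  have key := intervalIntegral.integral_eq_sub_of_hasDerivAt_of_tendsto
    (f := fun s => v (x', s) * ψ (x', s)) hb
    (f' := fun s => v (x', s) * fderiv ℝ ψ (x', s) (fBasis d (Fin.last d)) +
      fderiv ℝ v (x', s) (fBasis d (Fin.last d)) * ψ (x', s))
    (fun s hs => ((hasDerivAt_comp_mk_right (hv.differentiableAt_of_isOpen
      (isOpen_strip bm bp) hs)).mul (hasDerivAt_comp_mk_right
        (hψ.differentiable (by simp) (x', s)))).congr_deriv (add_comm _ _))
    ((intervalIntegrable_iff_integrableOn_Ioo_of_le hb.le).2 h3)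
    (h1.mul ((hψc bm).mono_left nhdsWithin_le_nhds))
    (h2.mul ((hψc bp).mono_left nhdsWithin_le_nhds))
  rw [intervalIntegral.integral_of_le hb.le, integral_Ioc_eq_integral_Ioo] at key
  rw [key]; ring

/-- The divergence theorem in the strip for the horizontal directions. -/
theorem setIntegral_strip_horizontal {v ψ : FullSpace d → ℝ}
    (hv : ContDiffOn ℝ ∞ v (strip d bm bp)) (hψ : ContDiff ℝ 1 ψ) (hc : HasCompactSupport ψ)
    (j : Fin d) (hint : IntegrableOn (fun x => v x * fderiv ℝ ψ x (fBasis d j.castSucc) +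
      fderiv ℝ v x (fBasis d j.castSucc) * ψ x) (strip d bm bp)) :
    ∫ x in strip d bm bp, (v x * fderiv ℝ ψ x (fBasis d j.castSucc) +
      fderiv ℝ v x (fBasis d j.castSucc) * ψ x) = 0 := by
  unfold IntegrableOn at hint
  rw [volume_restrict_strip] at hint ⊢
  rw [integral_prod_symm _ hint]
  refine (setIntegral_congr_fun measurableSet_Ioo fun s hs => ?_).trans (integral_zero _ _)
  have hmem : ∀ x' : HorSpace d, (x', s) ∈ strip d bm bp := fun _ => hs
  have hmk : Continuous fun x' : HorSpace d => (x', s) := by fun_prop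
  have hvd : ∀ x', DifferentiableAt ℝ v (x', s) := fun x' =>
    hv.differentiableAt_of_isOpen (isOpen_strip bm bp) (hmem x')
  have hψd : ∀ x', DifferentiableAt ℝ ψ (x', s) := fun x' => hψ.differentiable (by simp) _
  have hvc : Continuous fun x' : HorSpace d => v (x', s) :=
    hv.continuousOn.comp_continuous hmk hmem
  have hv'c : Continuous fun x' : HorSpace d => fderiv ℝ v (x', s) (fBasis d j.castSucc) :=
    (hv.fderiv_apply_const (isOpen_strip bm bp) _).continuousOn.comp_continuous hmk hmem
  have hψc : Continuous fun x' : HorSpace d => ψ (x', s) := hψ.continuous.comp hmk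
  have hψ'c : Continuous fun x' : HorSpace d => fderiv ℝ ψ (x', s) (fBasis d j.castSucc) :=
    ((hψ.continuous_fderiv (by simp)).clm_apply continuous_const).comp hmk
  have e1 : ∀ {f : FullSpace d → ℝ}, (∀ x', DifferentiableAt ℝ f (x', s)) → ∀ x',
      fderiv ℝ (fun x' => f (x', s)) x' (hBasis d j) = fderiv ℝ f (x', s) (fBasis d j.castSucc) :=
    fun hf x' => by
      rw [(hasFDerivAt_comp_mk_left (hf x')).fderiv, fBasis_castSucc]; simp
  have hcs := hc.comp_mk_left s
  have hcs' : HasCompactSupport fun x' : HorSpace d => fderiv ℝ ψ (x', s) (fBasis d j.castSucc) :=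
    (hc.fderiv_apply ℝ _).comp_mk_left s
  have i1 : Integrable fun x' : HorSpace d =>
      fderiv ℝ v (x', s) (fBasis d j.castSucc) * ψ (x', s) :=
    (hv'c.mul hψc).integrable_of_hasCompactSupport hcs.mul_left
  have i2 : Integrable fun x' : HorSpace d =>
      v (x', s) * fderiv ℝ ψ (x', s) (fBasis d j.castSucc) :=
    (hvc.mul hψ'c).integrable_of_hasCompactSupport hcs'.mul_left
  -- On a slice of constant height v is smooth on all of ℝ^d and ψ has compact support, so no
  -- boundary term appears.
  have key := integral_mul_fderiv_eq_neg_fderiv_mul_of_integrable (𝕜 := ℝ)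
    (f := fun x' : HorSpace d => v (x', s)) (g := fun x' => ψ (x', s)) (v := hBasis d j)
    (μ := volume) (by simpa only [e1 hvd] using i1) (by simpa only [e1 hψd] using i2)
    ((hvc.mul hψc).integrable_of_hasCompactSupport hcs.mul_left)
    (fun x' _ => (hasFDerivAt_comp_mk_left (hvd x')).differentiableAt)
    (fun x' _ => (hasFDerivAt_comp_mk_left (hψd x')).differentiableAt)
  simp only [e1 hvd, e1 hψd] at key
  rw [integral_add i2 i1, key]; ring

/-- Limits along almost every vertical line are traces: the divergence identity follows from the
fundamental theorem of calculus in the vertical direction and slicewise integration by parts in the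
others. Local L^p bounds make all integrals converge against compactly supported test functions. -/
theorem hasTrace_of_contDiffOn (hp : 1 ≤ p) (hb : bm < bp) {v : FullSpace d → ℝ}
    {gm gp : HorSpace d → ℝ} (hv : ContDiffOn ℝ ∞ v (strip d bm bp))
    (hL : ∀ R : ℝ, MemLp v (ENNReal.ofReal p)
      (volume.restrict (strip d bm bp ∩ Metric.closedBall 0 R)))
    (hL' : ∀ i, ∀ R : ℝ, MemLp (fun x => fderiv ℝ v x (fBasis d i)) (ENNReal.ofReal p)
      (volume.restrict (strip d bm bp ∩ Metric.closedBall 0 R)))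
    (hgm : MemLpLoc p gm) (hgp : MemLpLoc p gp)
    (htm : ∀ᵐ x', Filter.Tendsto (fun s => v (x', s)) (nhdsWithin bm (Ioi bm)) (nhds (gm x')))
    (htp : ∀ᵐ x', Filter.Tendsto (fun s => v (x', s)) (nhdsWithin bp (Iio bp)) (nhds (gp x'))) :
    HasTrace bm bp p v gm gp := by
  have hopen := isOpen_strip (d := d) bm bp
  have hms := measurableSet_strip (d := d) bm bp
  have hInt : ∀ {f : FullSpace d → ℝ}, (∀ R : ℝ, MemLp f (ENNReal.ofReal p)
      (volume.restrict (strip d bm bp ∩ Metric.closedBall 0 R))) →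
      ∀ R : ℝ, IntegrableOn f (strip d bm bp ∩ Metric.closedBall 0 R) := fun hf R => by
    have : IsFiniteMeasure (volume.restrict (strip d bm bp ∩ Metric.closedBall 0 R)) :=
      isFiniteMeasure_restrict.2 ((measure_mono inter_subset_right).trans_lt
        (isCompact_closedBall _ _).measure_lt_top).ne
    exact (hf R).integrable (by simpa using hp)
  refine ⟨hL, hgm, hgp, fun i => ⟨fun x => fderiv ℝ v x (fBasis d i), ?_, hL' i, ?_⟩⟩
  · have h1 := hasWeakPartial_iterDirDeriv (fBasis d) hopen (Pi.single i 1) hv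
    have hperm : [fBasis d i].Perm (dirList (fBasis d) (Pi.single i 1)) := by
      have h2 := dirList_add_single_perm (fBasis d) 0 i
      rw [zero_add] at h2
      refine List.Perm.trans ?_ h2
      have : dirList (fBasis d) 0 = [] := List.length_eq_zero_iff.1 (by simp [length_dirList])
      rw [this]
    have h2 := iterDirDeriv_perm hopen hv hperm
    refine ⟨h1.1, ?_, fun φ hφ hc hs => ?_⟩
    · exact (hv.fderiv_apply_const hopen _).continuousOn.locallyIntegrableOn hms
    · rw [h1.2.2 φ hφ hc hs]
      congr 1
      refine setIntegral_congr_fun hms fun x hx => ?_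
      rw [← h2 hx]; rfl
  · intro ψ hψ hc
    have hψ' : Continuous fun x => fderiv ℝ ψ x (fBasis d i) :=
      (hψ.continuous_fderiv (by simp)).clm_apply continuous_const
    have i1 := integrableOn_mul_of_hasCompactSupport hms (hInt hL) hψ' (hc.fderiv_apply ℝ _)
    have i2 := integrableOn_mul_of_hasCompactSupport hms (hInt (hL' i)) hψ.continuous hc
    have hsum := i1.add i2
    have key : ∫ x in strip d bm bp, (v x * fderiv ℝ ψ x (fBasis d i) +
        fderiv ℝ v x (fBasis d i) * ψ x) = (if i = Fin.last d then 1 else 0) *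
            ((∫ x' : HorSpace d, ψ (x', bp) * gp x') - ∫ x' : HorSpace d, ψ (x', bm) * gm x') := by
      induction i using Fin.lastCases with
      | last =>
        rw [if_pos rfl, one_mul]
        exact setIntegral_strip_vertical hb hv hψ hc (hgm.locallyIntegrable hp)
          (hgp.locallyIntegrable hp) htm htp hsum
      | cast j =>
        rw [if_neg (Fin.castSucc_lt_last j).ne, zero_mul]
        exact setIntegral_strip_horizontal hv hψ hc j hsum
    rw [integral_add i1 i2] at key
    rw [← key]
    simp only [mul_comm (ψ _)]
    ring

end Trace

end

noncomputable section

set_option linter.unusedSectionVars false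

/-! ### Measurable jets of Sobolev data; comparison of the energies -/

section Data

variable {d m s : ℕ} {p : ℝ} {f : HorSpace d → ℝ}

open Classical in
/-- A measurable representative of the weak partial derivative `∂^γ f`. -/
def jetRep (f : HorSpace d → ℝ) (γ : Fin d → ℕ) : HorSpace d → ℝ :=
  if h : AEMeasurable (hPartial γ f) volume then h.mk (hPartial γ f) else 0

theorem measurable_jetRep (f : HorSpace d → ℝ) (γ : Fin d → ℕ) : Measurable (jetRep f γ) := by
  unfold jetRep
  split_ifs with h
  · exact h.measurable_mk
  · exact measurable_const

theorem MemSobolevLoc.hasWeakPartial_hPartial (hf : MemSobolevLoc (hBasis d) s p f)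
    {γ : Fin d → ℕ} (hγ : ∑ i, γ i ≤ s) :
    HasWeakPartial (hBasis d) univ γ f (hPartial γ f) := by
  obtain ⟨g, hg, -⟩ := hf.2 _ hγ γ (mem_multiIdx.2 rfl)
  exact hg.weakPartial

theorem MemSobolevLoc.jetRep_ae_eq (hf : MemSobolevLoc (hBasis d) s p f)
    {γ : Fin d → ℕ} (hγ : ∑ i, γ i ≤ s) : jetRep f γ =ᵐ[volume] hPartial γ f := by
  have h : AEMeasurable (hPartial γ f) volume := by
    have h1 := (hf.hasWeakPartial_hPartial hγ).2.1.aestronglyMeasurable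
    rw [Measure.restrict_univ] at h1
    exact h1.aemeasurable
  rw [jetRep, dif_pos h]
  exact h.ae_eq_mk.symm

theorem MemSobolevLoc.hasWeakPartial_jetRep (hf : MemSobolevLoc (hBasis d) s p f)
    {γ : Fin d → ℕ} (hγ : ∑ i, γ i ≤ s) :
    HasWeakPartial (hBasis d) univ γ f (jetRep f γ) := by
  obtain ⟨h1, h2, h3⟩ := hf.hasWeakPartial_hPartial hγ
  have hae := hf.jetRep_ae_eq hγ
  refine ⟨h1, ?_, fun φ hφ hc hs => ?_⟩
  · rw [locallyIntegrableOn_univ] at h2 ⊢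
    exact h2.congr hae.symm
  · rw [h3 φ hφ hc hs, setIntegral_univ, setIntegral_univ]
    congr 1
    refine integral_congr_ae ?_
    filter_upwards [hae] with x hx
    rw [hx]

theorem MemSobolevLoc.memLpLoc_jetRep (hf : MemSobolevLoc (hBasis d) s p f)
    {γ : Fin d → ℕ} (hγ : ∑ i, γ i ≤ s) : MemLpLoc p (jetRep f γ) := by
  obtain ⟨g, hg, hgp⟩ := hf.2 _ hγ γ (mem_multiIdx.2 rfl)
  have h1 := (hf.hasWeakPartial_jetRep hγ).ae_eq isOpen_univ hg
  rw [Measure.restrict_univ] at h1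
  exact fun K hK => (memLp_congr_ae (ae_restrict_of_ae h1)).2 (hgp K hK)

theorem hasWeakPartial_zero (hf : LocallyIntegrable f) :
    HasWeakPartial (hBasis d) univ 0 f f := by
  have : dirList (hBasis d) 0 = [] := List.length_eq_zero_iff.1 (by simp [length_dirList])
  refine ⟨hf.locallyIntegrableOn _, hf.locallyIntegrableOn _, fun φ _ _ _ => ?_⟩
  simp [this, iterDirDeriv]

theorem MemSobolevLoc.jetRep_zero_ae_eq (hp : 1 ≤ p) (hf : MemSobolevLoc (hBasis d) s p f) :
    jetRep f 0 =ᵐ[volume] f := by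
  have := (hf.hasWeakPartial_jetRep (γ := 0) (by simp)).ae_eq isOpen_univ
    (hasWeakPartial_zero (hf.1.locallyIntegrable hp))
  rwa [Measure.restrict_univ] at this

theorem MemLp.lintegral_enorm_rpow_lt_top {α : Type*} [MeasurableSpace α] {μ : Measure α}
    {g : α → ℝ} (hp : 0 < p) (hg : MemLp g (ENNReal.ofReal p) μ) : ∫⁻ x, ‖g x‖ₑ ^ p ∂μ < ⊤ := by
  have := lintegral_rpow_enorm_lt_top_of_eLpNorm_lt_top (by simpa using hp) ENNReal.ofReal_ne_top
    hg.2
  rwa [ENNReal.toReal_ofReal hp.le] at this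

theorem memLp_of_lintegral_enorm_rpow_lt_top {α : Type*} [MeasurableSpace α] {μ : Measure α}
    {g : α → ℝ} (hp : 0 < p) (hg : AEStronglyMeasurable g μ) (h : ∫⁻ x, ‖g x‖ₑ ^ p ∂μ < ⊤) :
    MemLp g (ENNReal.ofReal p) μ := by
  refine ⟨hg, (eLpNorm_lt_top_iff_lintegral_rpow_enorm_lt_top (by simpa using hp)
    ENNReal.ofReal_ne_top).2 ?_⟩
  rwa [ENNReal.toReal_ofReal hp.le]

/-- The estimates for mollifications use Tonelli with genuinely measurable functions. The
representatives `jetRep` provide them and are still weak derivatives of one another, since integrals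
do not see null sets. -/
theorem MemSobolevLoc.isJet (hp : 1 ≤ p) (hf : MemSobolevLoc (hBasis d) s p f) :
    IsJet p s (jetRep f) where
  measurable γ _ := measurable_jetRep f γ
  locallyIntegrable _ hγ := (hf.memLpLoc_jetRep hγ).locallyIntegrable hp
  lintegral_lt_top _ hγ R :=
    MemLp.lintegral_enorm_rpow_lt_top (by linarith)
      (hf.memLpLoc_jetRep hγ _ (isCompact_closedBall 0 R))
  isWeakDir γ hγ r := by
    refine (hf.hasWeakPartial_jetRep (γ := γ) (by omega)).isWeakDir
      (hf.hasWeakPartial_jetRep (γ := γ + Pi.single r 1) ?_)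
    rw [sum_add_single]; exact hγ

theorem enorm_le_ofReal_sqrt_sum {ι : Type*} (t : Finset ι) (a : ι → ℝ) {i : ι} (hi : i ∈ t) :
    ‖a i‖ₑ ≤ ENNReal.ofReal (Real.sqrt (∑ j ∈ t, a j ^ 2)) := by
  rw [← ofReal_norm]
  exact ENNReal.ofReal_le_ofReal (Real.abs_le_sqrt
    (Finset.single_le_sum (f := fun j => a j ^ 2) (fun j _ => sq_nonneg _) hi))

theorem ofReal_sqrt_sum_le {ι : Type*} (t : Finset ι) (a : ι → ℝ) :
    ENNReal.ofReal (Real.sqrt (∑ j ∈ t, a j ^ 2)) ≤ ∑ j ∈ t, ‖a j‖ₑ := by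
  have h1 : Real.sqrt (∑ j ∈ t, a j ^ 2) ≤ ∑ j ∈ t, |a j| := by
    rw [Real.sqrt_le_left (Finset.sum_nonneg fun j _ => abs_nonneg _)]
    simp only [← sq_abs (a _)]
    exact Finset.sum_sq_le_sq_sum_of_nonneg fun j _ => abs_nonneg _
  refine (ENNReal.ofReal_le_ofReal h1).trans ?_
  rw [ENNReal.ofReal_sum_of_nonneg fun j _ => abs_nonneg _]
  exact (Finset.sum_congr rfl fun j _ => by rw [← Real.norm_eq_abs, ofReal_norm]).le

/-- One component is at most the Euclidean norm of the whole vector, and the ball of radius r lies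
in that of radius a. -/
theorem MemSobolevLoc.diffEnergy_le_screenedEnergy (hp : 0 ≤ p)
    (hf : MemSobolevLoc (hBasis d) s p f) {γ : Fin d → ℕ} (hγ : γ ∈ multiIdx d s) {r a : ℝ}
    (hr : r ≤ a) : diffEnergy p r (jetRep f γ) ≤ screenedEnergy p a s f := by
  have hae := hf.jetRep_ae_eq (mem_multiIdx.1 hγ).le
  unfold diffEnergy screenedEnergy
  refine lintegral_mono_ae ?_
  filter_upwards [hae] with x hx
  refine le_trans ?_ (lintegral_mono_set (Metric.ball_subset_ball hr))
  refine lintegral_mono_ae (ae_restrict_of_ae ?_)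
  -- Translation by x preserves null sets, so the representative may also be replaced at x + h for
  -- almost every h.
  filter_upwards [(measurePreserving_add_left volume x).quasiMeasurePreserving.ae hae] with h hh
  rw [hh, hx, div_eq_mul_inv, ENNReal.ofReal_mul (by positivity)]
  gcongr
  rw [← ENNReal.ofReal_rpow_of_nonneg (Real.sqrt_nonneg _) hp]
  exact ENNReal.rpow_le_rpow (enorm_le_ofReal_sqrt_sum (multiIdx d s)
    (fun β => hPartial β f (x + h) - hPartial β f x) hγ) hp

theorem dataEnergy_jetRep_le (hp : 0 ≤ p) {f : Fin m → HorSpace d → ℝ}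
    (hf : ∀ k : Fin m, MemSobolevLoc (hBasis d) (m - 1 - k) p (f k)) {r a : ℝ} (hr : r ≤ a) :
    dataEnergy p r (fun k => jetRep (f k)) ≤
      (∑ k : Fin m, ((multiIdx d (m - 1 - k)).card : ℝ≥0∞)) *
        ∑ k : Fin m, screenedEnergy p a (m - 1 - k) (f k) := by
  unfold dataEnergy
  rw [Finset.sum_mul]
  refine Finset.sum_le_sum fun k _ => ?_
  refine (Finset.sum_le_card_nsmul _ _ _ fun γ hγ =>
    (hf k).diffEnergy_le_screenedEnergy hp hγ hr).trans ?_
  rw [nsmul_eq_mul]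
  exact mul_le_mul' le_rfl (Finset.single_le_sum
    (f := fun k : Fin m => screenedEnergy p a (m - 1 - k) (f k)) (fun _ _ => zero_le)
    (Finset.mem_univ k))

theorem dataAt_jetRep_ae_eq {f : Fin m → HorSpace d → ℝ}
    (hf : ∀ k : Fin m, MemSobolevLoc (hBasis d) (m - 1 - k) p (f k)) (β : Fin d → ℕ) :
    ∀ᵐ x, ∀ k : Fin m, ∑ i, β i ≤ m - 1 - k →
      dataAt (fun k => jetRep (f k)) k β x = hPartial β (f k) x := by
  refine ae_all_iff.2 fun k => ?_
  by_cases h : ∑ i, β i ≤ m - 1 - k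
  · filter_upwards [(hf k).jetRep_ae_eq h] with x hx _
    simp [dataAt, hx]
  · exact Filter.Eventually.of_forall fun x h' => absurd h' h

/-- Writing (-b/2)^k as (-1)^k (b/2)^k in the upper Taylor coefficients produces the alternating
signs of Q. -/
theorem midMismatch_jetRep_ae_eq {fm fp : Fin m → HorSpace d → ℝ}
    (hfm : ∀ k : Fin m, MemSobolevLoc (hBasis d) (m - 1 - k) p (fm k))
    (hfp : ∀ k : Fin m, MemSobolevLoc (hBasis d) (m - 1 - k) p (fp k)) (b : ℝ) {i : ℕ} (n : ℕ)
    {β : Fin d → ℕ} (hβ : β ∈ multiIdx d i) :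
    midMismatch (fun k => jetRep (fm k)) (fun k => jetRep (fp k)) b i n β =ᵐ[volume]
      Qcomp b i n fm fp β := by
  filter_upwards [dataAt_jetRep_ae_eq hfm β, dataAt_jetRep_ae_eq hfp β] with x h1 h2
  unfold midMismatch Qcomp
  rw [← Fin.sum_univ_eq_sum_range (fun j =>
    dataAt (fun k => jetRep (fp k)) (j + n) β x * (-(b / 2)) ^ j / j.factorial -
    dataAt (fun k => jetRep (fm k)) (j + n) β x * (b / 2) ^ j / j.factorial)]
  refine Finset.sum_congr rfl fun k _ => ?_
  have hk := k.isLt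
  rw [mem_multiIdx] at hβ
  have e1 := h1 ⟨k + n, by omega⟩ (by simp only; omega)
  have e2 := h2 ⟨k + n, by omega⟩ (by simp only; omega)
  simp only at e1 e2
  rw [e1, e2, neg_pow (b / 2), pow_succ]
  have h3 : ((-1 : ℝ) ^ (k : ℕ)) * (-1) ^ (k : ℕ) = 1 := by rw [← mul_pow]; norm_num
  linear_combination (hPartial β (fm ⟨k + n, by omega⟩) x * (b / 2) ^ (k : ℕ) /
    ((k : ℕ).factorial : ℝ)) * h3

theorem lintegral_midMismatch_jetRep_le (hp : 0 ≤ p) {fm fp : Fin m → HorSpace d → ℝ}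
    (hfm : ∀ k : Fin m, MemSobolevLoc (hBasis d) (m - 1 - k) p (fm k))
    (hfp : ∀ k : Fin m, MemSobolevLoc (hBasis d) (m - 1 - k) p (fp k)) (b : ℝ) {i : ℕ} (n : ℕ)
    {β : Fin d → ℕ} (hβ : β ∈ multiIdx d i) :
    ∫⁻ x, ‖midMismatch (fun k => jetRep (fm k)) (fun k => jetRep (fp k)) b i n β x‖ₑ ^ p ≤
      Qenergy p b i n fm fp := by
  refine lintegral_mono_ae ?_
  filter_upwards [midMismatch_jetRep_ae_eq hfm hfp b n hβ] with x hx
  rw [hx, ← ENNReal.ofReal_rpow_of_nonneg (Real.sqrt_nonneg _) hp]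
  exact ENNReal.rpow_le_rpow (enorm_le_ofReal_sqrt_sum (multiIdx d i)
    (fun β => Qcomp b i n fm fp β x) hβ) hp

theorem mismatchEnergy_jetRep_le (hp : 0 ≤ p) {fm fp : Fin m → HorSpace d → ℝ}
    (hfm : ∀ k : Fin m, MemSobolevLoc (hBasis d) (m - 1 - k) p (fm k))
    (hfp : ∀ k : Fin m, MemSobolevLoc (hBasis d) (m - 1 - k) p (fp k)) (b : ℝ) :
    mismatchEnergy p (fun k => jetRep (fm k)) (fun k => jetRep (fp k)) b ≤
      (∑ i ∈ Finset.range m, ((multiIdx d i).card : ℝ≥0∞)) *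
        ∑ n ∈ Finset.range m, ∑ i ∈ Finset.range (m - n),
          ENNReal.ofReal (b ^ (((n : ℝ) + i - m) * p + 1)) * Qenergy p b i n fm fp := by
  unfold mismatchEnergy
  simp only [Finset.mul_sum]
  refine Finset.sum_le_sum fun n _ => Finset.sum_le_sum fun i hi => ?_
  have hi' := Finset.mem_range.1 hi
  rw [← Finset.mul_sum, mul_left_comm]
  refine mul_le_mul' le_rfl ((Finset.sum_le_card_nsmul _ _ _ fun β hβ =>
    lintegral_midMismatch_jetRep_le hp hfm hfp b n hβ).trans ?_)
  rw [nsmul_eq_mul]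
  exact mul_le_mul' (Finset.single_le_sum (f := fun i => ((multiIdx d i).card : ℝ≥0∞))
    (fun _ _ => zero_le) (Finset.mem_range.2 (by omega))) le_rfl

end Data

/-! ### From explicit weak derivatives to the energy of the gradient -/

section Sobolev

theorem HasWeakPartial.congr_left {E : Type*} [NormedAddCommGroup E] [NormedSpace ℝ E]
    [MeasureSpace E] [OpensMeasurableSpace E] {n : ℕ} {e : Fin n → E} {U : Set E}
    (hU : MeasurableSet U)
    {α : Fin n → ℕ} {f f' g : E → ℝ} (h : HasWeakPartial e U α f g) (hf : EqOn f' f U) :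
    HasWeakPartial e U α f' g := by
  obtain ⟨h1, h2, h3⟩ := h
  refine ⟨fun x hx => ?_, h2, fun φ hφ hc hs => ?_⟩
  · obtain ⟨t, ht, hint⟩ := h1 x hx
    obtain ⟨o, ho, hxo, hot⟩ := mem_nhdsWithin.1 ht
    exact ⟨o ∩ U, mem_nhdsWithin.2 ⟨o, ho, hxo, subset_rfl⟩,
      (hint.mono_set hot).congr_fun (fun y hy => (hf hy.2).symm) (ho.measurableSet.inter hU)⟩
  · rw [← h3 φ hφ hc hs]
    refine setIntegral_congr_fun hU fun x hx => ?_
    simp only [hf hx]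

/-- By uniqueness the chosen `weakPartial` equals the given derivative almost everywhere, and the
Euclidean norm is at most the sum of the absolute values of the components. -/
theorem gradEnergy_le {E : Type*} [NormedAddCommGroup E] [NormedSpace ℝ E]
    [FiniteDimensional ℝ E] [MeasureSpace E] [BorelSpace E] [(volume : Measure E).IsAddHaarMeasure]
    {n : ℕ} {e : Fin n → E} {U : Set E} (hU : IsOpen U) {m : ℕ} {p : ℝ} (hp : 1 ≤ p)
    {u : E → ℝ} {g : (Fin n → ℕ) → E → ℝ}
    (h : ∀ α ∈ multiIdx n m, HasWeakPartial e U α u (g α)) :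
    gradEnergy e U m p u ≤ ((multiIdx n m).card : ℝ≥0∞) ^ (p - 1) *
      ∑ α ∈ multiIdx n m, ∫⁻ x in U, ‖g α x‖ₑ ^ p := by
  have hae : ∀ᵐ x ∂(volume.restrict U), ∀ α ∈ multiIdx n m, weakPartial e U α u x = g α x := by
    refine (Finset.eventually_all _).2 fun α hα => ?_
    exact (h α hα).weakPartial.ae_eq hU (h α hα)
  rw [← lintegral_finsetSum' _ fun α hα =>
      ((h α hα).2.1.aestronglyMeasurable.enorm.pow_const p),
    ← lintegral_const_mul' _ _ (natCast_rpow_ne_top _ (by linarith))]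
  unfold gradEnergy
  refine lintegral_mono_ae ?_
  filter_upwards [hae] with x hx
  rw [← ENNReal.ofReal_rpow_of_nonneg (Real.sqrt_nonneg _) (by linarith)]
  refine (ENNReal.rpow_le_rpow (ofReal_sqrt_sum_le _ _) (by linarith)).trans
    ((ENNReal.rpow_sum_le_const_mul_sum_rpow _ _ hp).trans ?_)
  refine mul_le_mul' le_rfl (Finset.sum_le_sum fun α hα => ?_)
  rw [hx α hα]

end Sobolev

end

noncomputable section

set_option linter.unusedSectionVars false

/-! ### Sobolev membership, traces, energy bound and linearity -/

section Main

variable {d m : ℕ} {ε p : ℝ} {ψ : HorSpace d → ℝ}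

theorem memLp_wordDeriv_stripExt (hε : 0 < ε) (h : IsKernel ε ψ) (hp : 1 < p)
    {Gm Gp : Fin m → (Fin d → ℕ) → HorSpace d → ℝ}
    (hGm : ∀ k : Fin m, IsJet p (m - 1 - k) (Gm k)) (hGp : ∀ k : Fin m, IsJet p (m - 1 - k) (Gp k))
    {bm bp : ℝ} (hb : bm < bp) (w : List (Fin (d + 1)))
    (hw : w.length < m ∨ ∫⁻ x in strip d bm bp,
      ‖wordDeriv w (stripExt ψ bm bp (fun k => Gm k 0) (fun k => Gp k 0)) x‖ₑ ^ p < ⊤) (R : ℝ) :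
    MemLp (wordDeriv w (stripExt ψ bm bp (fun k => Gm k 0) (fun k => Gp k 0)))
      (ENNReal.ofReal p) (volume.restrict (strip d bm bp ∩ Metric.closedBall 0 R)) := by
  have hms := measurableSet_strip (d := d) bm bp
  refine memLp_of_lintegral_enorm_rpow_lt_top (by linarith) ?_ ?_
  · exact (((wordDeriv_contDiffOn (isOpen_strip bm bp) (contDiffOn_stripExt hε.le h hGm hGp bm bp)
      w).continuousOn.mono inter_subset_left).aestronglyMeasurable
      (hms.inter Metric.isClosed_closedBall.measurableSet))
  · rcases hw with hw | hw
    · refine (lintegral_mono_set ?_).trans_lt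
        (lintegral_wordDeriv_stripExt_lt_top hε h hp w hw hGm hGp hb R)
      exact inter_subset_inter_right _ fun x hx =>
        (norm_fst_le x).trans (mem_closedBall_zero_iff.1 hx)
    · exact (lintegral_mono_set inter_subset_left).trans_lt hw

theorem hasNormalTrace_stripExt (hε : 0 < ε) (h : IsKernel ε ψ) (hψ : ∫ y, ψ y = 1) (hp : 1 < p)
    {Gm Gp : Fin m → (Fin d → ℕ) → HorSpace d → ℝ}
    (hGm : ∀ k : Fin m, IsJet p (m - 1 - k) (Gm k)) (hGp : ∀ k : Fin m, IsJet p (m - 1 - k) (Gp k))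
    {bm bp : ℝ} (hb : bm < bp)
    (hfin : ∀ w : List (Fin (d + 1)), w.length = m → ∫⁻ x in strip d bm bp,
      ‖wordDeriv w (stripExt ψ bm bp (fun k => Gm k 0) (fun k => Gp k 0)) x‖ₑ ^ p < ⊤)
    (k : Fin m) {gm gp : HorSpace d → ℝ} (hgm : MemLpLoc p gm) (hgp : MemLpLoc p gp)
    (hm : Gm k 0 =ᵐ[volume] gm) (hp' : Gp k 0 =ᵐ[volume] gp) {u : FullSpace d → ℝ}
    (hu : EqOn u (stripExt ψ bm bp (fun k => Gm k 0) (fun k => Gp k 0)) (strip d bm bp)) :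
    HasNormalTrace bm bp p k u gm gp := by
  have hopen := isOpen_strip (d := d) bm bp
  have hms := measurableSet_strip (d := d) bm bp
  have hsm := contDiffOn_stripExt hε.le h hGm hGp bm bp
  set v := stripExt ψ bm bp (fun k => Gm k 0) (fun k => Gp k 0) with hv
  set w : List (Fin (d + 1)) := List.replicate (k : ℕ) (Fin.last d) with hw
  have hwl : w.length < m := by simp [hw]
  refine ⟨wordDeriv w v, ?_, ?_⟩
  · have h1 := hasWeakPartial_iterDirDeriv (fBasis d) hopen (Pi.single (Fin.last d) (k : ℕ)) hsm
    have hperm : (w.map (fBasis d)).Perm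
        (dirList (fBasis d) (Pi.single (Fin.last d) (k : ℕ))) := by
      have := map_perm_dirList (fBasis d) w
      have hc : (fun i => w.count i) = Pi.single (Fin.last d) (k : ℕ) := by
        funext i
        rw [hw, List.count_replicate, Pi.single_apply]
        simp only [beq_iff_eq, @eq_comm _ (Fin.last d)]
      rwa [hc] at this
    have h2 := iterDirDeriv_perm hopen hsm hperm
    refine HasWeakPartial.congr_left hms ⟨h1.1, ?_, fun φ hφ hc hs => ?_⟩ hu
    · exact (wordDeriv_contDiffOn hopen hsm w).continuousOn.locallyIntegrableOn hms
    · rw [h1.2.2 φ hφ hc hs]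
      congr 1
      refine setIntegral_congr_fun hms fun x hx => ?_
      rw [← h2 hx]; rfl
  · refine hasTrace_of_contDiffOn hp.le hb (wordDeriv_contDiffOn hopen hsm w)
      (fun R => memLp_wordDeriv_stripExt hε h hp hGm hGp hb w (Or.inl hwl) R)
      (fun i R => memLp_wordDeriv_stripExt hε h hp hGm hGp hb (i :: w) ?_ R) hgm hgp ?_ ?_
    -- For k = m - 1 the gradient of the k-th normal derivative has order m, where integrability
    -- comes from the global energy bound.
    · rcases (Nat.succ_le_of_lt hwl).lt_or_eq with h1 | h1
      · exact Or.inl (by simpa using h1)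
      · exact Or.inr (hfin _ (by simpa using h1))
    · filter_upwards [hm, ae_tendsto_wordDeriv_stripExt_lower (Gp := Gp) hε h hψ (by linarith) k
        k.isLt hGm hb] with x' h1 h2
      rwa [← h1]
    · filter_upwards [hp', ae_tendsto_wordDeriv_stripExt_upper (Gm := Gm) hε h hψ (by linarith) k
        k.isLt hGp hb] with x' h1 h2
      rwa [← h1]

theorem memHomSobolev_stripExt (hε : 0 < ε) (h : IsKernel ε ψ) (hp : 1 < p)
    {Gm Gp : Fin m → (Fin d → ℕ) → HorSpace d → ℝ}
    (hGm : ∀ k : Fin m, IsJet p (m - 1 - k) (Gm k)) (hGp : ∀ k : Fin m, IsJet p (m - 1 - k) (Gp k))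
    {bm bp : ℝ} (hfin : ∀ w : List (Fin (d + 1)), w.length = m → ∫⁻ x in strip d bm bp,
      ‖wordDeriv w (stripExt ψ bm bp (fun k => Gm k 0) (fun k => Gp k 0)) x‖ₑ ^ p < ⊤)
    {u : FullSpace d → ℝ}
    (hu : EqOn u (stripExt ψ bm bp (fun k => Gm k 0) (fun k => Gp k 0)) (strip d bm bp)) :
    MemHomSobolev (fBasis d) (strip d bm bp) m p u := by
  have hopen := isOpen_strip (d := d) bm bp
  have hms := measurableSet_strip (d := d) bm bp
  have hsm := contDiffOn_stripExt hε.le h hGm hGp bm bp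
  have hwp := fun α => (hasWeakPartial_iterDirDeriv (fBasis d) hopen α hsm).congr_left hms hu
  refine ⟨(hwp 0).1, fun α hα => ⟨_, hwp α, ?_⟩⟩
  obtain ⟨w, hw, hwl⟩ := exists_word_dirList (fBasis d) α
  rw [← hw]
  refine memLp_of_lintegral_enorm_rpow_lt_top (by linarith)
    ((wordDeriv_contDiffOn hopen hsm w).continuousOn.aestronglyMeasurable hms) ?_
  exact hfin w (hwl.trans (mem_multiIdx.1 hα))

theorem gradEnergy_stripExt_le (hε : 0 < ε) (h : IsKernel ε ψ) (hψ : ∫ y, ψ y = 1)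
    (hp : 1 < p) : ∃ C : ℝ≥0∞, C ≠ ⊤ ∧ ∀ Gm Gp : Fin m → (Fin d → ℕ) → HorSpace d → ℝ,
      (∀ k : Fin m, IsJet p (m - 1 - k) (Gm k)) → (∀ k : Fin m, IsJet p (m - 1 - k) (Gp k)) →
      ∀ bm bp : ℝ, bm < bp → ∀ u : FullSpace d → ℝ,
        EqOn u (stripExt ψ bm bp (fun k => Gm k 0) (fun k => Gp k 0)) (strip d bm bp) →
        gradEnergy (fBasis d) (strip d bm bp) m p u ≤
        C * (mismatchEnergy p Gm Gp (bp - bm) + (dataEnergy p (ε * (bp - bm)) Gm +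
          dataEnergy p (ε * (bp - bm)) Gp)) := by
  choose w hw hwl using exists_word_dirList (fBasis d)
  choose C hC hCb using fun α : multiIdx (d + 1) m => lintegral_wordDeriv_stripExt_le (m := m)
    hε h hψ hp (w α) ((hwl α).trans (mem_multiIdx.1 α.2))
  refine ⟨((multiIdx (d + 1) m).card : ℝ≥0∞) ^ (p - 1) * ∑ α, C α,
    ENNReal.mul_ne_top (natCast_rpow_ne_top _ (by linarith)) (ENNReal.sum_ne_top.2 fun α _ => hC α),
    ?_⟩
  intro Gm Gp hGm hGp bm bp hb u hu
  have hopen := isOpen_strip (d := d) bm bp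
  have hsm := contDiffOn_stripExt hε.le h hGm hGp bm bp
  refine (gradEnergy_le hopen hp.le fun α _ => (hasWeakPartial_iterDirDeriv (fBasis d) hopen α
    hsm).congr_left (measurableSet_strip bm bp) hu).trans ?_
  rw [mul_assoc, Finset.sum_mul, ← Finset.sum_coe_sort]
  refine mul_le_mul' le_rfl (Finset.sum_le_sum fun α _ => ?_)
  rw [← hw]
  exact hCb α Gm Gp hGm hGp bm bp hb

/-- Additivity of the mollifications needs convergent integrals and points of the strip. So the map
is defined on the subspace of locally integrable data, set to zero off the strip, and then extended
to all data by linear algebra; its values off that subspace are irrelevant. -/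
theorem exists_linearMap_stripExt (h : IsKernel ε ψ) (bm bp : ℝ) :
    ∃ T : ((Fin m → HorSpace d → ℝ) × (Fin m → HorSpace d → ℝ)) →ₗ[ℝ] (FullSpace d → ℝ),
      ∀ fm fp : Fin m → HorSpace d → ℝ, (∀ k, LocallyIntegrable (fm k)) →
        (∀ k, LocallyIntegrable (fp k)) →
        EqOn (T (fm, fp)) (stripExt ψ bm bp fm fp) (strip d bm bp) := by
  let V : Submodule ℝ ((Fin m → HorSpace d → ℝ) × (Fin m → HorSpace d → ℝ)) :=
    { carrier := {q | (∀ k, LocallyIntegrable (q.1 k)) ∧ ∀ k, LocallyIntegrable (q.2 k)}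
      add_mem' := fun ha hb => ⟨fun k => (ha.1 k).add (hb.1 k), fun k => (ha.2 k).add (hb.2 k)⟩
      zero_mem' := ⟨fun _ => locallyIntegrable_zero, fun _ => locallyIntegrable_zero⟩
      smul_mem' := by
        rintro c q ⟨h₁, h₂⟩
        exact ⟨fun k => (h₁ k).smul c, fun k => (h₂ k).smul c⟩ }
  let T₀ : V →ₗ[ℝ] (FullSpace d → ℝ) :=
    { toFun := fun q => (strip d bm bp).indicator (stripExt ψ bm bp q.1.1 q.1.2)
      map_add' := fun q r => by
        rw [← indicator_add']
        refine indicator_congr fun x hx => ?_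
        have e1 := sideExt_add h q.2.1 r.2.1 ((sideGeom_lower bm bp).strip_subset hx)
        have e2 := sideExt_add h q.2.2 r.2.2 ((sideGeom_upper bm bp).strip_subset hx)
        have e3 : stripExt ψ bm bp (q + r).1.1 (q + r).1.2 x = stripExt ψ bm bp
          (fun k y => q.1.1 k y + r.1.1 k y) (fun k y => q.1.2 k y + r.1.2 k y) x := rfl
        rw [e3]
        simp only [stripExt, Pi.add_apply]
        rw [e1, e2]; ring
      map_smul' := fun c q => by
        funext x
        simp only [RingHom.id_apply, Pi.smul_apply]
        by_cases hx : x ∈ strip d bm bp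
        swap
        · simp only [indicator_of_notMem hx, smul_zero]
        simp only [indicator_of_mem hx]
        have e3 : stripExt ψ bm bp (c • q).1.1 (c • q).1.2 x = stripExt ψ bm bp
          (fun k y => c * q.1.1 k y) (fun k y => c * q.1.2 k y) x := rfl
        rw [e3]
        simp only [stripExt, sideExt_const_mul, smul_eq_mul]
        ring }
  obtain ⟨T, hT⟩ := LinearMap.exists_extend T₀
  refine ⟨T, fun fm fp hfm hfp x hx => ?_⟩
  have h1 : T (fm, fp) = T₀ ⟨(fm, fp), hfm, hfp⟩ := by rw [← hT]; rfl
  rw [h1]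
  exact indicator_of_mem hx _

end Main

end

/-! ### The extension theorem -/

theorem theorem3p12 (d m : ℕ) (hd : 1 ≤ d) (hm : 2 ≤ m) (p ρ : ℝ) (hp : 1 < p) (hρ : 0 < ρ) :
    ∃ c : ℝ, 0 < c ∧ ∀ bm bp a : ℝ, bm < bp → 0 < a → ρ * (bp - bm) ≤ a →
      ∃ T : ((Fin m → HorSpace d → ℝ) × (Fin m → HorSpace d → ℝ)) →ₗ[ℝ] (FullSpace d → ℝ),
        ∀ fm fp : Fin m → HorSpace d → ℝ, AdmissibleData p a (bp - bm) fm fp →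
          MemHomSobolev (fBasis d) (strip d bm bp) m p (T (fm, fp)) ∧
          (∀ k : Fin m, HasNormalTrace bm bp p k (T (fm, fp)) (fm k) (fp k)) ∧
          gradEnergy (fBasis d) (strip d bm bp) m p (T (fm, fp)) ≤
            ENNReal.ofReal c *
                ∑ n ∈ Finset.range m, ∑ i ∈ Finset.range (m - n),
                  ENNReal.ofReal ((bp - bm) ^ (((n : ℝ) + i - m) * p + 1)) *
                    Qenergy p (bp - bm) i n fm fp
              + ENNReal.ofReal c * ∑ k : Fin m, screenedEnergy p a (m - 1 - k) (fm k)
              + ENNReal.ofReal c * ∑ k : Fin m, screenedEnergy p a (m - 1 - k) (fp k) := by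
  have hp0 : 0 ≤ p := by linarith
  -- The kernel has radius ρ, so over a strip of width b only differences with |h| < ρb ≤ a enter.
  obtain ⟨ψ, h, hψ⟩ := exists_isKernel_integral_eq_one d hρ
  obtain ⟨C, hC, hCb⟩ := gradEnergy_stripExt_le (m := m) hρ h hψ hp
  set K₁ : ℝ≥0∞ := ∑ i ∈ Finset.range m, ((multiIdx d i).card : ℝ≥0∞) with hK₁
  set K₂ : ℝ≥0∞ := ∑ k : Fin m, ((multiIdx d (m - 1 - k)).card : ℝ≥0∞) with hK₂
  have hK₁t : K₁ ≠ ⊤ := ENNReal.sum_ne_top.2 fun _ _ => ENNReal.natCast_ne_top _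
  have hK₂t : K₂ ≠ ⊤ := ENNReal.sum_ne_top.2 fun _ _ => ENNReal.natCast_ne_top _
  have hCK : C * (K₁ + K₂) ≠ ⊤ := ENNReal.mul_ne_top hC (ENNReal.add_ne_top.2 ⟨hK₁t, hK₂t⟩)
  -- K₁ and K₂ count multi-indices, for passing from components to vectors; adding 1 makes the
  -- constant positive. It is fixed before the strip and a.
  refine ⟨(C * (K₁ + K₂)).toReal + 1, by positivity, fun bm bp a hb ha hρa => ?_⟩
  have hc : C * (K₁ + K₂) ≤ ENNReal.ofReal ((C * (K₁ + K₂)).toReal + 1) :=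
    (ENNReal.ofReal_toReal hCK).symm.le.trans (ENNReal.ofReal_le_ofReal (by linarith))
  obtain ⟨T, hT⟩ := exists_linearMap_stripExt (m := m) h bm bp
  refine ⟨T, fun fm fp hadm => ?_⟩
  have hjm := fun k => (hadm.regular_minus k).isJet hp.le
  have hjp := fun k => (hadm.regular_plus k).isJet hp.le
  have hzm := fun k => (hadm.regular_minus k).jetRep_zero_ae_eq hp.le
  have hzp := fun k => (hadm.regular_plus k).jetRep_zero_ae_eq hp.le
  -- The linear map acts on the data themselves and the estimates on their measurable
  -- representatives; mollification does not distinguish them.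
  have hu : EqOn (T (fm, fp)) (stripExt ψ bm bp (fun k => jetRep (fm k) 0)
      (fun k => jetRep (fp k) 0)) (strip d bm bp) := by
    refine (hT fm fp (fun k => (hadm.regular_minus k).1.locallyIntegrable hp.le)
      (fun k => (hadm.regular_plus k).1.locallyIntegrable hp.le)).trans fun x _ => ?_
    simp only [stripExt]
    rw [sideExt_congr_ae (g := fm) hzm, sideExt_congr_ae (g := fp) hzp]
  have hmis := mismatchEnergy_jetRep_le hp0 hadm.regular_minus hadm.regular_plus (bp - bm)
  have hdm := dataEnergy_jetRep_le hp0 hadm.regular_minus hρa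
  have hdp := dataEnergy_jetRep_le hp0 hadm.regular_plus hρa
  rw [← hK₁] at hmis
  rw [← hK₂] at hdm hdp
  have hSm : ∑ k : Fin m, screenedEnergy p a (m - 1 - k) (fm k) < ⊤ :=
    ENNReal.sum_lt_top.2 fun k _ => hadm.screened_minus k
  have hSp : ∑ k : Fin m, screenedEnergy p a (m - 1 - k) (fp k) < ⊤ :=
    ENNReal.sum_lt_top.2 fun k _ => hadm.screened_plus k
  have hQ : ∑ n ∈ Finset.range m, ∑ i ∈ Finset.range (m - n),
      ENNReal.ofReal ((bp - bm) ^ (((n : ℝ) + i - m) * p + 1)) *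
        Qenergy p (bp - bm) i n fm fp < ⊤ :=
    ENNReal.sum_lt_top.2 fun n hn => ENNReal.sum_lt_top.2 fun i hi =>
      ENNReal.mul_lt_top ENNReal.ofReal_lt_top (hadm.compatible i n (by
        have := Finset.mem_range.1 hn
        have := Finset.mem_range.1 hi
        omega))
  set Q := ∑ n ∈ Finset.range m, ∑ i ∈ Finset.range (m - n),
      ENNReal.ofReal ((bp - bm) ^ (((n : ℝ) + i - m) * p + 1)) *
        Qenergy p (bp - bm) i n fm fp
  set Sm := ∑ k : Fin m, screenedEnergy p a (m - 1 - k) (fm k)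
  set Sp := ∑ k : Fin m, screenedEnergy p a (m - 1 - k) (fp k)
  have hX : mismatchEnergy p (fun k => jetRep (fm k)) (fun k => jetRep (fp k)) (bp - bm) +
      (dataEnergy p (ρ * (bp - bm)) (fun k => jetRep (fm k)) +
        dataEnergy p (ρ * (bp - bm)) (fun k => jetRep (fp k))) ≤ K₁ * Q + (K₂ * Sm + K₂ * Sp) :=
    add_le_add hmis (add_le_add hdm hdp)
  have hfin : ∀ w : List (Fin (d + 1)), w.length = m → ∫⁻ x in strip d bm bp,
      ‖wordDeriv w (stripExt ψ bm bp (fun k => jetRep (fm k) 0)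
        (fun k => jetRep (fp k) 0)) x‖ₑ ^ p < ⊤ := by
    intro w hw
    obtain ⟨C', hC', hCb'⟩ := lintegral_wordDeriv_stripExt_le (m := m) hρ h hψ hp w hw
    refine (hCb' (fun k => jetRep (fm k)) (fun k => jetRep (fp k)) hjm hjp bm bp hb).trans_lt
      (ENNReal.mul_lt_top hC'.lt_top (hX.trans_lt ?_))
    exact ENNReal.add_lt_top.2 ⟨ENNReal.mul_lt_top hK₁t.lt_top hQ, ENNReal.add_lt_top.2
      ⟨ENNReal.mul_lt_top hK₂t.lt_top hSm, ENNReal.mul_lt_top hK₂t.lt_top hSp⟩⟩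
  refine ⟨memHomSobolev_stripExt hρ h hp hjm hjp hfin hu, fun k =>
    hasNormalTrace_stripExt hρ h hψ hp hjm hjp hb hfin k (hadm.regular_minus k).1
      (hadm.regular_plus k).1 (hzm k) (hzp k) hu, ?_⟩
  refine (hCb (fun k => jetRep (fm k)) (fun k => jetRep (fp k)) hjm hjp bm bp hb _ hu).trans ?_
  calc _ ≤ C * (K₁ * Q + (K₂ * Sm + K₂ * Sp)) := mul_le_mul' le_rfl hX
    _ ≤ C * ((K₁ + K₂) * Q + ((K₁ + K₂) * Sm + (K₁ + K₂) * Sp)) := by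
        gcongr
        · exact le_self_add
        · exact le_add_self
        · exact le_add_self
    _ = C * (K₁ + K₂) * Q + C * (K₁ + K₂) * Sm + C * (K₁ + K₂) * Sp := by ring
    _ ≤ _ := by gcongr
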